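/- Let $1<\alpha\le 2$, $\delta\in\mathbb{R}$ and $h_*\ge 0$. Consider the Ising model with spins $\sigma\in\{-1,+1\}^{\mathbb{Z}}$, coupling $J(r)=r^{-\alpha}$ for $r\ge 1$ and $J(0)=0$, and external field $h_0=h_*$, $h_x=h_*|x|^{-\delta}$ for $x\neq 0$, that is, with the formal Hamiltonian $$H(\sigma)=\sum_{x<y}J(|x-y|)(1-\sigma_x\sigma_y)+\sum_x h_x(1-\sigma_x).$$ Let $\langle\cdot\rangle^{\pm}_{\beta,L}$ be the Gibbs state in $[-L,L]\cap\mathbb{Z}$ at inverse temperature $\beta$ when all spins outside $[-L,L]$ equal $\pm1$. We say that there is a phase transition if there is $\bar\beta>0$, which may depend on $\alpha,\delta,h_*$, such that for every $\beta\ge\bar\beta$ the limits $\langle\sigma_0\rangle^{\pm}_{\beta}=\lim_{L\to\infty}\langle\sigma_0\rangle^{\pm}_{\beta,L}$ exist, $\langle\sigma_0\rangle^{-}_{\beta}\neq\langle\sigma_0\rangle^{+}_{\beta}$, and the model has at least two infinite-volume Gibbs measures (solutions of the DLR equations) at inverse temperature $\beta$. (i) If $\delta>\alpha-1$, there is a phase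 transition, for every $h_*\ge 0$. (ii) If $\delta=\alpha-1$ and $1<\alpha<2$, there is a phase transition whenever $$h_*<\frac{8-4\alpha}{2^{3-\alpha}+6-3\alpha}.$$ (iii) If $\alpha=2$ and $\delta=1$, there is a phase transition whenever $$h_*<\frac{4}{3+2\log 2}.$$ -/

import Mathlib

/-!
One-dimensional long-range ferromagnetic Ising model with an external field.
-/

namespace LongRangeIsing

open MeasureTheory Filter Topology

/-- Spin configurations on `ℤ`: `true` stands for the spin `+1`, `false` for the spin `-1`.
The space carries the product topology and the product sigma-algebra. -/
abbrev Config : Type := ℤ → Bool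

/-- The value `±1` of a spin. -/
def spin (b : Bool) : ℝ := if b then 1 else -1

/-- The coupling `J(r) = r ^ (-α)` for `r > 0`, and `J(0) = 0`. -/
noncomputable def coupling (α : ℝ) (r : ℕ) : ℝ :=
  if r = 0 then 0 else (r : ℝ) ^ (-α)

/-- The polynomially decaying field `h_0 = hs`, `h_x = hs * |x| ^ (-δ)` for `x ≠ 0`. -/
noncomputable def decayingField (hs δ : ℝ) (x : ℤ) : ℝ :=
  if x = 0 then hs else hs * |(x : ℝ)| ^ (-δ)

/-- The Hamiltonian in the finite volume `Λ`,
`∑ J(|x - y|) (1 - σ_x σ_y) + ∑_{x ∈ Λ} h_x (1 - σ_x)`,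
where the first sum runs over the pairs `x < y` that meet `Λ`. If `σ` is constant outside `Λ`,
all other pairs contribute `0`, so the first sum is then the sum over all pairs `x < y`. -/
noncomputable def hamiltonian (α : ℝ) (h : ℤ → ℝ) (Λ : Finset ℤ) (σ : Config) : ℝ :=
  (∑' p : ℤ × ℤ, if p.1 < p.2 ∧ (p.1 ∈ Λ ∨ p.2 ∈ Λ) then
      coupling α (p.1 - p.2).natAbs * (1 - spin (σ p.1) * spin (σ p.2)) else 0)
    + ∑ x ∈ Λ, h x * (1 - spin (σ x))

/-- The configuration that equals `τ` in `Λ` and `ω` outside `Λ`. -/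
def glue (Λ : Finset ℤ) (τ : Λ → Bool) (ω : Config) : Config :=
  fun x => if hx : x ∈ Λ then τ ⟨x, hx⟩ else ω x

/-- The partition function in `Λ` at inverse temperature `β` with boundary condition `ω`. -/
noncomputable def partitionFunction (α : ℝ) (h : ℤ → ℝ) (β : ℝ) (Λ : Finset ℤ) (ω : Config) : ℝ :=
  ∑ τ : Λ → Bool, Real.exp (-β * hamiltonian α h Λ (glue Λ τ ω))

/-- The finite-volume Gibbs expectation of `f` in `Λ` at inverse temperature `β` with boundary
condition `ω`. -/
noncomputable def gibbsExp (α : ℝ) (h : ℤ → ℝ) (β : ℝ) (Λ : Finset ℤ) (f : Config → ℝ)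
    (ω : Config) : ℝ :=
  (∑ τ : Λ → Bool, f (glue Λ τ ω) * Real.exp (-β * hamiltonian α h Λ (glue Λ τ ω)))
    / partitionFunction α h β Λ ω

/-- The box `[-L, L] ∩ ℤ`. -/
noncomputable def box (L : ℕ) : Finset ℤ := Finset.Icc (-(L : ℤ)) (L : ℤ)

/-- The expectation of the spin at the origin in `[-L, L]`, with all spins outside the box equal
to `b` (`b = true`: plus boundary condition, `b = false`: minus boundary condition). -/
noncomputable def magnetization (α : ℝ) (h : ℤ → ℝ) (β : ℝ) (b : Bool) (L : ℕ) : ℝ :=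
  gibbsExp α h β (box L) (fun σ => spin (σ 0)) (fun _ => b)

/-- Infinite-volume Gibbs measures at inverse temperature `β`, through the
Dobrushin-Lanford-Ruelle equations. -/
def IsGibbsMeasure (α : ℝ) (h : ℤ → ℝ) (β : ℝ) (μ : Measure Config) : Prop :=
  IsProbabilityMeasure μ ∧
    ∀ (Λ : Finset ℤ) (A : Set Config), MeasurableSet A →
      μ A = ∫⁻ ω, ENNReal.ofReal (gibbsExp α h β Λ (A.indicator fun _ => 1) ω) ∂μ

/-- Phase transition at low temperature: for all large `β` the infinite-volume limits of the
plus and of the minus magnetization at the origin exist and differ, and there is more than one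
infinite-volume Gibbs measure. -/
def HasPhaseTransition (α : ℝ) (h : ℤ → ℝ) : Prop :=
  ∃ β₀ : ℝ, 0 < β₀ ∧ ∀ β : ℝ, β₀ ≤ β →
    (∃ mMinus mPlus : ℝ,
      Tendsto (magnetization α h β false) atTop (𝓝 mMinus) ∧
      Tendsto (magnetization α h β true) atTop (𝓝 mPlus) ∧
      mMinus ≠ mPlus) ∧
    ∃ μ ν : Measure Config, IsGibbsMeasure α h β μ ∧ IsGibbsMeasure α h β ν ∧ μ ≠ ν

end LongRangeIsing

namespace LongRangeIsing

open MeasureTheory Filter Topology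
open scoped ENNReal

/-! A Peierls argument combined with FKG monotonicity. Both thresholds in (ii) and (iii) are at most
1, and in (i) the field is eventually below half the critical one. So it suffices to treat fields
that, off a finite set `D`, lie between 0 and κ|x|^(1-α) with κ < 1
(`hasPhaseTransition_of_field_le`).

Soft part. The Hamiltonian is submodular, so Gibbs expectations of increasing functions increase
with the boundary condition (`gibbsExp_mono`). Hence the plus and minus magnetizations are monotone
in the box and converge, and compactness realizes the limits by Gibbs measures; a uniform gap in
large boxes is all that is needed. Changing the field on `D` multiplies the weights by a local
density, and a positive gap survives this (`exists_separated_of_field_eq_off`), so the field may be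
set to 0 on `D`.

Energy. Flipping the inside `B` of a contour gains the coupling across `B`, except for pairs that
were already aligned, and costs at most twice the sum of the field over `B`. By isoperimetry the
coupling across `B`, counted over ordered pairs, is at least 4 ∑ n^(1-α) over n ≤ |B|, while the
critical field sums to at most 2 ∑ n^(1-α); so the field uses up at most the fraction κ
(`sum_field_le`).

Contours. The boundary points between plus and minus spins are partitioned, as finely as possible,
into even sets that are pairwise separated: their distance exceeds a quarter of the length scale
following that of the smaller set, where each scale is roughly the 5/4 power of the one before.
Separation makes the aligned pairs across a contour a small fraction of its cut (`pairSum_same_le`).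

Entropy. Since a contour cannot be split, an isolated cluster of its points is odd, so all pairs
straddling the cluster within the surrounding gap are cut. At r^(-2) or slower decay this costs
energy proportional to the logarithm of the length. Consequently the number of dyadic blocks of all
lengths that meet a contour is at most a constant times its cut (`blockCount_le_pairSum_cut`), and
contours around the origin are summable against that number (`sum_pow_blockCount_le`). -/

/-! ### Spins, couplings and continuity of the Hamiltonian. -/

lemma spin_true : spin true = 1 := rfl

lemma spin_false : spin false = -1 := rfl

lemma abs_spin (b : Bool) : |spin b| = 1 := by cases b <;> simp [spin]

lemma spin_mono : Monotone spin := by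
  intro a b hab
  cases a <;> cases b
  · exact le_rfl
  · norm_num [spin]
  · exact absurd hab (by decide)
  · exact le_rfl

lemma coupling_nonneg (α : ℝ) (r : ℕ) : 0 ≤ coupling α r := by
  unfold coupling; split_ifs <;> positivity

lemma coupling_pos (α : ℝ) {r : ℕ} (hr : r ≠ 0) : 0 < coupling α r := by
  rw [coupling, if_neg hr]
  have : (0 : ℝ) < r := by exact_mod_cast Nat.pos_of_ne_zero hr
  positivity

lemma summable_coupling_nat {α : ℝ} (hα : 1 < α) : Summable (coupling α) := by
  refine Summable.of_nonneg_of_le (coupling_nonneg α) (fun r => ?_)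
    (Real.summable_nat_rpow.2 (show -α < -1 by linarith))
  unfold coupling
  split_ifs
  · positivity
  · exact le_rfl

lemma summable_coupling_int {α : ℝ} (hα : 1 < α) :
    Summable fun n : ℤ => coupling α n.natAbs := by
  apply Summable.of_nat_of_neg <;> simpa using summable_coupling_nat hα

lemma summable_coupling_sub {α : ℝ} (hα : 1 < α) (x : ℤ) :
    Summable fun y : ℤ => coupling α (x - y).natAbs :=
  (summable_coupling_int hα).comp_injective (i := fun y : ℤ => x - y) fun _ _ h => by
    simpa using h

lemma coupling_natAbs_comm (α : ℝ) (x y : ℤ) :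
    coupling α (x - y).natAbs = coupling α (y - x).natAbs := by
  rw [← Int.natAbs_neg, neg_sub]

/-- The coupling between the sites of a pair, restricted to the pairs that meet `Λ`. -/
noncomputable def touchingCoupling (α : ℝ) (Λ : Finset ℤ) (p : ℤ × ℤ) : ℝ :=
  if p.1 ∈ Λ ∨ p.2 ∈ Λ then coupling α (p.1 - p.2).natAbs else 0

lemma touchingCoupling_nonneg (α : ℝ) (Λ : Finset ℤ) (p : ℤ × ℤ) :
    0 ≤ touchingCoupling α Λ p := by
  unfold touchingCoupling; split_ifs; exacts [coupling_nonneg _ _, le_rfl]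

/-- The pairs that meet a finite set are covered by finitely many rows and columns, each summable
because α > 1. This one majorant serves for all configurations at once. -/
lemma summable_touchingCoupling {α : ℝ} (hα : 1 < α) (Λ : Finset ℤ) :
    Summable (touchingCoupling α Λ) := by
  have h1 : ∀ x : ℤ, Summable fun p : ℤ × ℤ =>
      if p.1 = x then coupling α (p.1 - p.2).natAbs else 0 := by
    intro x
    have hinj : Function.Injective fun y : ℤ => (x, y) := fun a b h => by simpa using h
    rw [← hinj.summable_iff]
    · simpa [Function.comp_def] using summable_coupling_sub hα x
    · rintro ⟨a, b⟩ hab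
      rw [if_neg]
      rintro rfl
      exact hab ⟨b, rfl⟩
  have h2 : ∀ x : ℤ, Summable fun p : ℤ × ℤ =>
      if p.2 = x then coupling α (p.1 - p.2).natAbs else 0 := by
    intro x
    refine ((Equiv.prodComm ℤ ℤ).summable_iff.2 (h1 x)).congr fun p => ?_
    simp [coupling_natAbs_comm α p.1 p.2]
  refine Summable.of_nonneg_of_le (touchingCoupling_nonneg α Λ) (fun p => ?_)
    ((summable_sum fun x (_ : x ∈ Λ) => h1 x).add (summable_sum fun x (_ : x ∈ Λ) => h2 x))
  have hc := coupling_nonneg α (p.1 - p.2).natAbs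
  simp only [touchingCoupling, Finset.sum_ite_eq]
  by_cases h : p.1 ∈ Λ <;> by_cases h' : p.2 ∈ Λ <;> simp [h, h', hc]

/-- The contribution of a pair of sites to the Hamiltonian in `Λ`. -/
noncomputable def pairEnergy (α : ℝ) (Λ : Finset ℤ) (σ : Config) (p : ℤ × ℤ) : ℝ :=
  if p.1 < p.2 ∧ (p.1 ∈ Λ ∨ p.2 ∈ Λ) then
    coupling α (p.1 - p.2).natAbs * (1 - spin (σ p.1) * spin (σ p.2)) else 0

lemma hamiltonian_eq (α : ℝ) (h : ℤ → ℝ) (Λ : Finset ℤ) (σ : Config) :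
    hamiltonian α h Λ σ = (∑' p, pairEnergy α Λ σ p) + ∑ x ∈ Λ, h x * (1 - spin (σ x)) := rfl

lemma abs_pairEnergy_le (α : ℝ) (Λ : Finset ℤ) (σ : Config) (p : ℤ × ℤ) :
    ‖pairEnergy α Λ σ p‖ ≤ 2 * touchingCoupling α Λ p := by
  have hc := coupling_nonneg α (p.1 - p.2).natAbs
  have h2 : |1 - spin (σ p.1) * spin (σ p.2)| ≤ 2 := by
    cases σ p.1 <;> cases σ p.2 <;> norm_num [spin]
  unfold pairEnergy touchingCoupling
  by_cases h : p.1 ∈ Λ ∨ p.2 ∈ Λ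
  · rw [if_pos h]
    split_ifs
    · rw [Real.norm_eq_abs, abs_mul, abs_of_nonneg hc, mul_comm]
      gcongr
    · simpa using hc
  · simp [h]

lemma summable_pairEnergy {α : ℝ} (hα : 1 < α) (Λ : Finset ℤ) (σ : Config) :
    Summable (pairEnergy α Λ σ) :=
  Summable.of_norm_bounded ((summable_touchingCoupling hα Λ).mul_left 2) (abs_pairEnergy_le α Λ σ)

lemma continuous_eval_bool {f : Bool → ℝ} (x : ℤ) : Continuous fun σ : Config => f (σ x) :=
  (continuous_of_discreteTopology (f := f)).comp (continuous_apply x)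

/-- Weierstrass test: the majorant of the pair energies does not depend on the configuration.
Continuity in the product topology is what lets the DLR equations pass to weak limits. -/
lemma continuous_hamiltonian {α : ℝ} (hα : 1 < α) (h : ℤ → ℝ) (Λ : Finset ℤ) :
    Continuous (hamiltonian α h Λ) := by
  have hs : ∀ x, Continuous fun σ : Config => spin (σ x) := fun x => continuous_eval_bool x
  refine Continuous.add (continuous_tsum (fun p => ?_)
    ((summable_touchingCoupling hα Λ).mul_left 2) (fun p σ => abs_pairEnergy_le α Λ σ p)) ?_
  · by_cases hp : p.1 < p.2 ∧ (p.1 ∈ Λ ∨ p.2 ∈ Λ)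
    · simp only [if_pos hp]
      have := hs p.1
      have := hs p.2
      fun_prop
    · simp only [if_neg hp]
      exact continuous_const
  · exact continuous_finsetSum _ fun x _ => by
      have := hs x
      fun_prop

/-! ### Finite-volume Gibbs expectations and their consistency. -/

lemma glue_apply_mem {Λ : Finset ℤ} {τ : Λ → Bool} {ω : Config} {x : ℤ} (hx : x ∈ Λ) :
    glue Λ τ ω x = τ ⟨x, hx⟩ := dif_pos hx

lemma glue_apply_not_mem {Λ : Finset ℤ} {τ : Λ → Bool} {ω : Config} {x : ℤ} (hx : x ∉ Λ) :
    glue Λ τ ω x = ω x := dif_neg hx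

lemma glue_restrict (Λ : Finset ℤ) {σ ω : Config} (h : ∀ x ∉ Λ, σ x = ω x) :
    glue Λ (fun x => σ x) ω = σ := by
  funext x
  by_cases hx : x ∈ Λ
  · rw [glue_apply_mem hx]
  · rw [glue_apply_not_mem hx, h x hx]

lemma glue_glue (Λ : Finset ℤ) (τ τ' : Λ → Bool) (ω : Config) :
    glue Λ τ (glue Λ τ' ω) = glue Λ τ ω := by
  funext x
  by_cases hx : x ∈ Λ
  · simp only [glue_apply_mem hx]
  · simp only [glue_apply_not_mem hx]

lemma continuous_glue (Λ : Finset ℤ) (τ : Λ → Bool) : Continuous (glue Λ τ) := by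
  refine continuous_pi fun x => ?_
  by_cases hx : x ∈ Λ
  · simp only [glue_apply_mem hx]; exact continuous_const
  · simp only [glue_apply_not_mem hx]; exact continuous_apply x

/-- The Boltzmann weight of a configuration in the volume `Λ`. -/
noncomputable def weight (α : ℝ) (h : ℤ → ℝ) (β : ℝ) (Λ : Finset ℤ) (σ : Config) : ℝ :=
  Real.exp (-β * hamiltonian α h Λ σ)

lemma weight_pos (α : ℝ) (h : ℤ → ℝ) (β : ℝ) (Λ : Finset ℤ) (σ : Config) :
    0 < weight α h β Λ σ := Real.exp_pos _

lemma continuous_weight {α : ℝ} (hα : 1 < α) (h : ℤ → ℝ) (β : ℝ) (Λ : Finset ℤ) :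
    Continuous (weight α h β Λ) :=
  Real.continuous_exp.comp (continuous_const.mul (continuous_hamiltonian hα h Λ))

lemma partitionFunction_eq (α : ℝ) (h : ℤ → ℝ) (β : ℝ) (Λ : Finset ℤ) (ω : Config) :
    partitionFunction α h β Λ ω = ∑ τ : Λ → Bool, weight α h β Λ (glue Λ τ ω) := rfl

lemma partitionFunction_pos (α : ℝ) (h : ℤ → ℝ) (β : ℝ) (Λ : Finset ℤ) (ω : Config) :
    0 < partitionFunction α h β Λ ω :=
  Finset.sum_pos (fun _ _ => weight_pos α h β Λ _) Finset.univ_nonempty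

lemma gibbsExp_eq (α : ℝ) (h : ℤ → ℝ) (β : ℝ) (Λ : Finset ℤ) (f : Config → ℝ) (ω : Config) :
    gibbsExp α h β Λ f ω =
      (∑ τ : Λ → Bool, f (glue Λ τ ω) * weight α h β Λ (glue Λ τ ω)) /
        partitionFunction α h β Λ ω := rfl

lemma gibbsExp_const (α : ℝ) (h : ℤ → ℝ) (β : ℝ) (Λ : Finset ℤ) (c : ℝ) (ω : Config) :
    gibbsExp α h β Λ (fun _ => c) ω = c := by
  rw [gibbsExp_eq, ← Finset.mul_sum, ← partitionFunction_eq,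
    mul_div_cancel_right₀ _ (partitionFunction_pos α h β Λ ω).ne']

lemma gibbsExp_add (α : ℝ) (h : ℤ → ℝ) (β : ℝ) (Λ : Finset ℤ) (f g : Config → ℝ) (ω : Config) :
    gibbsExp α h β Λ (fun σ => f σ + g σ) ω =
      gibbsExp α h β Λ f ω + gibbsExp α h β Λ g ω := by
  simp only [gibbsExp_eq, add_mul, Finset.sum_add_distrib, add_div]

lemma gibbsExp_const_mul (α : ℝ) (h : ℤ → ℝ) (β : ℝ) (Λ : Finset ℤ) (c : ℝ) (f : Config → ℝ)
    (ω : Config) :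
    gibbsExp α h β Λ (fun σ => c * f σ) ω = c * gibbsExp α h β Λ f ω := by
  simp only [gibbsExp_eq, mul_assoc, ← Finset.mul_sum, mul_div_assoc]

lemma gibbsExp_le_of_glue (α : ℝ) (h : ℤ → ℝ) (β : ℝ) (Λ : Finset ℤ) {f g : Config → ℝ}
    {ω : Config} (hfg : ∀ τ, f (glue Λ τ ω) ≤ g (glue Λ τ ω)) :
    gibbsExp α h β Λ f ω ≤ gibbsExp α h β Λ g ω := by
  have hZ := partitionFunction_pos α h β Λ ω
  rw [gibbsExp_eq, gibbsExp_eq]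
  gcongr with τ
  · exact (weight_pos α h β Λ _).le
  · exact hfg τ

lemma gibbsExp_le (α : ℝ) (h : ℤ → ℝ) (β : ℝ) (Λ : Finset ℤ) {f g : Config → ℝ} (hfg : f ≤ g)
    (ω : Config) : gibbsExp α h β Λ f ω ≤ gibbsExp α h β Λ g ω :=
  gibbsExp_le_of_glue α h β Λ fun _ => hfg _

lemma gibbsExp_congr_glue (α : ℝ) (h : ℤ → ℝ) (β : ℝ) (Λ : Finset ℤ) {f g : Config → ℝ}
    {ω : Config} (hfg : ∀ τ, f (glue Λ τ ω) = g (glue Λ τ ω)) :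
    gibbsExp α h β Λ f ω = gibbsExp α h β Λ g ω :=
  (gibbsExp_le_of_glue α h β Λ fun τ => (hfg τ).le).antisymm
    (gibbsExp_le_of_glue α h β Λ fun τ => (hfg τ).ge)

/-- The Hamiltonians in two nested volumes differ by a function of the spins outside the
smaller one. -/
lemma hamiltonian_sub_congr {α : ℝ} (hα : 1 < α) (h : ℤ → ℝ) {Λ Λ' : Finset ℤ} (hΛ : Λ ⊆ Λ')
    {σ σ' : Config} (hσ : ∀ x ∉ Λ, σ x = σ' x) :
    hamiltonian α h Λ' σ - hamiltonian α h Λ σ =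
      hamiltonian α h Λ' σ' - hamiltonian α h Λ σ' := by
  have key : ∀ σ : Config, hamiltonian α h Λ' σ - hamiltonian α h Λ σ =
      (∑' p, (pairEnergy α Λ' σ p - pairEnergy α Λ σ p)) +
        ∑ x ∈ Λ' \ Λ, h x * (1 - spin (σ x)) := by
    intro σ
    rw [(summable_pairEnergy hα Λ' σ).tsum_sub (summable_pairEnergy hα Λ σ), hamiltonian_eq,
      hamiltonian_eq, ← Finset.sum_sdiff hΛ]
    ring
  rw [key, key]
  congr 1
  · refine tsum_congr fun p => ?_
    unfold pairEnergy
    by_cases h1 : p.1 ∈ Λ <;> by_cases h2 : p.2 ∈ Λ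
    · simp [h1, h2, hΛ h1]
    · simp [h1, hΛ h1]
    · simp [h2, hΛ h2]
    · simp [h1, h2, hσ _ h1, hσ _ h2]
  · exact Finset.sum_congr rfl fun x hx => by rw [hσ x (Finset.mem_sdiff.1 hx).2]

/-- Detailed balance: resampling in the small volume is reversible for the weights of the large one.
-/
lemma weight_mul_weight_comm {α : ℝ} (hα : 1 < α) (h : ℤ → ℝ) (β : ℝ) {Λ Λ' : Finset ℤ}
    (hΛ : Λ ⊆ Λ') {σ σ' : Config} (hσ : ∀ x ∉ Λ, σ x = σ' x) :
    weight α h β Λ' σ * weight α h β Λ σ' = weight α h β Λ' σ' * weight α h β Λ σ := by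
  have := hamiltonian_sub_congr hα h hΛ hσ
  unfold weight
  rw [← Real.exp_add, ← Real.exp_add]
  congr 1
  linear_combination (-β) * this

lemma glue_eq_off {Λ Λ' : Finset ℤ} (hΛ : Λ ⊆ Λ') (τ : Λ → Bool) (τ' : Λ' → Bool) (ω : Config) :
    glue Λ' (fun x => glue Λ τ (glue Λ' τ' ω) x) ω = glue Λ τ (glue Λ' τ' ω) := by
  refine glue_restrict Λ' fun x hx => ?_
  rw [glue_apply_not_mem fun h => hx (hΛ h), glue_apply_not_mem hx]

/-- Consistency of the finite-volume Gibbs expectations. -/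
lemma gibbsExp_gibbsExp {α : ℝ} (hα : 1 < α) (h : ℤ → ℝ) (β : ℝ) {Λ Λ' : Finset ℤ}
    (hΛ : Λ ⊆ Λ') (f : Config → ℝ) (ω : Config) :
    gibbsExp α h β Λ' (gibbsExp α h β Λ f) ω = gibbsExp α h β Λ' f ω := by
  rw [gibbsExp_eq, gibbsExp_eq]
  congr 1
  set F : (Λ' → Bool) × (Λ → Bool) → ℝ := fun q =>
    f (glue Λ q.2 (glue Λ' q.1 ω)) * weight α h β Λ (glue Λ q.2 (glue Λ' q.1 ω)) /
      partitionFunction α h β Λ (glue Λ' q.1 ω) * weight α h β Λ' (glue Λ' q.1 ω) with hF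
  set G : (Λ' → Bool) × (Λ → Bool) → ℝ := fun q =>
    f (glue Λ' q.1 ω) * weight α h β Λ' (glue Λ' q.1 ω) *
      (weight α h β Λ (glue Λ q.2 (glue Λ' q.1 ω)) /
        partitionFunction α h β Λ (glue Λ' q.1 ω)) with hG
  have hl : ∑ τ' : Λ' → Bool, gibbsExp α h β Λ f (glue Λ' τ' ω) * weight α h β Λ' (glue Λ' τ' ω)
      = ∑ q, F q := by
    rw [Fintype.sum_prod_type]
    refine Finset.sum_congr rfl fun τ' _ => ?_
    rw [gibbsExp_eq, Finset.sum_div, Finset.sum_mul]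
  have hr : ∑ τ' : Λ' → Bool, f (glue Λ' τ' ω) * weight α h β Λ' (glue Λ' τ' ω) = ∑ q, G q := by
    rw [Fintype.sum_prod_type]
    refine Finset.sum_congr rfl fun τ' _ => ?_
    simp only [hG]
    rw [← Finset.mul_sum, ← Finset.sum_div, ← partitionFunction_eq,
      div_self (partitionFunction_pos α h β Λ _).ne', mul_one]
  rw [hl, hr]
  -- This involution exchanges the spins in Λ before and after resampling; by detailed balance it
  -- carries `F` to `G`.
  set s : (Λ' → Bool) × (Λ → Bool) → (Λ' → Bool) × (Λ → Bool) := fun q =>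
    (fun x => glue Λ q.2 (glue Λ' q.1 ω) x, fun x => glue Λ' q.1 ω x) with hs
  have hs1 : ∀ q, glue Λ' (s q).1 ω = glue Λ q.2 (glue Λ' q.1 ω) := fun q =>
    glue_eq_off hΛ q.2 q.1 ω
  have hs2 : ∀ q, glue Λ (s q).2 (glue Λ' (s q).1 ω) = glue Λ' q.1 ω := by
    intro q
    rw [hs1, glue_glue]
    exact glue_restrict Λ fun x _ => rfl
  have hinv : Function.Involutive s := by
    intro q
    refine Prod.ext (funext fun x => ?_) (funext fun x => ?_)
    · change glue Λ (s q).2 (glue Λ' (s q).1 ω) x = q.1 x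
      rw [hs2, glue_apply_mem x.2]
    · change glue Λ' (s q).1 ω x = q.2 x
      rw [hs1, glue_apply_mem x.2]
  refine Fintype.sum_equiv hinv.toPerm _ _ fun q => ?_
  change F q = G (s q)
  simp only [hF, hG, hs1]
  have hagree : ∀ x ∉ Λ, glue Λ q.2 (glue Λ' q.1 ω) x = glue Λ' q.1 ω x := fun x hx =>
    glue_apply_not_mem hx
  have hw := weight_mul_weight_comm hα h β hΛ hagree
  have hZ : partitionFunction α h β Λ (glue Λ q.2 (glue Λ' q.1 ω)) =
      partitionFunction α h β Λ (glue Λ' q.1 ω) := by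
    simp only [partitionFunction_eq, glue_glue]
  have hglue : glue Λ (s q).2 (glue Λ q.2 (glue Λ' q.1 ω)) = glue Λ' q.1 ω := by
    rw [← hs1, hs2]
  rw [hglue, hZ]
  rw [div_mul_eq_mul_div, ← mul_div_assoc]
  congr 1
  linear_combination (-f (glue Λ q.2 (glue Λ' q.1 ω))) * hw

/-! ### Submodularity and monotonicity in the boundary condition. -/

lemma spin_submodular (a b a' b' : Bool) :
    spin a * spin b + spin a' * spin b' ≤
      spin (a ⊓ a') * spin (b ⊓ b') + spin (a ⊔ a') * spin (b ⊔ b') := by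
  cases a <;> cases b <;> cases a' <;> cases b' <;> simp [spin] <;> norm_num

lemma spin_inf_add_spin_sup (a b : Bool) : spin (a ⊓ b) + spin (a ⊔ b) = spin a + spin b := by
  cases a <;> cases b <;> simp [spin]

/-- Ferromagnetic pair terms are submodular and the field term is modular, whatever its sign.
Exponentiated, this is the FKG lattice condition. -/
lemma hamiltonian_submodular {α : ℝ} (hα : 1 < α) (h : ℤ → ℝ) (Λ : Finset ℤ) (σ σ' : Config) :
    hamiltonian α h Λ (σ ⊓ σ') + hamiltonian α h Λ (σ ⊔ σ') ≤
      hamiltonian α h Λ σ + hamiltonian α h Λ σ' := by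
  have h1 : (∑' p, pairEnergy α Λ (σ ⊓ σ') p) + ∑' p, pairEnergy α Λ (σ ⊔ σ') p ≤
      (∑' p, pairEnergy α Λ σ p) + ∑' p, pairEnergy α Λ σ' p := by
    have hs := summable_pairEnergy hα Λ
    rw [← (hs _).tsum_add (hs _), ← (hs _).tsum_add (hs _)]
    refine ((hs _).add (hs _)).tsum_le_tsum (fun p => ?_) ((hs _).add (hs _))
    have hc := coupling_nonneg α (p.1 - p.2).natAbs
    have := spin_submodular (σ p.1) (σ p.2) (σ' p.1) (σ' p.2)
    unfold pairEnergy
    split_ifs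
    · simp only [Pi.inf_apply, Pi.sup_apply]
      nlinarith
    · simp
  have h2 : (∑ x ∈ Λ, h x * (1 - spin ((σ ⊓ σ') x))) + ∑ x ∈ Λ, h x * (1 - spin ((σ ⊔ σ') x)) =
      (∑ x ∈ Λ, h x * (1 - spin (σ x))) + ∑ x ∈ Λ, h x * (1 - spin (σ' x)) := by
    rw [← Finset.sum_add_distrib, ← Finset.sum_add_distrib]
    refine Finset.sum_congr rfl fun x _ => ?_
    have := spin_inf_add_spin_sup (σ x) (σ' x)
    simp only [Pi.inf_apply, Pi.sup_apply]
    linear_combination (-h x) * this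
  simp only [hamiltonian_eq]
  linarith

lemma glue_inf (Λ : Finset ℤ) (a b : Λ → Bool) {ω ω' : Config} (hω : ω ≤ ω') :
    glue Λ a ω ⊓ glue Λ b ω' = glue Λ (a ⊓ b) ω := by
  funext x
  by_cases hx : x ∈ Λ
  · simp only [Pi.inf_apply, glue_apply_mem hx]
  · simp only [Pi.inf_apply, glue_apply_not_mem hx, inf_eq_left.2 (hω x)]

lemma glue_sup (Λ : Finset ℤ) (a b : Λ → Bool) {ω ω' : Config} (hω : ω ≤ ω') :
    glue Λ a ω ⊔ glue Λ b ω' = glue Λ (a ⊔ b) ω' := by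
  funext x
  by_cases hx : x ∈ Λ
  · simp only [Pi.sup_apply, glue_apply_mem hx]
  · simp only [Pi.sup_apply, glue_apply_not_mem hx, sup_eq_right.2 (hω x)]

lemma weight_mul_weight_le {α : ℝ} (hα : 1 < α) (h : ℤ → ℝ) {β : ℝ} (hβ : 0 ≤ β) (Λ : Finset ℤ)
    (σ σ' : Config) :
    weight α h β Λ σ * weight α h β Λ σ' ≤
      weight α h β Λ (σ ⊓ σ') * weight α h β Λ (σ ⊔ σ') := by
  unfold weight
  rw [← Real.exp_add, ← Real.exp_add, Real.exp_le_exp]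
  nlinarith [hamiltonian_submodular hα h Λ σ σ']

/-- Gibbs expectations of increasing functions increase with the boundary condition. -/
lemma gibbsExp_mono {α : ℝ} (hα : 1 < α) (h : ℤ → ℝ) {β : ℝ} (hβ : 0 ≤ β) (Λ : Finset ℤ)
    {f : Config → ℝ} (hf : Monotone f) : Monotone (gibbsExp α h β Λ f) := by
  intro ω ω' hω
  -- The four functions theorem needs nonnegative functions. Adding a constant shifts both
  -- expectations equally, and only finitely many values of `f` occur.
  set K : ℝ := ∑ τ : Λ → Bool, (|f (glue Λ τ ω)| + |f (glue Λ τ ω')|) with hK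
  have hK1 : ∀ τ, |f (glue Λ τ ω)| + |f (glue Λ τ ω')| ≤ K := fun τ =>
    Finset.single_le_sum (f := fun τ => |f (glue Λ τ ω)| + |f (glue Λ τ ω')|)
      (fun _ _ => by positivity) (Finset.mem_univ τ)
  have hK2 : ∀ τ, 0 ≤ f (glue Λ τ ω) + K := fun τ => by
    linarith [neg_abs_le (f (glue Λ τ ω)), abs_nonneg (f (glue Λ τ ω')), hK1 τ]
  have hK3 : ∀ τ, 0 ≤ f (glue Λ τ ω') + K := fun τ => by
    linarith [neg_abs_le (f (glue Λ τ ω')), abs_nonneg (f (glue Λ τ ω)), hK1 τ]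
  have main := four_functions_theorem_univ
    (fun a : Λ → Bool => (f (glue Λ a ω) + K) * weight α h β Λ (glue Λ a ω))
    (fun b => weight α h β Λ (glue Λ b ω'))
    (fun a => weight α h β Λ (glue Λ a ω))
    (fun b => (f (glue Λ b ω') + K) * weight α h β Λ (glue Λ b ω'))
    (fun a => mul_nonneg (hK2 a) (weight_pos _ _ _ _ _).le)
    (fun a => (weight_pos _ _ _ _ _).le) (fun a => (weight_pos _ _ _ _ _).le)
    (fun a => mul_nonneg (hK3 a) (weight_pos _ _ _ _ _).le) (fun a b => by
      have hw := weight_mul_weight_le hα h hβ Λ (glue Λ a ω) (glue Λ b ω')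
      rw [glue_inf Λ a b hω, glue_sup Λ a b hω] at hw
      have hm : f (glue Λ a ω) ≤ f (glue Λ (a ⊔ b) ω') := by
        apply hf
        rw [← glue_sup Λ a b hω]
        exact le_sup_left
      calc (f (glue Λ a ω) + K) * weight α h β Λ (glue Λ a ω) * weight α h β Λ (glue Λ b ω')
          = (f (glue Λ a ω) + K) *
              (weight α h β Λ (glue Λ a ω) * weight α h β Λ (glue Λ b ω')) := by ring
        _ ≤ (f (glue Λ (a ⊔ b) ω') + K) *
              (weight α h β Λ (glue Λ (a ⊓ b) ω) * weight α h β Λ (glue Λ (a ⊔ b) ω')) :=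
            mul_le_mul (by linarith) hw
              (mul_nonneg (weight_pos _ _ _ _ _).le (weight_pos _ _ _ _ _).le) (hK3 _)
        _ = _ := by ring)
  have hZ := partitionFunction_pos α h β Λ ω
  have hZ' := partitionFunction_pos α h β Λ ω'
  have e : ∀ ω, gibbsExp α h β Λ (fun σ => f σ + K) ω = gibbsExp α h β Λ f ω + K := fun ω => by
    rw [gibbsExp_add, gibbsExp_const]
  suffices hh : gibbsExp α h β Λ (fun σ => f σ + K) ω ≤ gibbsExp α h β Λ (fun σ => f σ + K) ω' by
    rw [e, e] at hh
    linarith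
  rw [gibbsExp_eq, gibbsExp_eq, div_le_div_iff₀ hZ hZ', partitionFunction_eq,
    partitionFunction_eq]
  linarith

/-! ### Existence of the limiting magnetizations. -/

lemma spin_eval_mono (x : ℤ) : Monotone fun σ : Config => spin (σ x) := fun _ _ h => spin_mono (h x)

lemma box_mono {L L' : ℕ} (h : L ≤ L') : box L ⊆ box L' := by
  unfold box
  apply Finset.Icc_subset_Icc <;> omega

lemma mem_box {L : ℕ} {x : ℤ} : x ∈ box L ↔ -(L : ℤ) ≤ x ∧ x ≤ L := Finset.mem_Icc

lemma abs_magnetization_le (α : ℝ) (h : ℤ → ℝ) (β : ℝ) (b : Bool) (L : ℕ) :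
    |magnetization α h β b L| ≤ 1 := by
  have hs : ∀ σ : Config, |spin (σ 0)| ≤ 1 := fun σ => (abs_spin _).le
  rw [abs_le]
  constructor
  · rw [← gibbsExp_const α h β (box L) (-1) (fun _ => b)]
    exact gibbsExp_le α h β _ (fun σ => (abs_le.1 (hs σ)).1) _
  · rw [← gibbsExp_const α h β (box L) 1 (fun _ => b)]
    exact gibbsExp_le α h β _ (fun σ => (abs_le.1 (hs σ)).2) _

/-- By consistency the larger box averages the expectation in the smaller one over random boundary
conditions, all of which lie below the plus one. -/
lemma magnetization_true_antitone {α : ℝ} (hα : 1 < α) (h : ℤ → ℝ) {β : ℝ} (hβ : 0 ≤ β) :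
    Antitone (magnetization α h β true) := by
  intro L L' hL
  unfold magnetization
  rw [← gibbsExp_gibbsExp hα h β (box_mono hL)]
  conv_rhs => rw [← gibbsExp_const α h β (box L')
    (gibbsExp α h β (box L) (fun σ => spin (σ 0)) fun _ => true) fun _ => true]
  exact gibbsExp_le α h β _
    (fun σ => gibbsExp_mono hα h hβ _ (spin_eval_mono 0) fun x => Bool.le_true _) _

lemma magnetization_false_monotone {α : ℝ} (hα : 1 < α) (h : ℤ → ℝ) {β : ℝ} (hβ : 0 ≤ β) :
    Monotone (magnetization α h β false) := by
  intro L L' hL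
  unfold magnetization
  rw [← gibbsExp_gibbsExp hα h β (box_mono hL)]
  conv_lhs => rw [← gibbsExp_const α h β (box L')
    (gibbsExp α h β (box L) (fun σ => spin (σ 0)) fun _ => false) fun _ => false]
  exact gibbsExp_le α h β _
    (fun σ => gibbsExp_mono hα h hβ _ (spin_eval_mono 0) fun x => Bool.false_le _) _

lemma exists_tendsto_magnetization {α : ℝ} (hα : 1 < α) (h : ℤ → ℝ) {β : ℝ} (hβ : 0 ≤ β)
    (b : Bool) : ∃ m, Tendsto (magnetization α h β b) atTop (𝓝 m) := by
  have hb := abs_magnetization_le α h β b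
  cases b
  · exact ⟨_, tendsto_atTop_ciSup (magnetization_false_monotone hα h hβ)
      ⟨1, by rintro _ ⟨L, rfl⟩; exact (abs_le.1 (hb L)).2⟩⟩
  · exact ⟨_, tendsto_atTop_ciInf (magnetization_true_antitone hα h hβ)
      ⟨-1, by rintro _ ⟨L, rfl⟩; exact (abs_le.1 (hb L)).1⟩⟩

/-! ### Infinite-volume Gibbs measures by compactness. -/

/-- The finite-volume Gibbs measure. -/
noncomputable def gibbsMeasure (α : ℝ) (h : ℤ → ℝ) (β : ℝ) (Λ : Finset ℤ) (ω : Config) :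
    Measure Config :=
  ∑ τ : Λ → Bool, ENNReal.ofReal (weight α h β Λ (glue Λ τ ω) / partitionFunction α h β Λ ω) •
    Measure.dirac (glue Λ τ ω)

lemma weight_div_nonneg (α : ℝ) (h : ℤ → ℝ) (β : ℝ) (Λ : Finset ℤ) (σ ω : Config) :
    0 ≤ weight α h β Λ σ / partitionFunction α h β Λ ω :=
  div_nonneg (weight_pos _ _ _ _ _).le (partitionFunction_pos _ _ _ _ _).le

lemma integral_gibbsMeasure (α : ℝ) (h : ℤ → ℝ) (β : ℝ) (Λ : Finset ℤ) (ω : Config)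
    (f : Config → ℝ) : ∫ σ, f σ ∂(gibbsMeasure α h β Λ ω) = gibbsExp α h β Λ f ω := by
  unfold gibbsMeasure
  rw [integral_finsetSum_measure]
  · rw [gibbsExp_eq, Finset.sum_div]
    refine Finset.sum_congr rfl fun τ _ => ?_
    rw [integral_smul_measure, integral_dirac, ENNReal.toReal_ofReal (weight_div_nonneg _ _ _ _ _ _),
      smul_eq_mul]
    ring
  · intro τ _
    exact (integrable_dirac (by simp)).smul_measure ENNReal.ofReal_ne_top

lemma isProbabilityMeasure_gibbsMeasure (α : ℝ) (h : ℤ → ℝ) (β : ℝ) (Λ : Finset ℤ) (ω : Config) :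
    IsProbabilityMeasure (gibbsMeasure α h β Λ ω) := by
  refine ⟨?_⟩
  unfold gibbsMeasure
  simp only [Measure.coe_finsetSum, Measure.coe_smul, Finset.sum_apply, Pi.smul_apply,
    measure_univ, smul_eq_mul, mul_one]
  rw [← ENNReal.ofReal_sum_of_nonneg fun τ _ => weight_div_nonneg _ _ _ _ _ _, ← Finset.sum_div,
    ← partitionFunction_eq, div_self (partitionFunction_pos _ _ _ _ _).ne', ENNReal.ofReal_one]

lemma continuous_partitionFunction {α : ℝ} (hα : 1 < α) (h : ℤ → ℝ) (β : ℝ) (Λ : Finset ℤ) :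
    Continuous (partitionFunction α h β Λ) :=
  continuous_finsetSum _ fun τ _ => (continuous_weight hα h β Λ).comp (continuous_glue Λ τ)

lemma continuous_weight_div {α : ℝ} (hα : 1 < α) (h : ℤ → ℝ) (β : ℝ) (Λ : Finset ℤ)
    (τ : Λ → Bool) :
    Continuous fun ω => weight α h β Λ (glue Λ τ ω) / partitionFunction α h β Λ ω :=
  ((continuous_weight hα h β Λ).comp (continuous_glue Λ τ)).div
    (continuous_partitionFunction hα h β Λ) fun ω => (partitionFunction_pos _ _ _ _ ω).ne'

lemma gibbsExp_eq_sum (α : ℝ) (h : ℤ → ℝ) (β : ℝ) (Λ : Finset ℤ) (f : Config → ℝ) (ω : Config) :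
    gibbsExp α h β Λ f ω = ∑ τ : Λ → Bool,
      f (glue Λ τ ω) * (weight α h β Λ (glue Λ τ ω) / partitionFunction α h β Λ ω) := by
  simp only [gibbsExp_eq, Finset.sum_div, mul_div_assoc]

lemma continuous_gibbsExp {α : ℝ} (hα : 1 < α) (h : ℤ → ℝ) (β : ℝ) (Λ : Finset ℤ)
    {f : Config → ℝ} (hf : Continuous f) : Continuous (gibbsExp α h β Λ f) := by
  simp only [funext (gibbsExp_eq_sum α h β Λ f)]
  exact continuous_finsetSum _ fun τ _ =>
    (hf.comp (continuous_glue Λ τ)).mul (continuous_weight_div hα h β Λ τ)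

/-- The measure `μ` followed by resampling the spins in `Λ`. -/
noncomputable def resample (α : ℝ) (h : ℤ → ℝ) (β : ℝ) (Λ : Finset ℤ) (μ : Measure Config) :
    Measure Config :=
  ∑ τ : Λ → Bool, (μ.withDensity fun ω =>
    ENNReal.ofReal (weight α h β Λ (glue Λ τ ω) / partitionFunction α h β Λ ω)).map (glue Λ τ)

lemma lintegral_resample {α : ℝ} (hα : 1 < α) (h : ℤ → ℝ) (β : ℝ) (Λ : Finset ℤ)
    (μ : Measure Config) {f : Config → ℝ} (hf : Measurable f) (hf0 : 0 ≤ f) :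
    ∫⁻ σ, ENNReal.ofReal (f σ) ∂(resample α h β Λ μ) =
      ∫⁻ ω, ENNReal.ofReal (gibbsExp α h β Λ f ω) ∂μ := by
  have hm : ∀ τ, Measurable fun ω =>
      ENNReal.ofReal (weight α h β Λ (glue Λ τ ω) / partitionFunction α h β Λ ω) := fun τ =>
    (continuous_weight_div hα h β Λ τ).measurable.ennreal_ofReal
  have hg : ∀ τ, Measurable (glue Λ τ) := fun τ => (continuous_glue Λ τ).measurable
  unfold resample
  rw [lintegral_finsetSum_measure]
  simp_rw [gibbsExp_eq_sum]
  have : ∀ ω, ENNReal.ofReal (∑ τ : Λ → Bool,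
      f (glue Λ τ ω) * (weight α h β Λ (glue Λ τ ω) / partitionFunction α h β Λ ω)) =
      ∑ τ : Λ → Bool, ENNReal.ofReal (weight α h β Λ (glue Λ τ ω) / partitionFunction α h β Λ ω) *
        ENNReal.ofReal (f (glue Λ τ ω)) := by
    intro ω
    rw [ENNReal.ofReal_sum_of_nonneg fun τ _ => mul_nonneg (hf0 _) (weight_div_nonneg _ _ _ _ _ _)]
    refine Finset.sum_congr rfl fun τ _ => ?_
    rw [← ENNReal.ofReal_mul (weight_div_nonneg _ _ _ _ _ _), mul_comm]
  simp_rw [this]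
  rw [lintegral_finsetSum (f := fun (τ : Λ → Bool) ω =>
    ENNReal.ofReal (weight α h β Λ (glue Λ τ ω) / partitionFunction α h β Λ ω) *
      ENNReal.ofReal (f (glue Λ τ ω))) _
    fun τ _ => (hm τ).mul (hf.comp (hg τ)).ennreal_ofReal]
  refine Finset.sum_congr rfl fun τ _ => ?_
  rw [lintegral_map hf.ennreal_ofReal (hg τ)]
  exact lintegral_withDensity_eq_lintegral_mul _ (hm τ) (hf.comp (hg τ)).ennreal_ofReal

/-- Continuous functions determine a finite measure, so the hypothesis says that `μ` equals its own
resampling; evaluating this equality of measures on a measurable set gives DLR. -/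
lemma isGibbsMeasure_of_integral_gibbsExp {α : ℝ} (hα : 1 < α) (h : ℤ → ℝ) (β : ℝ)
    (μ : Measure Config) [IsProbabilityMeasure μ]
    (hμ : ∀ (Λ : Finset ℤ) (f : Config → ℝ), Continuous f →
      ∫ ω, gibbsExp α h β Λ f ω ∂μ = ∫ ω, f ω ∂μ) :
    IsGibbsMeasure α h β μ := by
  refine ⟨inferInstance, fun Λ A hA => ?_⟩
  have hint : ∀ f : Config → ℝ, Continuous f → Integrable f μ := fun f hf =>
    hf.integrable_of_hasCompactSupport (HasCompactSupport.of_compactSpace f)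
  have heq : μ = resample α h β Λ μ := by
    refine ext_of_forall_lintegral_eq_of_IsFiniteMeasure fun f => ?_
    have hf : Continuous fun σ => (f σ : ℝ) := NNReal.continuous_coe.comp f.continuous
    have h1 := lintegral_resample hα h β Λ μ hf.measurable fun σ => (f σ).2
    simp only [ENNReal.ofReal_coe_nnreal] at h1
    rw [h1, ← ofReal_integral_eq_lintegral_ofReal (hint _ (continuous_gibbsExp hα h β Λ hf)),
      hμ Λ _ hf, ofReal_integral_eq_lintegral_ofReal (hint _ hf) (ae_of_all _ fun σ => (f σ).2)]
    · simp only [ENNReal.ofReal_coe_nnreal]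
    · refine ae_of_all _ fun ω => ?_
      rw [Pi.zero_apply, ← gibbsExp_const α h β Λ 0 ω]
      exact gibbsExp_le α h β Λ (fun σ => (f σ).2) ω
  have h2 := lintegral_resample hα h β Λ μ (f := A.indicator fun _ => (1 : ℝ))
    (measurable_const.indicator hA) (fun σ => Set.indicator_nonneg (fun _ _ => zero_le_one) σ)
  rw [← h2, ← heq]
  have : ∀ σ, ENNReal.ofReal (A.indicator (fun _ => (1 : ℝ)) σ) = A.indicator 1 σ := by
    intro σ
    by_cases hσ : σ ∈ A <;> simp [hσ]
  simp_rw [this]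
  rw [lintegral_indicator_one hA]

/-- Every limit of finite-volume magnetizations with constant boundary condition is the
magnetization of an infinite-volume Gibbs measure. -/
lemma exists_isGibbsMeasure_integral_spin {α : ℝ} (hα : 1 < α) (h : ℤ → ℝ) (β : ℝ) (b : Bool)
    {m : ℝ} (hm : Tendsto (magnetization α h β b) atTop (𝓝 m)) :
    ∃ μ, IsGibbsMeasure α h β μ ∧ ∫ σ, spin (σ 0) ∂μ = m := by
  set u : ℕ → ProbabilityMeasure Config := fun L =>
    ⟨gibbsMeasure α h β (box L) fun _ => b, isProbabilityMeasure_gibbsMeasure _ _ _ _ _⟩ with hu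
  -- An ultrafilter converges in the compact space of probability measures, so no subsequence has to
  -- be extracted.
  set U : Ultrafilter ℕ := Ultrafilter.of atTop with hU
  have hUle : (U : Filter ℕ) ≤ atTop := Ultrafilter.of_le _
  obtain ⟨μ, -, hμ⟩ := (isCompact_univ (X := ProbabilityMeasure Config)).ultrafilter_le_nhds
    (U.map u) (by simp)
  have hlim : Tendsto u U (𝓝 μ) := hμ
  have hint : ∀ f : Config → ℝ, Continuous f → Tendsto
      (fun L => gibbsExp α h β (box L) f fun _ => b) U (𝓝 (∫ ω, f ω ∂(μ : Measure Config))) := by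
    intro f hf
    have := ProbabilityMeasure.tendsto_iff_forall_integral_tendsto.1 hlim
      (BoundedContinuousFunction.mkOfCompact ⟨f, hf⟩)
    refine this.congr fun L => ?_
    exact integral_gibbsMeasure α h β (box L) (fun _ => b) f
  refine ⟨μ, isGibbsMeasure_of_integral_gibbsExp hα h β μ fun Λ f hf => ?_, ?_⟩
  · refine tendsto_nhds_unique ((hint _ (continuous_gibbsExp hα h β Λ hf)).congr' ?_) (hint f hf)
    have hev : ∀ᶠ L in atTop, Λ ⊆ box L := by
      refine eventually_atTop.2 ⟨Λ.sup Int.natAbs, fun L hL x hx => ?_⟩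
      have := Finset.le_sup (f := Int.natAbs) hx
      rw [mem_box]
      omega
    exact (hev.filter_mono hUle).mono fun L hL => gibbsExp_gibbsExp hα h β hL f _
  · exact tendsto_nhds_unique (hint _ (continuous_eval_bool 0)) (hm.mono_left hUle)

/-- Monotonicity supplies the limits and compactness supplies Gibbs measures with these
magnetizations, so only a gap independent of the box remains to be shown. -/
lemma hasPhaseTransition_of_separated {α : ℝ} (hα : 1 < α) (h : ℤ → ℝ) {β₀ : ℝ} (hβ₀ : 0 < β₀)
    (hsep : ∀ β, β₀ ≤ β → ∃ c > 0, ∀ᶠ L in atTop,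
      magnetization α h β false L + c ≤ magnetization α h β true L) :
    HasPhaseTransition α h := by
  refine ⟨β₀, hβ₀, fun β hβ => ?_⟩
  have hβ' : 0 ≤ β := hβ₀.le.trans hβ
  obtain ⟨m, hm⟩ := exists_tendsto_magnetization hα h hβ' false
  obtain ⟨p, hp⟩ := exists_tendsto_magnetization hα h hβ' true
  obtain ⟨c, hc, hL⟩ := hsep β hβ
  have hle : m + c ≤ p := le_of_tendsto_of_tendsto (hm.add_const c) hp hL
  have hne : m ≠ p := by intro h; linarith
  obtain ⟨μ, hμ, hμm⟩ := exists_isGibbsMeasure_integral_spin hα h β false hm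
  obtain ⟨ν, hν, hνp⟩ := exists_isGibbsMeasure_integral_spin hα h β true hp
  refine ⟨⟨m, p, hm, hp, hne⟩, μ, ν, hμ, hν, ?_⟩
  rintro rfl
  exact hne (hμm.symm.trans hνp)

/-! ### Stability under finite changes of the field. -/

lemma pairEnergy_submodular (α : ℝ) (Λ : Finset ℤ) (σ σ' : Config) (p : ℤ × ℤ) :
    pairEnergy α Λ (σ ⊓ σ') p + pairEnergy α Λ (σ ⊔ σ') p ≤
      pairEnergy α Λ σ p + pairEnergy α Λ σ' p := by
  have hc := coupling_nonneg α (p.1 - p.2).natAbs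
  have := spin_submodular (σ p.1) (σ p.2) (σ' p.1) (σ' p.2)
  unfold pairEnergy
  split_ifs
  · simp only [Pi.inf_apply, Pi.sup_apply]
    nlinarith
  · simp

/-- The two configurations are opposite broken bonds, so meet and join are aligned; every coupling
is strictly positive. -/
lemma pairEnergy_submodular_lt (α : ℝ) {Λ : Finset ℤ} {σ σ' : Config} {p : ℤ × ℤ}
    (hp : p.1 < p.2) (hΛ : p.1 ∈ Λ ∨ p.2 ∈ Λ) (h : σ p.1 ≠ σ p.2) (h1 : σ' p.1 ≠ σ p.1)
    (h2 : σ' p.2 ≠ σ p.2) :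
    pairEnergy α Λ (σ ⊓ σ') p + pairEnergy α Λ (σ ⊔ σ') p <
      pairEnergy α Λ σ p + pairEnergy α Λ σ' p := by
  have hc := coupling_pos α (r := (p.1 - p.2).natAbs) (by omega)
  unfold pairEnergy
  simp only [if_pos (And.intro hp hΛ), Pi.inf_apply, Pi.sup_apply]
  revert h h1 h2
  cases σ p.1 <;> cases σ p.2 <;> cases σ' p.1 <;> cases σ' p.2 <;> simp [spin] <;> linarith

lemma hamiltonian_submodular_lt {α : ℝ} (hα : 1 < α) (h : ℤ → ℝ) {Λ : Finset ℤ} {σ σ' : Config}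
    {x y : ℤ} (hx : x ∈ Λ) (hxy : σ x ≠ σ y) (h1 : σ' x ≠ σ x) (h2 : σ' y ≠ σ y) :
    hamiltonian α h Λ (σ ⊓ σ') + hamiltonian α h Λ (σ ⊔ σ') <
      hamiltonian α h Λ σ + hamiltonian α h Λ σ' := by
  have hs := summable_pairEnergy hα Λ
  have h1 : (∑' p, pairEnergy α Λ (σ ⊓ σ') p) + ∑' p, pairEnergy α Λ (σ ⊔ σ') p <
      (∑' p, pairEnergy α Λ σ p) + ∑' p, pairEnergy α Λ σ' p := by
    rw [← (hs _).tsum_add (hs _), ← (hs _).tsum_add (hs _)]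
    have hne : x ≠ y := by rintro rfl; exact hxy rfl
    rcases lt_or_gt_of_ne hne with hlt | hlt
    · exact Summable.tsum_lt_tsum (i := (x, y)) (pairEnergy_submodular α Λ σ σ')
        (pairEnergy_submodular_lt α hlt (Or.inl hx) hxy h1 h2) ((hs _).add (hs _))
        ((hs _).add (hs _))
    · exact Summable.tsum_lt_tsum (i := (y, x)) (pairEnergy_submodular α Λ σ σ')
        (pairEnergy_submodular_lt α hlt (Or.inr hx) hxy.symm h2 h1) ((hs _).add (hs _))
        ((hs _).add (hs _))
  have h2 : (∑ x ∈ Λ, h x * (1 - spin ((σ ⊓ σ') x))) + ∑ x ∈ Λ, h x * (1 - spin ((σ ⊔ σ') x)) =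
      (∑ x ∈ Λ, h x * (1 - spin (σ x))) + ∑ x ∈ Λ, h x * (1 - spin (σ' x)) := by
    rw [← Finset.sum_add_distrib, ← Finset.sum_add_distrib]
    refine Finset.sum_congr rfl fun x _ => ?_
    have := spin_inf_add_spin_sup (σ x) (σ' x)
    simp only [Pi.inf_apply, Pi.sup_apply]
    linear_combination (-h x) * this
  simp only [hamiltonian_eq]
  linarith

lemma glue_singleton (b : Bool) (ω : Config) :
    glue {0} (fun _ => b) ω = Function.update ω 0 b := by
  funext x
  by_cases hx : x = 0
  · subst hx; rw [glue_apply_mem (by simp)]; simp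
  · rw [glue_apply_not_mem (by simpa using hx)]; simp [hx]

lemma eq_const_of_singleton (τ : ({0} : Finset ℤ) → Bool) :
    τ = fun _ => τ ⟨0, Finset.mem_singleton_self 0⟩ := by
  funext x
  congr 1
  exact Subtype.ext (Finset.mem_singleton.1 x.2)

/-- The single-site Gibbs expectation at the origin, in terms of the conditional magnetization. -/
lemma gibbsExp_singleton (α : ℝ) (h : ℤ → ℝ) (β : ℝ) (f : Config → ℝ) (ω : Config) :
    gibbsExp α h β {0} f ω =
      (f (Function.update ω 0 true) + f (Function.update ω 0 false)) / 2 +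
      (f (Function.update ω 0 true) - f (Function.update ω 0 false)) / 2 *
        gibbsExp α h β {0} (fun σ => spin (σ 0)) ω := by
  have hf : gibbsExp α h β {0} f ω = gibbsExp α h β {0} (fun σ =>
      (f (Function.update ω 0 true) + f (Function.update ω 0 false)) / 2 +
      (f (Function.update ω 0 true) - f (Function.update ω 0 false)) / 2 * spin (σ 0)) ω := by
    refine gibbsExp_congr_glue α h β _ fun τ => ?_
    rw [eq_const_of_singleton τ, glue_singleton]
    cases τ ⟨0, Finset.mem_singleton_self 0⟩ <;> simp [spin] <;> ring
  rw [hf, gibbsExp_add, gibbsExp_const, gibbsExp_const_mul]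

lemma gibbsExp_singleton_spin (α : ℝ) (h : ℤ → ℝ) (β : ℝ) (ω : Config) :
    gibbsExp α h β {0} (fun σ => spin (σ 0)) ω =
      (weight α h β {0} (Function.update ω 0 true) - weight α h β {0} (Function.update ω 0 false)) /
      (weight α h β {0} (Function.update ω 0 true) +
        weight α h β {0} (Function.update ω 0 false)) := by
  have hsum : ∀ F : (({0} : Finset ℤ) → Bool) → ℝ, ∑ τ, F τ =
      F (fun _ => true) + F (fun _ => false) := by
    intro F
    rw [← Fintype.sum_bool fun b => F fun _ => b]
    refine (Fintype.sum_equiv (Equiv.ofBijective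
      (fun (b : Bool) (_ : ({0} : Finset ℤ)) => b) ⟨fun a b hab => ?_, fun τ => ?_⟩) _ _
      fun b => rfl).symm
    · exact congrFun hab ⟨0, Finset.mem_singleton_self 0⟩
    · exact ⟨_, (eq_const_of_singleton τ).symm⟩
  rw [gibbsExp_eq, partitionFunction_eq, hsum, hsum]
  simp only [glue_singleton, Function.update_self, spin]
  simp
  ring

/-- Raising a spin strictly raises the conditional magnetization at the origin. -/
lemma gibbsExp_singleton_spin_lt {α : ℝ} (hα : 1 < α) (h : ℤ → ℝ) {β : ℝ} (hβ : 0 < β)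
    {σ σ' : Config} (hσ : σ ≤ σ') {x : ℤ} (hx : x ≠ 0) (h1 : σ x = false) (h2 : σ' x = true) :
    gibbsExp α h β {0} (fun σ => spin (σ 0)) σ < gibbsExp α h β {0} (fun σ => spin (σ 0)) σ' := by
  have hinf : Function.update σ 0 true ⊓ Function.update σ' 0 false =
      Function.update σ 0 false := by
    funext y
    by_cases hy : y = 0
    · subst hy; simp
    · simp only [Pi.inf_apply, Function.update_of_ne hy]
      exact inf_eq_left.2 (hσ y)
  have hsup : Function.update σ 0 true ⊔ Function.update σ' 0 false =
      Function.update σ' 0 true := by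
    funext y
    by_cases hy : y = 0
    · subst hy; simp
    · simp only [Pi.sup_apply, Function.update_of_ne hy]
      exact sup_eq_right.2 (hσ y)
  have hlt := hamiltonian_submodular_lt hα h (Λ := {0}) (σ := Function.update σ 0 true)
    (σ' := Function.update σ' 0 false) (x := 0) (y := x) (by simp) (by simp [hx, h1])
    (by simp) (by simp [hx, h1, h2])
  rw [hinf, hsup] at hlt
  have hw : weight α h β {0} (Function.update σ 0 true) *
      weight α h β {0} (Function.update σ' 0 false) <
      weight α h β {0} (Function.update σ 0 false) *
      weight α h β {0} (Function.update σ' 0 true) := by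
    unfold weight
    rw [← Real.exp_add, ← Real.exp_add, Real.exp_lt_exp]
    nlinarith
  have p1 := weight_pos α h β {0} (Function.update σ 0 true)
  have p2 := weight_pos α h β {0} (Function.update σ 0 false)
  have p3 := weight_pos α h β {0} (Function.update σ' 0 true)
  have p4 := weight_pos α h β {0} (Function.update σ' 0 false)
  rw [gibbsExp_singleton_spin, gibbsExp_singleton_spin,
    div_lt_div_iff₀ (by positivity) (by positivity)]
  nlinarith

/-- The strict inequality becomes uniform because the ordered pairs that differ in this way at `x`
form a compact set and the gap is continuous. -/
lemma exists_gibbsExp_singleton_spin_gap {α : ℝ} (hα : 1 < α) (h : ℤ → ℝ) {β : ℝ} (hβ : 0 < β)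
    {x : ℤ} (hx : x ≠ 0) : ∃ c > 0, ∀ σ σ' : Config, σ ≤ σ' → σ x = false → σ' x = true →
      gibbsExp α h β {0} (fun σ => spin (σ 0)) σ + c ≤
        gibbsExp α h β {0} (fun σ => spin (σ 0)) σ' := by
  set S : Set (Config × Config) := {p | p.1 ≤ p.2 ∧ p.1 x = false ∧ p.2 x = true} with hS
  have hclosed : IsClosed S := by
    have e : S = (⋂ y : ℤ, {p : Config × Config | p.1 y ≤ p.2 y}) ∩
        ({p | p.1 x = false} ∩ {p | p.2 x = true}) := by
      ext p; simp [hS, Pi.le_def]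
    rw [e]
    refine IsClosed.inter (isClosed_iInter fun y => ?_) (IsClosed.inter ?_ ?_)
    · exact (isClosed_discrete {q : Bool × Bool | q.1 ≤ q.2}).preimage
        (f := fun p : Config × Config => (p.1 y, p.2 y)) (by fun_prop)
    · exact (isClosed_discrete {false}).preimage (f := fun p : Config × Config => p.1 x)
        (by fun_prop)
    · exact (isClosed_discrete {true}).preimage (f := fun p : Config × Config => p.2 x)
        (by fun_prop)
  have hcont := continuous_gibbsExp hα h β {0} (continuous_eval_bool (f := spin) 0)
  have hne : S.Nonempty := ⟨(fun _ => false, fun _ => true), fun _ => Bool.le_true _, rfl, rfl⟩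
  obtain ⟨p, hp, hmin⟩ := hclosed.isCompact.exists_isMinOn hne
    (f := fun p : Config × Config => gibbsExp α h β {0} (fun σ => spin (σ 0)) p.2 -
      gibbsExp α h β {0} (fun σ => spin (σ 0)) p.1)
    ((hcont.comp continuous_snd).sub (hcont.comp continuous_fst)).continuousOn
  refine ⟨_, sub_pos.2 (gibbsExp_singleton_spin_lt hα h hβ hp.1 hx hp.2.1 hp.2.2),
    fun σ σ' h1 h2 h3 => ?_⟩
  have := hmin (show (σ, σ') ∈ S from ⟨h1, h2, h3⟩)
  simp only [Set.mem_ofPred_eq] at this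
  linarith

lemma exists_uniform_gibbsExp_singleton_spin_gap {α : ℝ} (hα : 1 < α) (h : ℤ → ℝ) {β : ℝ}
    (hβ : 0 < β) (D : Finset ℤ) : ∃ c > 0, ∀ x ∈ D, x ≠ 0 → ∀ σ σ' : Config, σ ≤ σ' →
      σ x = false → σ' x = true → gibbsExp α h β {0} (fun σ => spin (σ 0)) σ + c ≤
        gibbsExp α h β {0} (fun σ => spin (σ 0)) σ' := by
  induction D using Finset.induction_on with
  | empty => exact ⟨1, one_pos, by simp⟩
  | insert a D _ ih =>
    obtain ⟨c, hc, hD⟩ := ih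
    by_cases ha : a = 0
    · refine ⟨c, hc, fun x hx hx0 => hD x ?_ hx0⟩
      rcases Finset.mem_insert.1 hx with rfl | hx
      · exact absurd ha hx0
      · exact hx
    · obtain ⟨c', hc', ha'⟩ := exists_gibbsExp_singleton_spin_gap hα h hβ ha
      refine ⟨min c c', lt_min hc hc', fun x hx hx0 σ σ' h1 h2 h3 => ?_⟩
      rcases Finset.mem_insert.1 hx with rfl | hx
      · exact (add_le_add_right (min_le_right c c') _).trans (ha' σ σ' h1 h2 h3)
      · exact (add_le_add_right (min_le_left c c') _).trans (hD x hx hx0 σ σ' h1 h2 h3)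

/-- Expectations of local functions are controlled by the magnetization at the origin. -/
lemma exists_monotone_const_mul_spin_sub {α : ℝ} (hα : 1 < α) (h : ℤ → ℝ) {β : ℝ} (hβ : 0 < β)
    {D : Finset ℤ} {f : Config → ℝ} (hD : ∀ σ σ' : Config, (∀ x ∈ D, σ x = σ' x) → f σ = f σ')
    {K : ℝ} (hK : ∀ σ, |f σ| ≤ K) :
    ∃ C > 0, Monotone (gibbsExp α h β {0} fun σ => C * spin (σ 0) + (-1) * f σ) := by
  obtain ⟨c, hc, hgap⟩ := exists_uniform_gibbsExp_singleton_spin_gap hα h hβ D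
  have hK0 : 0 ≤ K := (abs_nonneg _).trans (hK fun _ => true)
  -- The term `K` handles pairs that agree on `D` off the origin, where `f` varies at most `K` times
  -- as much as the conditional magnetization. The term `2 * K / c` handles a disagreement elsewhere
  -- in `D`, where the magnetization rises by `c` while `f` varies by at most `2 * K`.
  refine ⟨K + 2 * K / c + 1, by positivity, fun σ σ' hσ => ?_⟩
  set C := K + 2 * K / c + 1 with hC
  have hCK : K ≤ C := by have : 0 ≤ 2 * K / c := by positivity
                         linarith
  have hCc : 2 * K ≤ C * c := by
    have : 2 * K / c * c = 2 * K := by field_simp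
    nlinarith
  simp only [gibbsExp_add, gibbsExp_const_mul]
  have hmono := gibbsExp_mono hα h hβ.le {0} (spin_eval_mono 0) hσ
  by_cases hag : ∀ x ∈ D, x ≠ 0 → σ x = σ' x
  · have hupd : ∀ b, f (Function.update σ 0 b) = f (Function.update σ' 0 b) := fun b => by
      refine hD _ _ fun x hx => ?_
      by_cases hx0 : x = 0
      · subst hx0; simp
      · simp [hx0, hag x hx hx0]
    rw [gibbsExp_singleton α h β f σ, gibbsExp_singleton α h β f σ', hupd, hupd]
    have h1 := abs_le.1 (hK (Function.update σ' 0 true))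
    have h2 := abs_le.1 (hK (Function.update σ' 0 false))
    nlinarith
  · push Not at hag
    obtain ⟨x, hx, hx0, hne⟩ := hag
    have hle := hσ x
    have hx1 : σ x = false ∧ σ' x = true := by
      revert hne hle
      cases σ x <;> cases σ' x <;> simp
    have hg := hgap x hx hx0 σ σ' hσ hx1.1 hx1.2
    have hb : ∀ ω, |gibbsExp α h β {0} f ω| ≤ K := fun ω => by
      rw [abs_le]
      constructor
      · rw [← gibbsExp_const α h β {0} (-K) ω]
        exact gibbsExp_le α h β _ (fun σ => (abs_le.1 (hK σ)).1) _
      · rw [← gibbsExp_const α h β {0} K ω]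
        exact gibbsExp_le α h β _ (fun σ => (abs_le.1 (hK σ)).2) _
    have h1 := abs_le.1 (hb σ)
    have h2 := abs_le.1 (hb σ')
    have hCpos : 0 ≤ C := hK0.trans hCK
    nlinarith

lemma weight_eq_mul_of_field_eq_off {α : ℝ} {h h' : ℤ → ℝ} (β : ℝ) {D Λ : Finset ℤ} (hDΛ : D ⊆ Λ)
    (hh : ∀ x ∉ D, h x = h' x) (σ : Config) :
    weight α h' β Λ σ =
      Real.exp (β * ∑ x ∈ D, (h x - h' x) * (1 - spin (σ x))) * weight α h β Λ σ := by
  have e : ∑ x ∈ D, (h x - h' x) * (1 - spin (σ x)) =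
      ∑ x ∈ Λ, (h x - h' x) * (1 - spin (σ x)) :=
    Finset.sum_subset hDΛ fun x _ hx => by rw [hh x hx]; ring
  unfold weight
  rw [← Real.exp_add, e, hamiltonian_eq, hamiltonian_eq]
  congr 1
  simp only [sub_mul, Finset.sum_sub_distrib]
  ring

/-- A finite perturbation of the field does not destroy the separation of the magnetizations. -/
lemma exists_separated_of_field_eq_off {α : ℝ} (hα : 1 < α) {h h' : ℤ → ℝ} {β : ℝ} (hβ : 0 < β)
    {D : Finset ℤ} (hh : ∀ x ∉ D, h x = h' x)
    (hm : ∀ L, magnetization α h' β false L ≤ -(1 / 2))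
    (hp : ∀ L, 1 / 2 ≤ magnetization α h' β true L) :
    ∃ c > 0, ∀ᶠ L in atTop, magnetization α h β false L + c ≤ magnetization α h β true L := by
  set S : ℝ := ∑ x ∈ D, |h x - h' x| * 2 with hS
  set Φ : Config → ℝ := fun σ => Real.exp (β * ∑ x ∈ D, (h x - h' x) * (1 - spin (σ x))) with hΦ
  have hbound : ∀ σ : Config, |∑ x ∈ D, (h x - h' x) * (1 - spin (σ x))| ≤ S := fun σ => by
    refine (Finset.abs_sum_le_sum_abs _ _).trans (Finset.sum_le_sum fun x _ => ?_)
    rw [abs_mul]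
    refine mul_le_mul_of_nonneg_left ?_ (abs_nonneg _)
    cases σ x <;> norm_num [spin]
  have hΦle : ∀ σ, Φ σ ≤ Real.exp (β * S) := fun σ =>
    Real.exp_le_exp.2 (mul_le_mul_of_nonneg_left (abs_le.1 (hbound σ)).2 hβ.le)
  have hΦge : ∀ σ, Real.exp (-(β * S)) ≤ Φ σ := fun σ => by
    refine Real.exp_le_exp.2 ?_
    have := mul_le_mul_of_nonneg_left (abs_le.1 (hbound σ)).1 hβ.le
    linarith
  -- `Φ` is the unnormalized density of the model with field `h'` with respect to the one with field
  -- `h`.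
  have hratio : ∀ L, D ⊆ box L → ∀ ω, gibbsExp α h β (box L) (fun σ => spin (σ 0) * Φ σ) ω =
      gibbsExp α h' β (box L) (fun σ => spin (σ 0)) ω * gibbsExp α h β (box L) Φ ω := by
    intro L hL ω
    have hw := weight_eq_mul_of_field_eq_off (α := α) β hL hh
    have hZ := (partitionFunction_pos α h β (box L) ω).ne'
    have hZ' := (partitionFunction_pos α h' β (box L) ω).ne'
    have e : partitionFunction α h' β (box L) ω =
        ∑ τ : box L → Bool, Φ (glue (box L) τ ω) * weight α h β (box L) (glue (box L) τ ω) := by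
      rw [partitionFunction_eq]
      exact Finset.sum_congr rfl fun τ _ => hw _
    rw [gibbsExp_eq, gibbsExp_eq, gibbsExp_eq, ← e, div_mul_div_comm, mul_comm _
      (partitionFunction α h' β (box L) ω), mul_div_mul_left _ _ hZ']
    congr 1
    refine Finset.sum_congr rfl fun τ _ => ?_
    rw [hw, ← mul_assoc]
  have hloc : ∀ σ σ' : Config, (∀ x ∈ insert 0 D, σ x = σ' x) →
      spin (σ 0) * Φ σ = spin (σ' 0) * Φ σ' := by
    intro σ σ' hσ
    simp only [hΦ]
    rw [hσ 0 (Finset.mem_insert_self _ _), Finset.sum_congr rfl fun x hx => by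
      rw [hσ x (Finset.mem_insert_of_mem hx)]]
  obtain ⟨C, hC, hmono⟩ := exists_monotone_const_mul_spin_sub hα h hβ hloc
    (K := Real.exp (β * S)) fun σ => by
      rw [abs_mul, abs_spin, one_mul, abs_of_pos (Real.exp_pos _)]
      exact hΦle σ
  refine ⟨Real.exp (-(β * S)) / C, by positivity, ?_⟩
  have hev : ∀ᶠ L in atTop, D ⊆ box L := by
    refine eventually_atTop.2 ⟨D.sup Int.natAbs, fun L hL x hx => ?_⟩
    have := Finset.le_sup (f := Int.natAbs) hx
    rw [mem_box]
    omega
  filter_upwards [hev] with L hL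
  have h0 : ({0} : Finset ℤ) ⊆ box L := by
    simp [mem_box]
  -- Monotonicity of C σ₀ − σ₀Φ bounds C times the magnetization gap below by the difference of the
  -- expectations of σ₀Φ, which is at least half the sum of the two expectations of Φ.
  have key := gibbsExp_mono hα h hβ.le (box L) hmono
    (show (fun _ => false : Config) ≤ fun _ => true from fun _ => Bool.false_le _)
  simp only [gibbsExp_gibbsExp hα h β h0, gibbsExp_add, gibbsExp_const_mul, hratio L hL] at key
  have hk : ∀ ω, Real.exp (-(β * S)) ≤ gibbsExp α h β (box L) Φ ω := fun ω => by
    rw [← gibbsExp_const α h β (box L) (Real.exp (-(β * S))) ω]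
    exact gibbsExp_le α h β _ hΦge ω
  have k1 := hk fun _ => false
  have k2 := hk fun _ => true
  have m1 := hm L
  have m2 := hp L
  have hpos := Real.exp_pos (-(β * S))
  unfold magnetization at m1 m2 ⊢
  set a := gibbsExp α h β (box L) (fun σ => spin (σ 0)) fun _ => false
  set b := gibbsExp α h β (box L) (fun σ => spin (σ 0)) fun _ => true
  have hfin : Real.exp (-(β * S)) ≤ C * (b - a) := by nlinarith
  have := (div_le_iff₀' hC).2 hfin
  linarith

/-! ### Boundary points and insides. -/

/-- The sites with an odd number of points of `γ` at or to the left of them. -/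
def inside (γ : Finset ℤ) : Set ℤ := {x | Odd (γ.filter (· ≤ x)).card}

lemma mem_inside {γ : Finset ℤ} {x : ℤ} : x ∈ inside γ ↔ Odd (γ.filter (· ≤ x)).card := Iff.rfl

lemma inside_iff_iff_even {γ : Finset ℤ} {x y : ℤ} (hxy : x ≤ y) :
    (x ∈ inside γ ↔ y ∈ inside γ) ↔ Even (γ.filter fun p => x < p ∧ p ≤ y).card := by
  have h : (γ.filter (· ≤ y)).card =
      (γ.filter (· ≤ x)).card + (γ.filter fun p => x < p ∧ p ≤ y).card := by
    rw [← Finset.card_union_of_disjoint]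
    · congr 1
      ext p
      simp only [Finset.mem_filter, Finset.mem_union]
      constructor
      · rintro ⟨h1, h2⟩
        by_cases h : p ≤ x
        · exact Or.inl ⟨h1, h⟩
        · exact Or.inr ⟨h1, by omega, h2⟩
      · rintro (⟨h1, h2⟩ | ⟨h1, h2, h3⟩)
        · exact ⟨h1, by omega⟩
        · exact ⟨h1, h3⟩
    · rw [Finset.disjoint_filter]
      intro p _ h1 h2
      omega
  rw [mem_inside, mem_inside, h, Nat.odd_add]
  rw [← Nat.not_odd_iff_even]
  tauto

lemma inside_iff_of_forall {γ : Finset ℤ} {x y : ℤ} (hxy : x ≤ y)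
    (h : ∀ p ∈ γ, x < p → ¬p ≤ y) : x ∈ inside γ ↔ y ∈ inside γ := by
  rw [inside_iff_iff_even hxy, Finset.filter_eq_empty_iff.2]
  · simp
  · rintro p hp ⟨h1, h2⟩
    exact h p hp h1 h2

lemma exists_mem_of_inside_ne {γ : Finset ℤ} {x y : ℤ} (hxy : x ≤ y)
    (h : ¬(x ∈ inside γ ↔ y ∈ inside γ)) : ∃ p ∈ γ, x < p ∧ p ≤ y := by
  by_contra! hc
  exact h (inside_iff_of_forall hxy fun p hp h1 h2 => absurd (hc p hp h1) (by omega))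

lemma inside_pred_iff {γ : Finset ℤ} {p : ℤ} :
    (p - 1 ∈ inside γ ↔ p ∈ inside γ) ↔ p ∉ γ := by
  rw [inside_iff_iff_even (by omega)]
  have h : (γ.filter fun q => p - 1 < q ∧ q ≤ p) = γ.filter (· = p) := by
    refine Finset.filter_congr fun q _ => ?_
    omega
  rw [h, Finset.filter_eq']
  split_ifs with hp <;> simp [hp]

lemma exists_le_of_mem_inside {γ : Finset ℤ} {x : ℤ} (hx : x ∈ inside γ) : ∃ p ∈ γ, p ≤ x := by
  by_contra! hc
  rw [mem_inside, Finset.filter_eq_empty_iff.2 fun p hp => by simpa using hc p hp] at hx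
  simp at hx

lemma exists_lt_of_mem_inside {γ : Finset ℤ} (hγ : Even γ.card) {x : ℤ} (hx : x ∈ inside γ) :
    ∃ p ∈ γ, x < p := by
  by_contra! hc
  rw [mem_inside, Finset.filter_true_of_mem hc] at hx
  exact (Nat.not_odd_iff_even.2 hγ) hx

lemma finite_inside {γ : Finset ℤ} (hγ : Even γ.card) : (inside γ).Finite := by
  by_cases hne : γ.Nonempty
  · refine (Set.finite_Icc (γ.min' hne) (γ.max' hne)).subset fun x hx => ?_
    obtain ⟨p, hp, hpx⟩ := exists_le_of_mem_inside hx
    obtain ⟨q, hq, hqx⟩ := exists_lt_of_mem_inside hγ hx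
    exact ⟨(γ.min'_le p hp).trans hpx, hqx.le.trans (γ.le_max' q hq)⟩
  · rw [Finset.not_nonempty_iff_eq_empty.1 hne]
    convert Set.finite_empty
    ext x
    simp [mem_inside]

/-- The boundary points of `A`: the `p` such that exactly one of `p - 1` and `p` lies in `A`. -/
def boundary (A : Finset ℤ) : Finset ℤ := symmDiff A (A.map (addRightEmbedding 1))

lemma mem_boundary {A : Finset ℤ} {p : ℤ} : p ∈ boundary A ↔ ¬(p - 1 ∈ A ↔ p ∈ A) := by
  have h : p ∈ A.map (addRightEmbedding 1) ↔ p - 1 ∈ A := by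
    simp only [Finset.mem_map, addRightEmbedding_apply]
    constructor
    · rintro ⟨a, ha, rfl⟩; simpa using ha
    · intro hp; exact ⟨_, hp, by ring⟩
  rw [boundary, Finset.mem_symmDiff, h]
  tauto

/-- Both memberships fail far to the left, and on moving right they change at exactly the same
points. -/
lemma mem_inside_boundary {A : Finset ℤ} {x : ℤ} : x ∈ inside (boundary A) ↔ x ∈ A := by
  obtain ⟨m, hm⟩ : ∃ m : ℤ, ∀ a ∈ A, m < a := by
    obtain ⟨m, hm⟩ := A.bddBelow
    exact ⟨m - 1, fun a ha => by have := hm ha; omega⟩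
  have hlow : ∀ x ≤ m, (x ∈ inside (boundary A) ↔ x ∈ A) := by
    intro x hx
    refine iff_of_false (fun h => ?_) fun h => ?_
    · obtain ⟨p, hp, hpx⟩ := exists_le_of_mem_inside h
      rw [mem_boundary] at hp
      refine hp (iff_of_false (fun h => ?_) fun h => ?_)
      · have := hm _ h; omega
      · have := hm _ h; omega
    · have := hm _ h; omega
  rcases le_total x m with hx | hx
  · exact hlow x hx
  · induction x, hx using Int.leInduction with
    | base => exact hlow m le_rfl
    | succ n hn ih =>
      have h1 := inside_pred_iff (γ := boundary A) (p := n + 1)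
      rw [mem_boundary, not_not] at h1
      simp only [add_sub_cancel_right] at h1
      tauto

/-- With odd cardinality the sites far to the right would be inside, hence in `A`. -/
lemma even_card_boundary (A : Finset ℤ) : Even (boundary A).card := by
  obtain ⟨m, hm⟩ := (A ∪ boundary A).bddAbove
  rw [← Nat.not_odd_iff_even]
  intro h
  have h1 : m + 1 ∈ inside (boundary A) := by
    rw [mem_inside, Finset.filter_true_of_mem]
    · exact h
    · intro p hp
      have := hm (Finset.mem_union_right A hp)
      omega
  rw [mem_inside_boundary] at h1
  have := hm (Finset.mem_union_left _ h1)
  omega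

/-! ### Length scales and contours. -/

/-- The diameter of a finite set of integers. -/
def diam (γ : Finset ℤ) : ℕ := (γ ×ˢ γ).sup fun p => (p.1 - p.2).natAbs

lemma diam_le_iff {γ : Finset ℤ} {d : ℕ} :
    diam γ ≤ d ↔ ∀ p ∈ γ, ∀ q ∈ γ, (p - q).natAbs ≤ d := by
  simp only [diam, Finset.sup_le_iff, Finset.mem_product, Prod.forall, and_imp]
  exact ⟨fun h p hp q hq => h p q hp hq, fun h p q hp hq => h p hp q hq⟩

lemma natAbs_sub_le_diam {γ : Finset ℤ} {p q : ℤ} (hp : p ∈ γ) (hq : q ∈ γ) :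
    (p - q).natAbs ≤ diam γ := diam_le_iff.1 le_rfl p hp q hq

lemma diam_mono {γ γ' : Finset ℤ} (h : γ ⊆ γ') : diam γ ≤ diam γ' :=
  diam_le_iff.2 fun _ hp _ hq => natAbs_sub_le_diam (h hp) (h hq)

/-- The exponents of the length scales. -/
def scaleExp (m : ℕ) : ℕ → ℕ
  | 0 => m
  | i + 1 => scaleExp m i + scaleExp m i / 4

/-- The length scales. -/
def scale (m i : ℕ) : ℕ := 2 ^ scaleExp m i

lemma scaleExp_succ (m i : ℕ) : scaleExp m (i + 1) = scaleExp m i + scaleExp m i / 4 := rfl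

lemma scaleExp_mono (m : ℕ) : Monotone (scaleExp m) :=
  monotone_nat_of_le_succ fun i => by rw [scaleExp_succ]; omega

lemma le_scaleExp (m i : ℕ) : m ≤ scaleExp m i := scaleExp_mono m (Nat.zero_le i)

lemma add_le_scaleExp {m : ℕ} (hm : 16 ≤ m) (i : ℕ) : m + 4 * i ≤ scaleExp m i := by
  induction i with
  | zero => simp [scaleExp]
  | succ i ih => rw [scaleExp_succ]; omega

lemma scale_mono (m : ℕ) : Monotone (scale m) := fun _ _ h =>
  Nat.pow_le_pow_right two_pos (scaleExp_mono m h)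

lemma scale_pos (m i : ℕ) : 0 < scale m i := pow_pos two_pos _

lemma scale_succ (m i : ℕ) : scale m (i + 1) = scale m i * 2 ^ (scaleExp m i / 4) := by
  rw [scale, scaleExp_succ, pow_add, scale]

/-- Scales grow superlinearly, so for large `m` one step absorbs any prescribed constant factor. -/
lemma mul_scale_le {m k : ℕ} (hk : 4 * k ≤ m) (i : ℕ) : 2 ^ k * scale m i ≤ scale m (i + 1) := by
  rw [scale_succ, mul_comm]
  have := le_scaleExp m i
  exact Nat.mul_le_mul_left _ (Nat.pow_le_pow_right two_pos (by omega))

lemma exists_le_scale {m : ℕ} (hm : 16 ≤ m) (d : ℕ) : ∃ i, d ≤ 4 * scale m i := by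
  refine ⟨d, ?_⟩
  have h1 := add_le_scaleExp hm d
  have h2 : d < 2 ^ d := Nat.lt_two_pow_self
  have h3 : 2 ^ d ≤ scale m d := Nat.pow_le_pow_right two_pos (by omega)
  omega

open Classical in
/-- The first length scale that is comparable to the diameter of `γ`. -/
noncomputable def scaleIndex (m : ℕ) (γ : Finset ℤ) : ℕ := sInf {i | diam γ ≤ 4 * scale m i}

/-- The set under `sInf` is nonempty and upward closed, so the default value at the empty set plays
no part. -/
lemma scaleIndex_le_iff {m : ℕ} (hm : 16 ≤ m) {γ : Finset ℤ} {i : ℕ} :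
    scaleIndex m γ ≤ i ↔ diam γ ≤ 4 * scale m i := by
  constructor
  · intro h
    have h1 : diam γ ≤ 4 * scale m (scaleIndex m γ) := Nat.sInf_mem (exists_le_scale hm (diam γ))
    have := scale_mono m h
    omega
  · intro h
    exact Nat.sInf_le h

lemma scaleIndex_mono {m : ℕ} (hm : 16 ≤ m) {γ γ' : Finset ℤ} (h : γ ⊆ γ') :
    scaleIndex m γ ≤ scaleIndex m γ' :=
  (scaleIndex_le_iff hm).2 ((diam_mono h).trans ((scaleIndex_le_iff hm).1 le_rfl))

/-- Two sets of boundary points are far apart, compared with the smaller of their diameters. -/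
def Separated (m : ℕ) (γ₁ γ₂ : Finset ℤ) : Prop :=
  ∀ p ∈ γ₁, ∀ q ∈ γ₂, scale m (min (scaleIndex m γ₁) (scaleIndex m γ₂) + 1) < 4 * (p - q).natAbs

lemma Separated.symm {m : ℕ} {γ₁ γ₂ : Finset ℤ} (h : Separated m γ₁ γ₂) : Separated m γ₂ γ₁ := by
  intro p hp q hq
  have := h q hq p hp
  rw [min_comm, ← Int.natAbs_neg, neg_sub]
  exact this

lemma Separated.mono_left {m : ℕ} (hm : 16 ≤ m) {γ₁ γ₂ γ : Finset ℤ} (h : Separated m γ₁ γ₂)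
    (hγ : γ ⊆ γ₁) : Separated m γ γ₂ := by
  intro p hp q hq
  refine lt_of_le_of_lt (scale_mono m ?_) (h p (hγ hp) q hq)
  have := scaleIndex_mono hm hγ
  omega

/-- A set of boundary points that cannot be split into two separated even pieces. -/
def Unsplittable (m : ℕ) (γ : Finset ℤ) : Prop :=
  ∀ γ₁ ⊆ γ, γ₁.Nonempty → (γ \ γ₁).Nonempty → Even γ₁.card → ¬Separated m γ₁ (γ \ γ₁)

/-- A family of pairwise separated even sets of boundary points that partition `S`. -/
structure IsContourFamily (m : ℕ) (S : Finset ℤ) (P : Finset (Finset ℤ)) : Prop where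
  nonempty : ∀ γ ∈ P, γ.Nonempty
  even : ∀ γ ∈ P, Even γ.card
  disjoint : ∀ γ₁ ∈ P, ∀ γ₂ ∈ P, γ₁ ≠ γ₂ → Disjoint γ₁ γ₂
  union : P.biUnion id = S
  separated : ∀ γ₁ ∈ P, ∀ γ₂ ∈ P, γ₁ ≠ γ₂ → Separated m γ₁ γ₂

lemma IsContourFamily.split {m : ℕ} (hm : 16 ≤ m) {S : Finset ℤ} {P : Finset (Finset ℤ)}
    (hP : IsContourFamily m S P) {γ γ₁ : Finset ℤ} (hγ : γ ∈ P) (h1 : γ₁ ⊆ γ)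
    (hne : γ₁.Nonempty) (hne' : (γ \ γ₁).Nonempty) (he : Even γ₁.card)
    (hs : Separated m γ₁ (γ \ γ₁)) :
    ∃ P', IsContourFamily m S P' ∧ P.card < P'.card := by
  set γ₂ := γ \ γ₁ with hγ₂
  have h2 : γ₂ ⊆ γ := Finset.sdiff_subset
  have he2 : Even γ₂.card := by
    have hc := Finset.card_sdiff_add_card_eq_card h1
    have := hP.even γ hγ
    rw [← hc, Nat.even_add] at this
    exact this.2 he
  have hd12 : Disjoint γ₁ γ₂ := Finset.disjoint_sdiff
  have hrest : ∀ δ ∈ P.erase γ, Disjoint γ δ ∧ Separated m γ δ := fun δ hδ =>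
    ⟨hP.disjoint γ hγ δ (Finset.mem_of_mem_erase hδ) (Finset.ne_of_mem_erase hδ).symm,
      hP.separated γ hγ δ (Finset.mem_of_mem_erase hδ) (Finset.ne_of_mem_erase hδ).symm⟩
  have hnotin : ∀ δ ⊆ γ, δ.Nonempty → δ ∉ P.erase γ := by
    intro δ hδ hδne hmem
    obtain ⟨x, hx⟩ := hδne
    exact Finset.disjoint_left.1 (hrest δ hmem).1 (hδ hx) hx
  have hne12 : γ₁ ≠ γ₂ := by
    intro h
    obtain ⟨x, hx⟩ := hne
    exact Finset.disjoint_left.1 hd12 hx (h ▸ hx)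
  refine ⟨insert γ₁ (insert γ₂ (P.erase γ)), ⟨?_, ?_, ?_, ?_, ?_⟩, ?_⟩
  · intro δ hδ
    simp only [Finset.mem_insert] at hδ
    rcases hδ with rfl | rfl | hδ
    exacts [hne, hne', hP.nonempty δ (Finset.mem_of_mem_erase hδ)]
  · intro δ hδ
    simp only [Finset.mem_insert] at hδ
    rcases hδ with rfl | rfl | hδ
    exacts [he, he2, hP.even δ (Finset.mem_of_mem_erase hδ)]
  · intro δ hδ δ' hδ' hdd
    simp only [Finset.mem_insert] at hδ hδ'
    rcases hδ with rfl | rfl | hδ <;> rcases hδ' with rfl | rfl | hδ'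
    · exact absurd rfl hdd
    · exact hd12
    · exact (hrest δ' hδ').1.mono_left h1
    · exact hd12.symm
    · exact absurd rfl hdd
    · exact (hrest δ' hδ').1.mono_left h2
    · exact ((hrest δ hδ).1.mono_left h1).symm
    · exact ((hrest δ hδ).1.mono_left h2).symm
    · exact hP.disjoint δ (Finset.mem_of_mem_erase hδ) δ' (Finset.mem_of_mem_erase hδ') hdd
  · rw [← hP.union, Finset.biUnion_insert, Finset.biUnion_insert, ← Finset.union_assoc, id, id,
      Finset.union_sdiff_of_subset h1]
    conv_rhs => rw [← Finset.insert_erase hγ, Finset.biUnion_insert, id]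
  · intro δ hδ δ' hδ' hdd
    simp only [Finset.mem_insert] at hδ hδ'
    rcases hδ with rfl | rfl | hδ <;> rcases hδ' with rfl | rfl | hδ'
    · exact absurd rfl hdd
    · exact hs
    · exact (hrest δ' hδ').2.mono_left hm h1
    · exact hs.symm
    · exact absurd rfl hdd
    · exact (hrest δ' hδ').2.mono_left hm h2
    · exact ((hrest δ hδ).2.mono_left hm h1).symm
    · exact ((hrest δ hδ).2.mono_left hm h2).symm
    · exact hP.separated δ (Finset.mem_of_mem_erase hδ) δ' (Finset.mem_of_mem_erase hδ') hdd
  · rw [Finset.card_insert_of_notMem, Finset.card_insert_of_notMem (hnotin γ₂ h2 hne'),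
      Finset.card_erase_of_mem hγ]
    · have := Finset.card_pos.2 ⟨γ, hγ⟩
      omega
    · rw [Finset.mem_insert, not_or]
      exact ⟨hne12, hnotin γ₁ h1 hne⟩

/-- Take a family with as many members as possible: by `IsContourFamily.split`, splitting a member
would give a larger one. -/
lemma exists_contourFamily {m : ℕ} (hm : 16 ≤ m) {S : Finset ℤ} (hS : S.Nonempty)
    (he : Even S.card) :
    ∃ P, IsContourFamily m S P ∧ ∀ γ ∈ P, Unsplittable m γ := by
  classical
  set F := (S.powerset.powerset).filter (IsContourFamily m S) with hF
  have hmem : ∀ P, IsContourFamily m S P → P ∈ F := by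
    intro P hP
    rw [hF, Finset.mem_filter, Finset.mem_powerset]
    refine ⟨fun γ hγ => ?_, hP⟩
    rw [Finset.mem_powerset, ← hP.union]
    exact Finset.subset_biUnion_of_mem id hγ
  have hne : F.Nonempty := by
    refine ⟨{S}, hmem _ ⟨?_, ?_, ?_, by simp, ?_⟩⟩ <;> simp [hS, he]
  obtain ⟨P, hPF, hmax⟩ := F.exists_max_image Finset.card hne
  have hP := (Finset.mem_filter.1 hPF).2
  refine ⟨P, hP, fun γ hγ γ₁ h1 h2 h3 h4 h5 => ?_⟩
  obtain ⟨P', hP', hlt⟩ := hP.split hm hγ h1 h2 h3 h4 h5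
  exact absurd (hmax P' (hmem P' hP')) (by omega)

lemma IsContourFamily.card_filter {m : ℕ} {S : Finset ℤ} {P : Finset (Finset ℤ)}
    (hP : IsContourFamily m S P) (r : ℤ → Prop) [DecidablePred r] :
    (S.filter r).card = ∑ γ ∈ P, (γ.filter r).card := by
  rw [← hP.union, Finset.filter_biUnion, Finset.card_biUnion]
  · rfl
  · intro γ₁ h1 γ₂ h2 hne
    exact Finset.disjoint_filter_filter (hP.disjoint γ₁ h1 γ₂ h2 hne)

/-- Being inside is a parity, and the parities of the members add up to that of `S`. -/
lemma IsContourFamily.exists_mem_inside {m : ℕ} {S : Finset ℤ} {P : Finset (Finset ℤ)}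
    (hP : IsContourFamily m S P) {x : ℤ} (hx : x ∈ inside S) : ∃ γ ∈ P, x ∈ inside γ := by
  by_contra! hc
  rw [mem_inside, hP.card_filter, ← Nat.not_even_iff_odd] at hx
  exact hx (Finset.even_sum _ fun γ hγ => by
    have := hc γ hγ
    rwa [mem_inside, Nat.not_odd_iff_even] at this)

/-- If a contour separates two sites on the same side of the whole boundary, then another
contour separates them too. -/
lemma IsContourFamily.exists_ne_inside {m : ℕ} {S : Finset ℤ} {P : Finset (Finset ℤ)}
    (hP : IsContourFamily m S P) {γ : Finset ℤ} (hγ : γ ∈ P) {x y : ℤ}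
    (hS : x ∈ inside S ↔ y ∈ inside S) (hxy : ¬(x ∈ inside γ ↔ y ∈ inside γ)) :
    ∃ γ' ∈ P, γ' ≠ γ ∧ ¬(x ∈ inside γ' ↔ y ∈ inside γ') := by
  wlog hle : x ≤ y generalizing x y
  · obtain ⟨γ', h1, h2, h3⟩ := this hS.symm (fun h => hxy h.symm) (by omega)
    exact ⟨γ', h1, h2, fun h => h3 h.symm⟩
  by_contra! hc
  rw [inside_iff_iff_even hle] at hxy hS
  rw [hP.card_filter, ← Finset.add_sum_erase _ _ hγ, Nat.even_add] at hS
  refine hxy (hS.2 (Finset.even_sum _ fun γ' hγ' => ?_))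
  rw [← inside_iff_iff_even hle]
  exact hc γ' (Finset.mem_of_mem_erase hγ') (Finset.ne_of_mem_erase hγ')

/-! ### Pair sums and cuts. -/

/-- The coupling between the two sites of a pair, as an extended nonnegative real. -/
noncomputable def pairCoupling (α : ℝ) (p : ℤ × ℤ) : ℝ≥0∞ :=
  ENNReal.ofReal (coupling α (p.1 - p.2).natAbs)

/-- The total coupling of a set of ordered pairs. -/
noncomputable def pairSum (α : ℝ) (S : Set (ℤ × ℤ)) : ℝ≥0∞ :=
  ∑' p, S.indicator (pairCoupling α) p

/-- The ordered pairs of sites with exactly one site in `B`. -/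
def cut (B : Set ℤ) : Set (ℤ × ℤ) := {p | ¬(p.1 ∈ B ↔ p.2 ∈ B)}

lemma mem_cut {B : Set ℤ} {p : ℤ × ℤ} : p ∈ cut B ↔ ¬(p.1 ∈ B ↔ p.2 ∈ B) := Iff.rfl

lemma pairSum_mono (α : ℝ) {S T : Set (ℤ × ℤ)} (h : S ⊆ T) : pairSum α S ≤ pairSum α T :=
  ENNReal.tsum_le_tsum fun _ => Set.indicator_le_indicator_of_subset h (fun _ => zero_le) _

lemma pairSum_union_le (α : ℝ) (S T : Set (ℤ × ℤ)) :
    pairSum α (S ∪ T) ≤ pairSum α S + pairSum α T := by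
  unfold pairSum
  rw [← ENNReal.tsum_add]
  refine ENNReal.tsum_le_tsum fun p => ?_
  by_cases h1 : p ∈ S <;> by_cases h2 : p ∈ T <;> simp [h1, h2]

lemma sum_pairCoupling_le_pairSum (α : ℝ) {F : Finset (ℤ × ℤ)} {S : Set (ℤ × ℤ)}
    (h : ∀ p ∈ F, p ∈ S) : ∑ p ∈ F, pairCoupling α p ≤ pairSum α S := by
  calc ∑ p ∈ F, pairCoupling α p = ∑ p ∈ F, S.indicator (pairCoupling α) p :=
        Finset.sum_congr rfl fun p hp => (Set.indicator_of_mem (h p hp) _).symm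
    _ ≤ _ := ENNReal.sum_le_tsum F

lemma sum_pairSum_le {ι : Type*} (α : ℝ) (s : Finset ι) {S : ι → Set (ℤ × ℤ)}
    {T : Set (ℤ × ℤ)} (hd : ∀ i ∈ s, ∀ j ∈ s, i ≠ j → Disjoint (S i) (S j))
    (hT : ∀ i ∈ s, S i ⊆ T) : ∑ i ∈ s, pairSum α (S i) ≤ pairSum α T := by
  unfold pairSum
  rw [← Summable.tsum_finsetSum fun i _ => ENNReal.summable]
  refine ENNReal.tsum_le_tsum fun p => ?_
  by_cases hp : ∃ i ∈ s, p ∈ S i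
  · obtain ⟨i, hi, hpi⟩ := hp
    rw [Finset.sum_eq_single_of_mem i hi fun j hj hne =>
      Set.indicator_of_notMem (fun h => Set.disjoint_left.1 (hd j hj i hi hne) h hpi) _,
      Set.indicator_of_mem hpi, Set.indicator_of_mem (hT i hi hpi)]
  · push Not at hp
    rw [Finset.sum_eq_zero fun i hi => Set.indicator_of_notMem (hp i hi) _]
    exact zero_le

/-- Comparison with the borderline decay r^(-2). The energy bounds that control entropy rest on it,
so their constants do not depend on α. -/
lemma inv_sq_le_pairCoupling {α : ℝ} (hα₂ : α ≤ 2) {p : ℤ × ℤ} (hp : p.1 ≠ p.2)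
    {R : ℕ} (hR : (p.1 - p.2).natAbs ≤ R) : ((R : ℝ≥0∞) ^ 2)⁻¹ ≤ pairCoupling α p := by
  have hr0 : (p.1 - p.2).natAbs ≠ 0 := by omega
  have hr : (1 : ℝ) ≤ (p.1 - p.2).natAbs := by exact_mod_cast Nat.one_le_iff_ne_zero.2 hr0
  have hrR : ((p.1 - p.2).natAbs : ℝ) ≤ R := by exact_mod_cast hR
  have h1 : ((R : ℝ) ^ 2)⁻¹ ≤ coupling α (p.1 - p.2).natAbs := by
    rw [coupling, if_neg hr0, Real.rpow_neg (by linarith)]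
    refine inv_anti₀ (by positivity) ?_
    calc ((p.1 - p.2).natAbs : ℝ) ^ α ≤ ((p.1 - p.2).natAbs : ℝ) ^ (2 : ℝ) :=
          Real.rpow_le_rpow_of_exponent_le hr hα₂
      _ = ((p.1 - p.2).natAbs : ℝ) ^ 2 := by norm_cast
      _ ≤ (R : ℝ) ^ 2 := by gcongr
  have h2 : ((R : ℝ≥0∞) ^ 2)⁻¹ = ENNReal.ofReal (((R : ℝ) ^ 2)⁻¹) := by
    rw [ENNReal.ofReal_inv_of_pos (by nlinarith), ENNReal.ofReal_pow (by positivity),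
      ENNReal.ofReal_natCast]
  rw [h2]
  exact ENNReal.ofReal_le_ofReal h1

lemma card_le_pairSum_cut {α : ℝ} (hα₂ : α ≤ 2) (γ : Finset ℤ) :
    (γ.card : ℝ≥0∞) ≤ pairSum α (cut (inside γ)) := by
  have hinj : Set.InjOn (fun p : ℤ => (p - 1, p)) γ := fun a _ b _ h => by
    simpa using congrArg Prod.snd h
  calc (γ.card : ℝ≥0∞) = ∑ p ∈ γ, 1 := by simp
    _ ≤ ∑ p ∈ γ, pairCoupling α (p - 1, p) := Finset.sum_le_sum fun p _ => by
        have := inv_sq_le_pairCoupling hα₂ (p := (p - 1, p)) (R := 1) (by simp) (by simp)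
        simpa using this
    _ = ∑ q ∈ γ.image fun p : ℤ => (p - 1, p), pairCoupling α q :=
        (Finset.sum_image hinj).symm
    _ ≤ _ := sum_pairCoupling_le_pairSum α fun q hq => by
        obtain ⟨p, hp, rfl⟩ := Finset.mem_image.1 hq
        rw [mem_cut, inside_pred_iff]
        exact not_not.2 hp

/-! ### Nets, lonely points and the energy they force. -/

lemma exists_net (γ : Finset ℤ) {R : ℕ} (hR : 0 < R) :
    ∃ X ⊆ γ, (∀ x ∈ X, ∀ y ∈ X, x ≠ y → R ≤ (x - y).natAbs) ∧
      ∀ p ∈ γ, ∃ x ∈ X, (p - x).natAbs < R := by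
  classical
  set F := γ.powerset.filter fun X => ∀ x ∈ X, ∀ y ∈ X, x ≠ y → R ≤ (x - y).natAbs with hF
  obtain ⟨X, hX, hmax⟩ := F.exists_max_image Finset.card ⟨∅, by simp [hF]⟩
  rw [hF, Finset.mem_filter, Finset.mem_powerset] at hX
  refine ⟨X, hX.1, hX.2, fun p hp => ?_⟩
  by_contra! hc
  have hpX : p ∉ X := fun h => by have := hc p h; simp at this; omega
  have := hmax (insert p X) (by
    rw [hF, Finset.mem_filter, Finset.mem_powerset]
    refine ⟨Finset.insert_subset hp hX.1, fun x hx y hy hne => ?_⟩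
    rcases Finset.mem_insert.1 hx with h1 | h1 <;> rcases Finset.mem_insert.1 hy with h2 | h2
    · exact absurd (h1.trans h2.symm) hne
    · have := hc y h2; rwa [h1]
    · have := hc x h1; omega
    · exact hX.2 x h1 y h2 hne)
  rw [Finset.card_insert_of_notMem hpX] at this
  omega

/-- A maximal separated subset of `γ` at the scale `scale m i`. -/
noncomputable def net (m : ℕ) (γ : Finset ℤ) (i : ℕ) : Finset ℤ :=
  (exists_net γ (scale_pos m i)).choose

lemma net_subset (m : ℕ) (γ : Finset ℤ) (i : ℕ) : net m γ i ⊆ γ :=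
  (exists_net γ (scale_pos m i)).choose_spec.1

lemma scale_le_of_mem_net {m : ℕ} {γ : Finset ℤ} {i : ℕ} {x y : ℤ} (hx : x ∈ net m γ i)
    (hy : y ∈ net m γ i) (hne : x ≠ y) : scale m i ≤ (x - y).natAbs :=
  (exists_net γ (scale_pos m i)).choose_spec.2.1 x hx y hy hne

lemma exists_mem_net {m : ℕ} {γ : Finset ℤ} (i : ℕ) {p : ℤ} (hp : p ∈ γ) :
    ∃ x ∈ net m γ i, (p - x).natAbs < scale m i :=
  (exists_net γ (scale_pos m i)).choose_spec.2.2 p hp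

/-- The points of a net whose neighbourhood contains a single point of the finer net. -/
noncomputable def lonely (m : ℕ) (γ : Finset ℤ) (i : ℕ) : Finset ℤ :=
  (net m γ (i + 1)).filter fun x =>
    ((net m γ i).filter fun y => 2 * (y - x).natAbs < scale m (i + 1)).card ≤ 1

/-- Neighbourhoods of distinct coarse points are disjoint, and each contains at least two fine
points unless its centre is lonely. So the net at least halves at each scale, up to lonely points.
-/
lemma two_mul_card_net_le {m : ℕ} (hm : 64 ≤ m) (γ : Finset ℤ) (i : ℕ) :
    2 * (net m γ (i + 1)).card ≤ (net m γ i).card + (lonely m γ i).card := by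
  have hs := mul_scale_le (k := 4) (by omega : 4 * 4 ≤ m) i
  set nb : ℤ → Finset ℤ := fun x =>
    (net m γ i).filter fun y => 2 * (y - x).natAbs < scale m (i + 1) with hnb
  have h1 : ∑ x ∈ net m γ (i + 1), (nb x).card ≤ (net m γ i).card := by
    rw [← Finset.card_biUnion]
    · refine Finset.card_le_card (Finset.biUnion_subset.2 fun x _ => Finset.filter_subset _ _)
    · intro x hx y hy hne
      rw [Function.onFun, Finset.disjoint_left]
      intro z hzx hzy
      have h1 := (Finset.mem_filter.1 hzx).2
      have h2 := (Finset.mem_filter.1 hzy).2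
      have h3 := scale_le_of_mem_net hx hy hne
      omega
  have h2 : ∑ x ∈ net m γ (i + 1), 2 ≤
      ∑ x ∈ net m γ (i + 1), ((nb x).card + if (nb x).card ≤ 1 then 1 else 0) := by
    refine Finset.sum_le_sum fun x hx => ?_
    have hpos : 0 < (nb x).card := by
      obtain ⟨y, hy, hyx⟩ := exists_mem_net i (net_subset m γ (i + 1) hx)
      exact Finset.card_pos.2 ⟨y, Finset.mem_filter.2 ⟨hy, by omega⟩⟩
    split_ifs <;> omega
  rw [Finset.sum_add_distrib, ← Finset.card_filter, Finset.sum_const, smul_eq_mul] at h2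
  have h3 : (lonely m γ i).card =
    ((net m γ (i + 1)).filter fun x => (nb x).card ≤ 1).card := rfl
  omega

/-- A lonely point carries a small cluster of `γ` surrounded by a wide gap, since points in the gap
would lie near a second fine net point. -/
lemma natAbs_sub_lt_of_mem_lonely {m : ℕ} (hm : 64 ≤ m) {γ : Finset ℤ} {i : ℕ} {x p : ℤ}
    (hx : x ∈ lonely m γ i) (hp : p ∈ γ)
    (hpx : 2 * (p - x).natAbs + 2 * scale m i < scale m (i + 1)) :
    (p - x).natAbs < 2 * scale m i := by
  have hs := mul_scale_le (k := 4) (by omega : 4 * 4 ≤ m) i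
  have hpos := scale_pos m i
  obtain ⟨hx1, hx2⟩ := Finset.mem_filter.1 hx
  obtain ⟨y, hy, hyx⟩ := exists_mem_net i (net_subset m γ (i + 1) hx1)
  obtain ⟨z, hz, hzp⟩ := exists_mem_net i hp
  have hyz : y = z := Finset.card_le_one.1 hx2 y (Finset.mem_filter.2 ⟨hy, by omega⟩) z
    (Finset.mem_filter.2 ⟨hz, by omega⟩)
  subst hyz
  omega

/-- An even cluster with such a gap around it would be separated from the rest and could be split
off. The rest is nonempty because `γ` is too large for scale `i`. -/
lemma odd_card_of_mem_lonely {m : ℕ} (hm : 64 ≤ m) {γ : Finset ℤ} (hγ : Unsplittable m γ)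
    {i : ℕ} (hi : i < scaleIndex m γ) {x : ℤ} (hx : x ∈ lonely m γ i) :
    Odd (γ.filter fun p => (p - x).natAbs < 2 * scale m i).card := by
  have hs := mul_scale_le (k := 4) (by omega : 4 * 4 ≤ m) i
  have hpos := scale_pos m i
  set γ₁ := γ.filter fun p => (p - x).natAbs < 2 * scale m i with hγ₁
  have hd : diam γ₁ ≤ 4 * scale m i := by
    rw [diam_le_iff]
    intro p hp q hq
    have h1 := (Finset.mem_filter.1 hp).2
    have h2 := (Finset.mem_filter.1 hq).2
    omega
  have hidx : scaleIndex m γ₁ ≤ i := (scaleIndex_le_iff (by omega)).2 hd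
  have hxγ : x ∈ γ := net_subset m γ (i + 1) (Finset.mem_filter.1 hx).1
  rw [← Nat.not_even_iff_odd]
  intro he
  refine hγ γ₁ (Finset.filter_subset _ _) ⟨x, Finset.mem_filter.2 ⟨hxγ, by simp; omega⟩⟩ ?_ he ?_
  · rw [Finset.sdiff_nonempty]
    intro hsub
    have := scaleIndex_mono (m := m) (by omega) hsub
    omega
  · intro p hp q hq
    obtain ⟨hq1, hq2⟩ := Finset.mem_sdiff.1 hq
    have h1 := (Finset.mem_filter.1 hp).2
    have h2 : ¬(q - x).natAbs < 2 * scale m i := fun h => hq2 (Finset.mem_filter.2 ⟨hq1, h⟩)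
    have h3 : ¬(2 * (q - x).natAbs + 2 * scale m i < scale m (i + 1)) := fun h =>
      h2 (natAbs_sub_lt_of_mem_lonely hm hx hq1 h)
    have h4 := scale_mono m (show min (scaleIndex m γ₁) (scaleIndex m (γ \ γ₁)) + 1 ≤ i + 1 by
      omega)
    omega

/-- The points of `γ` between the two sites are exactly the odd cluster. -/
lemma mem_cut_of_mem_lonely {m : ℕ} (hm : 64 ≤ m) {γ : Finset ℤ} (hγ : Unsplittable m γ)
    {i : ℕ} (hi : i < scaleIndex m γ) {x : ℤ} (hx : x ∈ lonely m γ i) {s t : ℤ}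
    (hs : (2 * scale m i : ℕ) ≤ s) (ht : (2 * scale m i : ℕ) ≤ t)
    (hs' : 4 * s ≤ (scale m (i + 1) : ℕ)) (ht' : 4 * t ≤ (scale m (i + 1) : ℕ)) :
    (x - s, x + t) ∈ cut (inside γ) := by
  have hsc := mul_scale_le (k := 4) (by omega : 4 * 4 ≤ m) i
  have hpos := scale_pos m i
  rw [mem_cut, inside_iff_iff_even (by omega : x - s ≤ x + t), Nat.not_even_iff_odd]
  convert odd_card_of_mem_lonely hm hγ hi hx using 2
  refine Finset.filter_congr fun p hp => ⟨fun h => ?_, fun h => ?_⟩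
  · exact natAbs_sub_lt_of_mem_lonely hm hx hp (by omega)
  · omega

/-- The pairs cut by `γ` at distance of order `2 ^ k`. -/
def cutAt (γ : Finset ℤ) (k : ℕ) : Set (ℤ × ℤ) :=
  {p | p ∈ cut (inside γ) ∧ 2 ^ (k + 1) < (p.1 - p.2).natAbs ∧ (p.1 - p.2).natAbs ≤ 2 ^ (k + 2)}

lemma sum_pairSum_cutAt_le (α : ℝ) (γ : Finset ℤ) (s : Finset ℕ) :
    ∑ k ∈ s, pairSum α (cutAt γ k) ≤ pairSum α (cut (inside γ)) := by
  refine sum_pairSum_le α s (fun i _ j _ hij => ?_) fun i _ p hp => hp.1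
  rw [Set.disjoint_left]
  rintro p ⟨-, h1, h2⟩ ⟨-, h3, h4⟩
  rcases lt_or_gt_of_ne hij with h | h
  · have := Nat.pow_le_pow_right two_pos (show i + 2 ≤ j + 1 by omega)
    omega
  · have := Nat.pow_le_pow_right two_pos (show j + 2 ≤ i + 1 by omega)
    omega

/-- Each lonely point yields 4^k cut pairs of length at most 4·2^k, so total coupling at least 1/16.
Pairs from distinct lonely points differ because coarse net points are far apart. -/
lemma card_lonely_le {α : ℝ} (hα₂ : α ≤ 2) {m : ℕ} (hm : 64 ≤ m) {γ : Finset ℤ}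
    (hγ : Unsplittable m γ) {i : ℕ} (hi : i < scaleIndex m γ) {k : ℕ}
    (hk : scaleExp m i + 1 ≤ k) (hk' : k + 3 ≤ scaleExp m (i + 1)) :
    ((lonely m γ i).card : ℝ≥0∞) ≤ 16 * pairSum α (cutAt γ k) := by
  have h1 : 2 * scale m i ≤ 2 ^ k := by
    calc 2 * scale m i = 2 ^ (scaleExp m i + 1) := by rw [pow_succ, scale]; ring
      _ ≤ _ := Nat.pow_le_pow_right two_pos hk
  have h2 : 8 * 2 ^ k ≤ scale m (i + 1) := by
    calc 8 * 2 ^ k = 2 ^ (k + 3) := by ring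
      _ ≤ _ := Nat.pow_le_pow_right two_pos hk'
  have hpos : 0 < 2 ^ k := pow_pos two_pos k
  set I : Finset ℤ := Finset.Ioc ((2 ^ k : ℕ) : ℤ) ((2 * 2 ^ k : ℕ) : ℤ) with hI
  have hIc : I.card = 2 ^ k := by
    rw [hI, Int.card_Ioc]
    omega
  set f : ℤ × ℤ × ℤ → ℤ × ℤ := fun q => (q.1 - q.2.1, q.1 + q.2.2) with hf
  set T := lonely m γ i ×ˢ I ×ˢ I with hT
  have hmemT : ∀ q ∈ T, q.1 ∈ lonely m γ i ∧ ((2 ^ k : ℕ) < q.2.1 ∧ q.2.1 ≤ (2 * 2 ^ k : ℕ)) ∧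
      ((2 ^ k : ℕ) < q.2.2 ∧ q.2.2 ≤ (2 * 2 ^ k : ℕ)) := by
    intro q hq
    simpa only [hT, hI, Finset.mem_product, Finset.mem_Ioc] using hq
  have hinj : Set.InjOn f T := by
    rintro ⟨x, s, t⟩ hq ⟨x', s', t'⟩ hq' h
    obtain ⟨hx, hs, ht⟩ := hmemT _ hq
    obtain ⟨hx', hs', ht'⟩ := hmemT _ hq'
    simp only [hf, Prod.mk.injEq] at h hx hs ht hx' hs' ht'
    have hxx : x = x' := by
      by_contra hne
      have := scale_le_of_mem_net (Finset.mem_filter.1 hx).1 (Finset.mem_filter.1 hx').1 hne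
      omega
    subst hxx
    simp only [Prod.mk.injEq, true_and]
    omega
  have hsum : ∑ q ∈ T, pairCoupling α (f q) ≤ pairSum α (cutAt γ k) := by
    rw [← Finset.sum_image (f := pairCoupling α) hinj]
    refine sum_pairCoupling_le_pairSum α fun p hp => ?_
    obtain ⟨⟨x, s, t⟩, hq, rfl⟩ := Finset.mem_image.1 hp
    obtain ⟨hx, hs, ht⟩ := hmemT _ hq
    simp only at hx hs ht
    refine ⟨mem_cut_of_mem_lonely (s := s) (t := t) hm hγ hi hx (by omega) (by omega) (by omega)
      (by omega), ?_, ?_⟩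
    · simp only [hf, pow_succ]; omega
    · simp only [hf, pow_succ]; omega
  have hlow : (T.card : ℝ≥0∞) * (((4 * 2 ^ k : ℕ) : ℝ≥0∞) ^ 2)⁻¹ ≤
      ∑ q ∈ T, pairCoupling α (f q) := by
    rw [← nsmul_eq_mul, ← Finset.sum_const]
    refine Finset.sum_le_sum fun q hq => ?_
    obtain ⟨hx, hs, ht⟩ := hmemT _ hq
    refine inv_sq_le_pairCoupling hα₂ ?_ ?_
    · simp only [hf]; omega
    · simp only [hf]; omega
  have hcard : T.card = (lonely m γ i).card * (2 ^ k * 2 ^ k) := by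
    rw [hT, Finset.card_product, Finset.card_product, hIc]
  have hA : (16 : ℝ≥0∞) * ((T.card : ℝ≥0∞) * (((4 * 2 ^ k : ℕ) : ℝ≥0∞) ^ 2)⁻¹) =
      (lonely m γ i).card := by
    rw [hcard]
    have hne : (((4 * 2 ^ k : ℕ) : ℝ≥0∞) ^ 2) ≠ 0 := by simp
    have hnt : (((4 * 2 ^ k : ℕ) : ℝ≥0∞) ^ 2) ≠ ⊤ := ENNReal.pow_ne_top (ENNReal.natCast_ne_top _)
    have : (16 : ℝ≥0∞) * (((lonely m γ i).card * (2 ^ k * 2 ^ k) : ℕ) : ℝ≥0∞) =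
        (lonely m γ i).card * (((4 * 2 ^ k : ℕ) : ℝ≥0∞) ^ 2) := by
      push_cast; ring
    rw [← mul_assoc, this, mul_assoc, ENNReal.mul_inv_cancel hne hnt, mul_one]
  calc ((lonely m γ i).card : ℝ≥0∞) = _ := hA.symm
    _ ≤ 16 * pairSum α (cutAt γ k) := by gcongr; exact hlow.trans hsum

/-- The gap at scale `i` spans a number of dyadic shells proportional to `scaleExp m i`, each
costing a constant amount of energy; shells of different scales are disjoint. -/
lemma sum_card_lonely_mul_le {α : ℝ} (hα₂ : α ≤ 2) {m : ℕ} (hm : 64 ≤ m)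
    {γ : Finset ℤ} (hγ : Unsplittable m γ) :
    ((∑ i ∈ Finset.range (scaleIndex m γ), (lonely m γ i).card * scaleExp m i : ℕ) : ℝ≥0∞) ≤
      128 * pairSum α (cut (inside γ)) := by
  have h1 : ∀ n ≤ scaleIndex m γ,
      ((∑ i ∈ Finset.range n, (lonely m γ i).card * scaleExp m i : ℕ) : ℝ≥0∞) ≤
      128 * ∑ k ∈ Finset.Ico (scaleExp m 0) (scaleExp m n), pairSum α (cutAt γ k) := by
    intro n
    induction n with
    | zero => simp
    | succ n ih =>
      intro hn
      rw [Finset.sum_range_succ, Nat.cast_add,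
        ← Finset.sum_Ico_consecutive _ (scaleExp_mono m (Nat.zero_le n))
          (scaleExp_mono m (Nat.le_succ n)), mul_add]
      refine add_le_add (ih (by omega)) ?_
      have hl := le_scaleExp m n
      have hsucc := scaleExp_succ m n
      -- Trimming one shell below and two above still leaves at least an eighth of the exponent,
      -- because it is at least 64.
      set I := Finset.Ico (scaleExp m n + 1) (scaleExp m (n + 1) - 2) with hI
      have hIsub : I ⊆ Finset.Ico (scaleExp m n) (scaleExp m (n + 1)) :=
        Finset.Ico_subset_Ico (by omega) (by omega)
      have hIc : scaleExp m n ≤ 8 * I.card := by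
        rw [hI, Nat.card_Ico]; omega
      calc (((lonely m γ n).card * scaleExp m n : ℕ) : ℝ≥0∞)
          ≤ (((lonely m γ n).card * (8 * I.card) : ℕ) : ℝ≥0∞) := by
            exact_mod_cast Nat.mul_le_mul_left _ hIc
        _ = 8 * ∑ k ∈ I, ((lonely m γ n).card : ℝ≥0∞) := by
            rw [Finset.sum_const, nsmul_eq_mul]; push_cast; ring
        _ ≤ 8 * ∑ k ∈ I, 16 * pairSum α (cutAt γ k) := by
            gcongr with k hk
            rw [hI, Finset.mem_Ico] at hk
            exact card_lonely_le hα₂ hm hγ (by omega) hk.1 (by omega)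
        _ = 128 * ∑ k ∈ I, pairSum α (cutAt γ k) := by
            rw [← Finset.mul_sum, ← mul_assoc]; norm_num
        _ ≤ _ := by gcongr
  refine (h1 _ le_rfl).trans ?_
  gcongr
  exact sum_pairSum_cutAt_le α γ _

/-- Per scale the net halves while the exponent grows by at most 5/4, so apart from lonely points
their product contracts by 5/8 and the sum is geometric. -/
lemma three_mul_sum_card_net_le {m : ℕ} (hm : 64 ≤ m) (γ : Finset ℤ) (n : ℕ) :
    3 * ∑ i ∈ Finset.range n, (net m γ i).card * scaleExp m i ≤
      8 * (γ.card * m) + 5 * ∑ i ∈ Finset.range n, (lonely m γ i).card * scaleExp m i := by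
  have h1 : ∀ i, 8 * ((net m γ (i + 1)).card * scaleExp m (i + 1)) ≤
      5 * ((net m γ i).card * scaleExp m i) + 5 * ((lonely m γ i).card * scaleExp m i) := by
    intro i
    have h2 := two_mul_card_net_le hm γ i
    have h3 : 4 * scaleExp m (i + 1) ≤ 5 * scaleExp m i := by rw [scaleExp_succ]; omega
    calc 8 * ((net m γ (i + 1)).card * scaleExp m (i + 1))
        = (2 * (net m γ (i + 1)).card) * (4 * scaleExp m (i + 1)) := by ring
      _ ≤ ((net m γ i).card + (lonely m γ i).card) * (5 * scaleExp m i) := Nat.mul_le_mul h2 h3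
      _ = _ := by ring
  have h0 : (net m γ 0).card * scaleExp m 0 ≤ γ.card * m :=
    Nat.mul_le_mul_right _ (Finset.card_le_card (net_subset m γ 0))
  have h2 : ∀ n, 8 * ∑ i ∈ Finset.range (n + 1), (net m γ i).card * scaleExp m i ≤
      8 * (γ.card * m) + 5 * ∑ i ∈ Finset.range n, (net m γ i).card * scaleExp m i +
      5 * ∑ i ∈ Finset.range n, (lonely m γ i).card * scaleExp m i := by
    intro n
    induction n with
    | zero => simpa using h0
    | succ n ih =>
      rw [Finset.sum_range_succ _ (n + 1)]
      conv_rhs => rw [Finset.sum_range_succ _ n, Finset.sum_range_succ _ n]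
      have := h1 n
      linarith
  have h3 := h2 n
  rw [Finset.sum_range_succ] at h3
  omega

/-! ### Dyadic block counts. -/

/-- The number of dyadic blocks that meet `γ`, summed over the block lengths `2 ^ k`, `k < K`. -/
def blockCount (γ : Finset ℤ) (K : ℕ) : ℕ :=
  ∑ k ∈ Finset.range K, (γ.image fun p => p / 2 ^ k).card

lemma card_image_div_le (γ : Finset ℤ) (k : ℕ) : (γ.image fun p => p / 2 ^ k).card ≤ γ.card :=
  Finset.card_image_le

/-- Every point lies within one block length of a net point, hence in its block or an adjacent one.
-/
lemma card_image_div_le_three_mul {m : ℕ} (γ : Finset ℤ) {i k : ℕ} (hk : scaleExp m i ≤ k) :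
    (γ.image fun p => p / 2 ^ k).card ≤ 3 * (net m γ i).card := by
  have hsub : (γ.image fun p => p / 2 ^ k) ⊆
      (net m γ i).biUnion fun x => {x / 2 ^ k - 1, x / 2 ^ k, x / 2 ^ k + 1} := by
    intro b hb
    obtain ⟨p, hp, rfl⟩ := Finset.mem_image.1 hb
    obtain ⟨x, hx, hpx⟩ := exists_mem_net i hp
    refine Finset.mem_biUnion.2 ⟨x, hx, ?_⟩
    have hlt : (p - x).natAbs < 2 ^ k :=
      hpx.trans_le (Nat.pow_le_pow_right two_pos hk)
    have hpos : (0 : ℤ) < 2 ^ k := by positivity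
    have hlt1 : p < x + 2 ^ k := by zify at hlt; have := (abs_lt.1 hlt).2; linarith
    have hlt2 : x - 2 ^ k < p := by zify at hlt; have := (abs_lt.1 hlt).1; linarith
    have h1 : p / 2 ^ k ≤ x / 2 ^ k + 1 := by
      calc p / 2 ^ k ≤ (x + 2 ^ k) / 2 ^ k := Int.ediv_le_ediv hpos hlt1.le
        _ = _ := by rw [Int.add_ediv_of_dvd_right dvd_rfl, Int.ediv_self hpos.ne']
    have h2 : x / 2 ^ k ≤ p / 2 ^ k + 1 := by
      calc x / 2 ^ k ≤ (p + 2 ^ k) / 2 ^ k := Int.ediv_le_ediv hpos (by linarith)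
        _ = _ := by rw [Int.add_ediv_of_dvd_right dvd_rfl, Int.ediv_self hpos.ne']
    simp only [Finset.mem_insert, Finset.mem_singleton]
    omega
  refine (Finset.card_le_card hsub).trans ?_
  refine (Finset.card_biUnion_le_card_mul _ _ 3 fun x _ => Finset.card_le_three).trans ?_
  rw [mul_comm]

lemma blockCount_le {m : ℕ} (γ : Finset ℤ) (n : ℕ) :
    blockCount γ (scaleExp m n + 3) ≤
      (m + 3) * γ.card + ∑ i ∈ Finset.range n, (net m γ i).card * scaleExp m i := by
  have h1 : ∀ n, ∑ k ∈ Finset.range (scaleExp m n), (γ.image fun p => p / 2 ^ k).card ≤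
      m * γ.card + ∑ i ∈ Finset.range n, (net m γ i).card * scaleExp m i := by
    intro n
    induction n with
    | zero =>
      refine (Finset.sum_le_card_nsmul _ _ γ.card fun k _ => card_image_div_le γ k).trans ?_
      simp [scaleExp]
    | succ n ih =>
      rw [Finset.sum_range_succ _ n, ← Finset.sum_range_add_sum_Ico _
        (scaleExp_mono m (Nat.le_succ n)), ← add_assoc]
      refine add_le_add ih ?_
      refine (Finset.sum_le_card_nsmul _ _ _ fun k hk =>
        card_image_div_le_three_mul γ (Finset.mem_Ico.1 hk).1).trans ?_
      -- The factor 3 is absorbed because only a quarter of `scaleExp m n` block lengths lie between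
      -- consecutive scales.
      rw [Nat.card_Ico, smul_eq_mul, scaleExp_succ, mul_comm, mul_comm 3, mul_assoc]
      refine Nat.mul_le_mul_left _ ?_
      omega
  have h2 := h1 n
  have h3 := card_image_div_le γ (scaleExp m n)
  have h4 := card_image_div_le γ (scaleExp m n + 1)
  have h5 := card_image_div_le γ (scaleExp m n + 2)
  unfold blockCount
  rw [Finset.sum_range_succ, Finset.sum_range_succ, Finset.sum_range_succ]
  linarith

/-- The block count of an unsplittable set of boundary points is bounded by its cut. -/
lemma blockCount_le_pairSum_cut {α : ℝ} (hα₂ : α ≤ 2) {m : ℕ} (hm : 64 ≤ m)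
    {γ : Finset ℤ} (hγ : Unsplittable m γ) :
    (blockCount γ (scaleExp m (scaleIndex m γ) + 3) : ℝ≥0∞) ≤
      ((9 * m + 643 : ℕ) : ℝ≥0∞) * pairSum α (cut (inside γ)) := by
  set n := scaleIndex m γ
  have h1 := blockCount_le (m := m) γ n
  have h2 := three_mul_sum_card_net_le hm γ n
  have h3 := sum_card_lonely_mul_le hα₂ hm hγ
  have h4 := card_le_pairSum_cut hα₂ γ
  have h5 : blockCount γ (scaleExp m n + 3) ≤ (9 * m + 3) * γ.card +
      5 * ∑ i ∈ Finset.range n, (lonely m γ i).card * scaleExp m i := by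
    have := Nat.zero_le (∑ i ∈ Finset.range n, (net m γ i).card * scaleExp m i)
    linarith
  calc (blockCount γ (scaleExp m n + 3) : ℝ≥0∞)
      ≤ (((9 * m + 3) * γ.card +
        5 * ∑ i ∈ Finset.range n, (lonely m γ i).card * scaleExp m i : ℕ) : ℝ≥0∞) := by
        exact_mod_cast h5
    _ = ((9 * m + 3 : ℕ) : ℝ≥0∞) * γ.card + 5 *
        ((∑ i ∈ Finset.range n, (lonely m γ i).card * scaleExp m i : ℕ) : ℝ≥0∞) := by
        rw [Nat.cast_add, Nat.cast_mul, Nat.cast_mul]; rfl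
    _ ≤ ((9 * m + 3 : ℕ) : ℝ≥0∞) * pairSum α (cut (inside γ)) +
        5 * (128 * pairSum α (cut (inside γ))) := by gcongr
    _ = _ := by push_cast; ring

/-! ### Interaction between contours. -/

lemma pairCoupling_swap (α : ℝ) (p : ℤ × ℤ) : pairCoupling α p.swap = pairCoupling α p := by
  unfold pairCoupling
  rw [Prod.fst_swap, Prod.snd_swap, coupling_natAbs_comm]

lemma pairSum_preimage_swap (α : ℝ) (S : Set (ℤ × ℤ)) :
    pairSum α (Prod.swap ⁻¹' S) = pairSum α S := by
  unfold pairSum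
  rw [← (Equiv.prodComm ℤ ℤ).tsum_eq]
  refine tsum_congr fun p => ?_
  by_cases hp : p ∈ S
  · simp [hp, pairCoupling_swap]
  · simp [hp]

lemma pairSum_biUnion_le {ι : Type*} (α : ℝ) (s : Finset ι) {S : ι → Set (ℤ × ℤ)}
    {T : Set (ℤ × ℤ)} (hT : ∀ p ∈ T, ∃ i ∈ s, p ∈ S i) :
    pairSum α T ≤ ∑ i ∈ s, pairSum α (S i) := by
  unfold pairSum
  rw [← Summable.tsum_finsetSum fun i _ => ENNReal.summable]
  refine ENNReal.tsum_le_tsum fun p => ?_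
  by_cases hp : p ∈ T
  · obtain ⟨i, hi, hpi⟩ := hT p hp
    rw [Set.indicator_of_mem hp, ← Set.indicator_of_mem hpi (pairCoupling α)]
    exact Finset.single_le_sum (f := fun i => (S i).indicator (pairCoupling α) p)
      (fun _ _ => zero_le) hi
  · rw [Set.indicator_of_notMem hp]
    exact zero_le

lemma pairSum_le_mul_of_injective (α : ℝ) {S T : Set (ℤ × ℤ)} {f : ℤ × ℤ → ℤ × ℤ}
    (hf : Function.Injective f) {c : ℝ≥0∞}
    (h : ∀ p ∈ S, f p ∈ T ∧ pairCoupling α p ≤ c * pairCoupling α (f p)) :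
    pairSum α S ≤ c * pairSum α T := by
  unfold pairSum
  calc ∑' p, S.indicator (pairCoupling α) p
      ≤ ∑' p, c * T.indicator (pairCoupling α) (f p) := by
        refine ENNReal.tsum_le_tsum fun p => ?_
        by_cases hp : p ∈ S
        · rw [Set.indicator_of_mem hp, Set.indicator_of_mem (h p hp).1]
          exact (h p hp).2
        · rw [Set.indicator_of_notMem hp]
          exact zero_le
    _ = c * ∑' p, T.indicator (pairCoupling α) (f p) := ENNReal.tsum_mul_left
    _ ≤ _ := mul_le_mul' le_rfl
        (ENNReal.tsum_comp_le_tsum_of_injective hf (T.indicator (pairCoupling α)))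

lemma pairCoupling_le_four_mul {α : ℝ} (hα : 0 ≤ α) (hα₂ : α ≤ 2) {p q : ℤ × ℤ}
    (hq : q.1 ≠ q.2) (h : (q.1 - q.2).natAbs ≤ 2 * (p.1 - p.2).natAbs) :
    pairCoupling α p ≤ 4 * pairCoupling α q := by
  have hq0 : (q.1 - q.2).natAbs ≠ 0 := by omega
  have hp0 : (p.1 - p.2).natAbs ≠ 0 := by omega
  unfold pairCoupling
  rw [show (4 : ℝ≥0∞) = ENNReal.ofReal 4 by simp, ← ENNReal.ofReal_mul (by norm_num)]
  refine ENNReal.ofReal_le_ofReal ?_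
  rw [coupling, coupling, if_neg hq0, if_neg hp0]
  set a := (p.1 - p.2).natAbs
  set b := (q.1 - q.2).natAbs
  have ha : (0 : ℝ) < a := by exact_mod_cast Nat.pos_of_ne_zero hp0
  have hb : (0 : ℝ) < b := by exact_mod_cast Nat.pos_of_ne_zero hq0
  have hab : (b : ℝ) ≤ 2 * a := by exact_mod_cast h
  have h1 : (b : ℝ) ^ α ≤ 4 * (a : ℝ) ^ α := by
    calc (b : ℝ) ^ α ≤ (2 * a) ^ α := Real.rpow_le_rpow hb.le hab hα
      _ = 2 ^ α * (a : ℝ) ^ α := Real.mul_rpow (by norm_num) ha.le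
      _ ≤ 2 ^ (2 : ℝ) * (a : ℝ) ^ α := by gcongr; norm_num
      _ = _ := by norm_num
  rw [Real.rpow_neg ha.le, Real.rpow_neg hb.le, ← div_eq_mul_inv,
    inv_le_comm₀ (by positivity) (by positivity), inv_div, div_le_iff₀ (by norm_num)]
  linarith

lemma exists_mem_le_lt_of_mem_inside {γ : Finset ℤ} (hγ : Even γ.card) {x : ℤ}
    (hx : x ∈ inside γ) : ∃ p ∈ γ, ∃ q ∈ γ, p ≤ x ∧ x < q ∧ q - p ≤ diam γ := by
  obtain ⟨p, hp, hpx⟩ := exists_le_of_mem_inside hx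
  obtain ⟨q, hq, hqx⟩ := exists_lt_of_mem_inside hγ hx
  have := natAbs_sub_le_diam hp hq
  exact ⟨p, hp, q, hq, hpx, hqx, by omega⟩

lemma exists_mem_between {γ : Finset ℤ} {x y : ℤ} (h : ¬(x ∈ inside γ ↔ y ∈ inside γ)) :
    ∃ p ∈ γ, (x < p ∧ p ≤ y) ∨ (y < p ∧ p ≤ x) := by
  rcases le_total x y with hxy | hxy
  · obtain ⟨p, hp, h1⟩ := exists_mem_of_inside_ne hxy h
    exact ⟨p, hp, Or.inl h1⟩
  · obtain ⟨p, hp, h1⟩ := exists_mem_of_inside_ne hxy fun h' => h h'.symm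
    exact ⟨p, hp, Or.inr h1⟩

/-- A contour that is at least as large as `γ` only separates distant pairs cut by `γ`. -/
lemma scale_le_of_separated_of_le {m : ℕ} (hm : 64 ≤ m) {γ γ' : Finset ℤ} (hγ : Even γ.card)
    (hs : Separated m γ γ') (hidx : scaleIndex m γ ≤ scaleIndex m γ') {p : ℤ × ℤ}
    (hp : p ∈ cut (inside γ)) (hp' : ¬(p.1 ∈ inside γ' ↔ p.2 ∈ inside γ')) :
    scale m (scaleIndex m γ + 1) ≤ 8 * (p.1 - p.2).natAbs := by
  have hd := (scaleIndex_le_iff (by omega : 16 ≤ m)).1 (le_refl (scaleIndex m γ))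
  have hsc := mul_scale_le (k := 5) (by omega : 4 * 5 ≤ m) (scaleIndex m γ)
  obtain ⟨q, hq, hq2⟩ := exists_mem_between hp'
  obtain ⟨b, hb, hb2⟩ : ∃ b, b ∈ inside γ ∧ (b = p.1 ∨ b = p.2) := by
    rw [mem_cut] at hp
    by_cases h : p.1 ∈ inside γ
    · exact ⟨_, h, Or.inl rfl⟩
    · exact ⟨p.2, by tauto, Or.inr rfl⟩
  obtain ⟨r, hr, r', hr', h1, h2, h3⟩ := exists_mem_le_lt_of_mem_inside hγ hb
  have := hs r hr q hq
  rw [min_eq_left hidx] at this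
  omega

/-- The pairs cut by `γ` with first site in `U`. -/
def rows (γ : Finset ℤ) (U : Set ℤ) : Set (ℤ × ℤ) := {p | p ∈ cut (inside γ) ∧ p.1 ∈ U}

/-- No point of `γ` is within `w` of `u`. So moving the first site by less than `w` keeps it on the
same side of `γ` and at most doubles the length of a cut pair. Averaging over the shifts then shows
that the inside of a small contour carries little of the cut. -/
lemma pairSum_rows_singleton_le {α : ℝ} (hα : 0 ≤ α) (hα₂ : α ≤ 2) {m : ℕ} (hm : 64 ≤ m)
    {γ γ' : Finset ℤ} (hγ' : Even γ'.card) (hs : Separated m γ γ')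
    (hidx : scaleIndex m γ' < scaleIndex m γ) {w : ℕ}
    (hw : 16 * w = scale m (scaleIndex m γ' + 1)) {u z : ℤ} (hu : u ∈ inside γ') (huz : u ≤ z)
    (hz : z < u + w) :
    pairSum α (rows γ {u}) ≤ 4 * pairSum α (rows γ {z}) := by
  have hd := (scaleIndex_le_iff (by omega : 16 ≤ m)).1 (le_refl (scaleIndex m γ'))
  have hsc := mul_scale_le (k := 5) (by omega : 4 * 5 ≤ m) (scaleIndex m γ')
  have hpos := scale_pos m (scaleIndex m γ')
  obtain ⟨r, hr, r', hr', h1, h2, h3⟩ := exists_mem_le_lt_of_mem_inside hγ' hu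
  have hfar : ∀ q ∈ γ, ¬(u - w ≤ q ∧ q ≤ u + w) := by
    rintro q hq ⟨h4, h5⟩
    have := hs q hq r hr
    rw [min_eq_right hidx.le] at this
    omega
  have hzu : u ∈ inside γ ↔ z ∈ inside γ :=
    inside_iff_of_forall huz fun q hq h4 h5 => hfar q hq ⟨by omega, by omega⟩
  refine pairSum_le_mul_of_injective α (f := fun p => (p.1 + (z - u), p.2)) (fun a b hab => ?_) ?_
  · simp only [Prod.mk.injEq] at hab
    exact Prod.ext (by omega) hab.2
  · rintro ⟨a, v⟩ ⟨hcut, ha⟩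
    obtain rfl : a = u := ha
    rw [mem_cut] at hcut
    simp only at hcut
    obtain ⟨q, hq, hqv⟩ := exists_mem_between hcut
    have h4 := hfar q hq
    refine ⟨⟨?_, ?_⟩, pairCoupling_le_four_mul hα hα₂ ?_ ?_⟩
    · rw [mem_cut]
      simpa [← hzu] using hcut
    · simp
    · simp only; omega
    · simp only; omega

/-- The pairs cut by `γ` with first site inside a smaller contour are dominated by the pairs whose
first site lies in a neighbourhood of that contour. -/
lemma pairSum_rows_inside_le {α : ℝ} (hα : 0 ≤ α) (hα₂ : α ≤ 2) {m : ℕ} (hm : 64 ≤ m)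
    {γ γ' : Finset ℤ} (hγ' : Even γ'.card) (hs : Separated m γ γ')
    (hidx : scaleIndex m γ' < scaleIndex m γ) {w : ℕ}
    (hw : 16 * w = scale m (scaleIndex m γ' + 1)) :
    w * pairSum α (rows γ (inside γ')) ≤ (16 * scale m (scaleIndex m γ') : ℕ) *
      pairSum α (rows γ {z | ∃ q ∈ γ', q ≤ z ∧ z < q + 4 * scale m (scaleIndex m γ') + w}) := by
  have hd := (scaleIndex_le_iff (by omega : 16 ≤ m)).1 (le_refl (scaleIndex m γ'))
  set ρ := scale m (scaleIndex m γ')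
  set U : Set ℤ := {z | ∃ q ∈ γ', q ≤ z ∧ z < q + 4 * ρ + w} with hU
  set B := (finite_inside hγ').toFinset with hB
  have hBmem : ∀ u, u ∈ B ↔ u ∈ inside γ' := fun u => by simp [hB]
  have hBcard : B.card ≤ 4 * ρ := by
    by_cases hne : γ'.Nonempty
    · have h1 : B ⊆ Finset.Ico (γ'.min' hne) (γ'.max' hne) := by
        intro u hu
        obtain ⟨p, hp, q, hq, h1, h2, -⟩ :=
          exists_mem_le_lt_of_mem_inside hγ' ((hBmem u).1 hu)
        rw [Finset.mem_Ico]
        exact ⟨(γ'.min'_le p hp).trans h1, h2.trans_le (γ'.le_max' q hq)⟩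
      have h2 := Finset.card_le_card h1
      have h3 := natAbs_sub_le_diam (γ'.max'_mem hne) (γ'.min'_mem hne)
      rw [Int.card_Ico] at h2
      omega
    · have : B = ∅ := by
        ext u
        rw [hBmem, mem_inside, Finset.not_nonempty_iff_eq_empty.1 hne]
        simp
      simp [this]
  have hrow : ∀ u ∈ B, w * pairSum α (rows γ {u}) ≤ 4 * pairSum α (rows γ U) := by
    intro u hu
    rw [hBmem] at hu
    obtain ⟨p, hp, q, hq, h1, h2, h3⟩ := exists_mem_le_lt_of_mem_inside hγ' hu
    calc w * pairSum α (rows γ {u}) = ∑ z ∈ Finset.Ico u (u + w), pairSum α (rows γ {u}) := by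
          rw [Finset.sum_const, Int.card_Ico, nsmul_eq_mul]
          simp
      _ ≤ ∑ z ∈ Finset.Ico u (u + w), 4 * pairSum α (rows γ {z}) :=
          Finset.sum_le_sum fun z hz => by
            rw [Finset.mem_Ico] at hz
            exact pairSum_rows_singleton_le hα hα₂ hm hγ' hs hidx hw hu hz.1 hz.2
      _ = 4 * ∑ z ∈ Finset.Ico u (u + w), pairSum α (rows γ {z}) := by rw [Finset.mul_sum]
      _ ≤ _ := by
          gcongr
          refine sum_pairSum_le α _ (fun i _ j _ hij => ?_) fun z hz => ?_
          · rw [Set.disjoint_left]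
            rintro p ⟨-, h1⟩ ⟨-, h2⟩
            exact hij (h1.symm.trans h2)
          · rintro ⟨a, b⟩ ⟨h4, h5⟩
            obtain rfl : a = z := h5
            rw [Finset.mem_Ico] at hz
            exact ⟨h4, p, hp, by simp only; omega, by simp only; omega⟩
  calc w * pairSum α (rows γ (inside γ')) ≤ w * ∑ u ∈ B, pairSum α (rows γ {u}) := by
        gcongr
        exact pairSum_biUnion_le α B fun p hp => ⟨p.1, (hBmem _).2 hp.2, hp.1, rfl⟩
    _ = ∑ u ∈ B, w * pairSum α (rows γ {u}) := by rw [Finset.mul_sum]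
    _ ≤ ∑ u ∈ B, 4 * pairSum α (rows γ U) := Finset.sum_le_sum hrow
    _ = (B.card * 4 : ℕ) * pairSum α (rows γ U) := by
        rw [Finset.sum_const, nsmul_eq_mul, ← mul_assoc]; push_cast; rfl
    _ ≤ _ := mul_le_mul' (Nat.cast_le.2 (by omega)) le_rfl

/-- The total contribution of the smaller contours of a given scale. -/
lemma sum_pairSum_rows_inside_le {α : ℝ} (hα : 0 ≤ α) (hα₂ : α ≤ 2) {m : ℕ} (hm : 64 ≤ m)
    {S : Finset ℤ} {P : Finset (Finset ℤ)} (hP : IsContourFamily m S P) {γ : Finset ℤ}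
    (hγ : γ ∈ P) {j : ℕ} (hj : j < scaleIndex m γ) :
    ∑ γ' ∈ P.filter (scaleIndex m · = j), pairSum α (rows γ (inside γ')) ≤
      256 * 2⁻¹ ^ (scaleExp m j / 4) * pairSum α (cut (inside γ)) := by
  have hsc := mul_scale_le (k := 5) (by omega : 4 * 5 ≤ m) j
  have hpos := scale_pos m j
  obtain ⟨w, hw⟩ : ∃ w, 16 * w = scale m (j + 1) := by
    have hl := le_scaleExp m (j + 1)
    refine ⟨2 ^ (scaleExp m (j + 1) - 4), ?_⟩
    rw [scale, show (16 : ℕ) = 2 ^ 4 by norm_num, ← pow_add]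
    congr 1
    omega
  have hw0 : (w : ℝ≥0∞) ≠ 0 := by
    rw [Nat.cast_ne_zero]; omega
  have hmem : ∀ γ' ∈ P.filter (scaleIndex m · = j), γ' ∈ P ∧ scaleIndex m γ' = j ∧ γ ≠ γ' := by
    intro γ' hγ'
    obtain ⟨h1, h2⟩ := Finset.mem_filter.1 hγ'
    exact ⟨h1, h2, by rintro rfl; omega⟩
  set U : Finset ℤ → Set ℤ := fun γ' => {z | ∃ q ∈ γ', q ≤ z ∧ z < q + 4 * scale m j + w} with hU
  have hmain : w * ∑ γ' ∈ P.filter (scaleIndex m · = j), pairSum α (rows γ (inside γ')) ≤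
      (16 * scale m j : ℕ) * pairSum α (cut (inside γ)) := by
    calc w * ∑ γ' ∈ P.filter (scaleIndex m · = j), pairSum α (rows γ (inside γ'))
        = ∑ γ' ∈ P.filter (scaleIndex m · = j), w * pairSum α (rows γ (inside γ')) := by
          rw [Finset.mul_sum]
      _ ≤ ∑ γ' ∈ P.filter (scaleIndex m · = j),
            (16 * scale m j : ℕ) * pairSum α (rows γ (U γ')) := by
          refine Finset.sum_le_sum fun γ' hγ' => ?_
          obtain ⟨h1, h2, h3⟩ := hmem γ' hγ'
          have := pairSum_rows_inside_le hα hα₂ hm (hP.even γ' h1) (hP.separated γ hγ γ' h1 h3)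
            (h2 ▸ hj) (h2 ▸ hw)
          rwa [h2] at this
      _ = (16 * scale m j : ℕ) * ∑ γ' ∈ P.filter (scaleIndex m · = j),
            pairSum α (rows γ (U γ')) := by rw [Finset.mul_sum]
      _ ≤ _ := by
          gcongr
          refine sum_pairSum_le α _ (fun γ₁ h1 γ₂ h2 hne => ?_) fun γ' _ p hp => hp.1
          rw [Set.disjoint_left]
          rintro p ⟨-, q₁, hq₁, h3, h4⟩ ⟨-, q₂, hq₂, h5, h6⟩
          obtain ⟨h7, h8, -⟩ := hmem γ₁ h1
          obtain ⟨h9, h10, -⟩ := hmem γ₂ h2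
          have := hP.separated γ₁ h7 γ₂ h9 hne q₁ hq₁ q₂ hq₂
          rw [h8, h10, min_self] at this
          omega
  -- The gain is the ratio of consecutive scales; 256 is 16 times the 16 in the definition of `w`.
  have hscale : ((16 * scale m j : ℕ) : ℝ≥0∞) = w * (256 * 2⁻¹ ^ (scaleExp m j / 4)) := by
    have h1 : 256 * scale m j * 2 ^ (scaleExp m j / 4) = 256 * (16 * w) := by
      rw [hw, scale_succ]; ring
    have h2 : 16 * scale m j * 2 ^ (scaleExp m j / 4) = w * 256 := by linarith
    have h3 : ((16 * scale m j : ℕ) : ℝ≥0∞) * 2 ^ (scaleExp m j / 4) = w * 256 := by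
      exact_mod_cast h2
    calc ((16 * scale m j : ℕ) : ℝ≥0∞)
        = ((16 * scale m j : ℕ) : ℝ≥0∞) * (2 ^ (scaleExp m j / 4) * 2⁻¹ ^ (scaleExp m j / 4)) := by
          rw [← mul_pow, ENNReal.mul_inv_cancel two_ne_zero ENNReal.ofNat_ne_top, one_pow, mul_one]
      _ = _ := by rw [← mul_assoc, h3, mul_assoc]
  rw [hscale, mul_assoc] at hmain
  exact (ENNReal.mul_le_mul_iff_right hw0 (ENNReal.natCast_ne_top _)).1 hmain

/-- The total coupling of a site to the sites at distance at least `n` on one side. -/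
noncomputable def tail (α : ℝ) (n : ℕ) : ℝ≥0∞ :=
  ∑' r : ℕ, if n ≤ r then ENNReal.ofReal (coupling α r) else 0

/-- Group the distances into blocks r = qN + i: each block has `N` terms, each at most N^(-α) times
the coupling at distance `q`. -/
lemma tail_mul_le {α : ℝ} (hα : 0 ≤ α) {N : ℕ} (hN : 0 < N) {D : ℕ} (hD : 0 < D) :
    tail α (N * D) ≤ ENNReal.ofReal ((N : ℝ) ^ (1 - α)) * tail α D := by
  have : NeZero N := ⟨hN.ne'⟩
  have hNR : (0 : ℝ) < N := by exact_mod_cast hN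
  unfold tail
  rw [← (Nat.divModEquiv N).symm.tsum_eq, ENNReal.tsum_prod', ← ENNReal.tsum_mul_left]
  refine ENNReal.tsum_le_tsum fun q => ?_
  rw [tsum_fintype]
  by_cases hq : D ≤ q
  · rw [if_pos hq]
    have hterm : ∀ i : Fin N, (if N * D ≤ (Nat.divModEquiv N).symm (q, i) then
        ENNReal.ofReal (coupling α ((Nat.divModEquiv N).symm (q, i))) else 0) ≤
        ENNReal.ofReal (((N : ℝ) * q) ^ (-α)) := by
      intro i
      split_ifs
      · refine ENNReal.ofReal_le_ofReal ?_
        have hqR : (0 : ℝ) < q := by exact_mod_cast hD.trans_le hq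
        rw [coupling, Nat.divModEquiv_symm_apply]
        have hq0 : 0 < q := hD.trans_le hq
        have hne : q * N + (i : ℕ) ≠ 0 := by positivity
        simp only [if_neg hne]
        refine Real.rpow_le_rpow_of_nonpos (by positivity) ?_ (by linarith)
        push_cast
        have : (0 : ℝ) ≤ ((i : ℕ) : ℝ) := by positivity
        nlinarith
      · exact zero_le
    refine (Finset.sum_le_sum fun i _ => hterm i).trans ?_
    rw [Finset.sum_const, Finset.card_univ, Fintype.card_fin, nsmul_eq_mul,
      ← ENNReal.ofReal_natCast, ← ENNReal.ofReal_mul (by positivity),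
      ← ENNReal.ofReal_mul (by positivity), coupling, if_neg (by omega)]
    refine ENNReal.ofReal_le_ofReal (le_of_eq ?_)
    rw [Real.mul_rpow hNR.le (by positivity), sub_eq_add_neg, Real.rpow_add hNR, Real.rpow_one,
      mul_assoc]
  · refine (Finset.sum_eq_zero fun i _ => if_neg ?_).trans_le zero_le
    simp only [Nat.divModEquiv_symm_apply]
    have := i.2
    have : N * (q + 1) ≤ N * D := Nat.mul_le_mul_left _ (by omega)
    have : N * (q + 1) = N * q + N := by ring
    have := mul_comm N q
    omega

lemma pairSum_row_far_le (α : ℝ) (x : ℤ) (n : ℕ) :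
    pairSum α {p | p.1 = x ∧ n ≤ (p.1 - p.2).natAbs} ≤ 2 * tail α n := by
  set g : ℤ → ℝ≥0∞ := fun k => if n ≤ k.natAbs then ENNReal.ofReal (coupling α k.natAbs) else 0
  have h1 : pairSum α {p | p.1 = x ∧ n ≤ (p.1 - p.2).natAbs} = ∑' y : ℤ, g (x - y) := by
    unfold pairSum
    rw [ENNReal.tsum_prod', tsum_eq_single x]
    · refine tsum_congr fun y => ?_
      simp only [g, Set.indicator_apply, Set.mem_ofPred_eq, true_and, pairCoupling]
    · intro a ha
      simp [ha]
  have h2 : ∑' y : ℤ, g (x - y) = ∑' k : ℤ, g k := (Equiv.subLeft x).tsum_eq g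
  have h3 : ∑' k : ℤ, g k ≤ ∑' r : ℕ, g r + ∑' r : ℕ, g (-r) := by
    have e : ∀ k : ℤ, g k ≤ (∑' r : ℕ, if (r : ℤ) = k then g r else 0) +
        ∑' r : ℕ, if -(r : ℤ) = k then g (-r) else 0 := by
      intro k
      rcases le_total 0 k with hk | hk
      · refine le_add_right ?_
        refine le_trans ?_ (ENNReal.le_tsum k.natAbs)
        rw [if_pos (by omega), Int.natAbs_of_nonneg hk]
      · refine le_add_left ?_
        refine le_trans ?_ (ENNReal.le_tsum k.natAbs)
        rw [if_pos (by omega), Int.ofNat_natAbs_of_nonpos hk, neg_neg]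
    refine (ENNReal.tsum_le_tsum e).trans ?_
    rw [ENNReal.tsum_add, ENNReal.tsum_comm, ENNReal.tsum_comm (f := fun (k : ℤ) (r : ℕ) =>
      if -(r : ℤ) = k then g (-r) else 0)]
    have e1 : ∀ r : ℕ, ∑' k : ℤ, (if (r : ℤ) = k then g r else 0) = g r := fun r => by
      rw [tsum_eq_single (r : ℤ) fun k hk => if_neg hk.symm, if_pos rfl]
    have e2 : ∀ r : ℕ, ∑' k : ℤ, (if -(r : ℤ) = k then g (-r) else 0) = g (-r) := fun r => by
      rw [tsum_eq_single (-r : ℤ) fun k hk => if_neg hk.symm, if_pos rfl]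
    simp only [e1, e2]
    exact le_rfl
  rw [h1, h2, two_mul]
  refine h3.trans (le_of_eq ?_)
  simp [g, tail]

lemma tail_le_pairSum_row {α : ℝ} {γ : Finset ℤ} (hγ : Even γ.card) {x : ℤ} (hx : x ∈ inside γ)
    {n : ℕ} (hn : diam γ ≤ n) : tail α n ≤ pairSum α (rows γ {x}) := by
  unfold tail pairSum
  have hinj : Function.Injective fun r : ℕ => (x, x + (r : ℤ)) := fun a b hab => by
    simpa using hab
  refine le_trans (ENNReal.tsum_le_tsum fun r => ?_) (ENNReal.tsum_comp_le_tsum_of_injective hinj _)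
  split_ifs with hr
  · rw [Set.indicator_of_mem]
    · simp [pairCoupling]
    · refine ⟨?_, rfl⟩
      rw [mem_cut]
      simp only [hx, true_iff]
      intro h
      obtain ⟨p, hp, -, -, h1, -, -⟩ := exists_mem_le_lt_of_mem_inside hγ hx
      obtain ⟨-, -, q, hq, -, h2, -⟩ := exists_mem_le_lt_of_mem_inside hγ h
      have := natAbs_sub_le_diam hp hq
      omega
  · exact zero_le

/-- The distant pairs contribute little to the cut. -/
lemma pairSum_far_le {α : ℝ} (hα : 0 ≤ α) {γ : Finset ℤ} (hγ : Even γ.card) {N D : ℕ} (hN : 0 < N)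
    (hD : 0 < D) (hd : diam γ ≤ D) :
    pairSum α {p | p ∈ cut (inside γ) ∧ N * D ≤ (p.1 - p.2).natAbs} ≤
      4 * ENNReal.ofReal ((N : ℝ) ^ (1 - α)) * pairSum α (cut (inside γ)) := by
  set B := (finite_inside hγ).toFinset with hB
  have hBmem : ∀ u, u ∈ B ↔ u ∈ inside γ := fun u => by simp [hB]
  set F : ℤ → Set (ℤ × ℤ) := fun x => {p | p.1 = x ∧ N * D ≤ (p.1 - p.2).natAbs} with hF
  set T : Set (ℤ × ℤ) := {p | p.1 ∈ inside γ ∧ N * D ≤ (p.1 - p.2).natAbs} with hT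
  have h1 : pairSum α {p | p ∈ cut (inside γ) ∧ N * D ≤ (p.1 - p.2).natAbs} ≤
      2 * pairSum α T := by
    refine (pairSum_mono α (T := Prod.swap ⁻¹' T ∪ T) ?_).trans
      ((pairSum_union_le α _ _).trans (by rw [pairSum_preimage_swap, two_mul]))
    rintro p ⟨h1, h2⟩
    rw [mem_cut] at h1
    by_cases h : p.1 ∈ inside γ
    · exact Or.inr ⟨h, h2⟩
    · refine Or.inl ⟨by rw [Prod.fst_swap]; tauto, ?_⟩
      rw [Prod.fst_swap, Prod.snd_swap, ← Int.natAbs_neg, neg_sub]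
      exact h2
  have h2 : pairSum α T ≤ ∑ x ∈ B, 2 * (ENNReal.ofReal ((N : ℝ) ^ (1 - α)) *
      pairSum α (rows γ {x})) := by
    refine (pairSum_biUnion_le α B (S := F) fun p hp => ⟨p.1, (hBmem _).2 hp.1, rfl, hp.2⟩).trans ?_
    refine Finset.sum_le_sum fun x hx => (pairSum_row_far_le α x (N * D)).trans ?_
    gcongr
    refine (tail_mul_le hα hN hD).trans ?_
    gcongr
    exact tail_le_pairSum_row hγ ((hBmem x).1 hx) hd
  have h3 : ∑ x ∈ B, pairSum α (rows γ {x}) ≤ pairSum α (cut (inside γ)) := by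
    refine sum_pairSum_le α _ (fun i _ j _ hij => ?_) fun z _ p hp => hp.1
    rw [Set.disjoint_left]
    rintro p ⟨-, h1⟩ ⟨-, h2⟩
    exact hij (h1.symm.trans h2)
  calc _ ≤ 2 * ∑ x ∈ B, 2 * (ENNReal.ofReal ((N : ℝ) ^ (1 - α)) * pairSum α (rows γ {x})) :=
        h1.trans (by gcongr)
    _ = 4 * ENNReal.ofReal ((N : ℝ) ^ (1 - α)) * ∑ x ∈ B, pairSum α (rows γ {x}) := by
        simp only [← mul_assoc]
        rw [← Finset.mul_sum]
        ring
    _ ≤ _ := by gcongr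

/-- Most pairs cut by a contour lie on different sides of the whole boundary. -/
lemma pairSum_same_le {α : ℝ} (hα : 0 ≤ α) (hα₂ : α ≤ 2) {m : ℕ} (hm : 64 ≤ m)
    {S : Finset ℤ} {P : Finset (Finset ℤ)} (hP : IsContourFamily m S P) {γ : Finset ℤ}
    (hγ : γ ∈ P) :
    pairSum α {p | p ∈ cut (inside γ) ∧ (p.1 ∈ inside S ↔ p.2 ∈ inside S)} ≤
      (4 * ENNReal.ofReal (((2 ^ (m / 4 - 5) : ℕ) : ℝ) ^ (1 - α)) + 1024 * 2⁻¹ ^ (m / 4)) *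
        pairSum α (cut (inside γ)) := by
  set K := scaleIndex m γ with hK
  set Q := pairSum α (cut (inside γ)) with hQ
  have hd := (scaleIndex_le_iff (by omega : 16 ≤ m)).1 (le_refl (scaleIndex m γ))
  have hpos := scale_pos m K
  set N := 2 ^ (m / 4 - 5) with hN
  -- The 5 subtracted in the exponent of `N` absorbs the factor 8 · 4.
  have hND : 8 * (N * (4 * scale m K)) ≤ scale m (K + 1) := by
    have h1 := mul_scale_le (k := m / 4) (by omega : 4 * (m / 4) ≤ m) K
    calc 8 * (N * (4 * scale m K)) = 2 ^ (m / 4 - 5 + 5) * scale m K := by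
          rw [pow_add, hN]; ring
      _ = 2 ^ (m / 4) * scale m K := by congr 2; omega
      _ ≤ _ := h1
  set far : Set (ℤ × ℤ) := {p | p ∈ cut (inside γ) ∧ N * (4 * scale m K) ≤ (p.1 - p.2).natAbs}
  set near : Set (ℤ × ℤ) :=
    {p | p ∈ cut (inside γ) ∧ ∃ γ' ∈ P, scaleIndex m γ' < K ∧ p.1 ∈ inside γ'} with hnear
  -- By parity a second contour also cuts the pair. If its scale is not smaller, separation makes
  -- the pair long; if it is smaller, one end lies inside it.
  have hsub : {p | p ∈ cut (inside γ) ∧ (p.1 ∈ inside S ↔ p.2 ∈ inside S)} ⊆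
      far ∪ (near ∪ Prod.swap ⁻¹' near) := by
    rintro p ⟨hp, hpS⟩
    obtain ⟨γ', hγ', hne, hsep⟩ := hP.exists_ne_inside hγ hpS hp
    by_cases hidx : K ≤ scaleIndex m γ'
    · refine Or.inl ⟨hp, ?_⟩
      have := scale_le_of_separated_of_le hm (hP.even γ hγ) (hP.separated γ hγ γ' hγ' hne.symm)
        hidx hp hsep
      rw [← hK] at this
      omega
    · push Not at hidx
      refine Or.inr ?_
      by_cases h : p.1 ∈ inside γ'
      · exact Or.inl ⟨hp, γ', hγ', hidx, h⟩
      · refine Or.inr ⟨?_, γ', hγ', hidx, by rw [Prod.fst_swap]; tauto⟩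
        rw [mem_cut] at hp ⊢
        rw [Prod.fst_swap, Prod.snd_swap]
        tauto
  have hfar : pairSum α far ≤ 4 * ENNReal.ofReal ((N : ℝ) ^ (1 - α)) * Q :=
    pairSum_far_le hα (hP.even γ hγ) (by positivity) (by positivity) hd
  have hnr : pairSum α near ≤ 512 * 2⁻¹ ^ (m / 4) * Q := by
    have h1 : pairSum α near ≤ ∑ γ' ∈ P.filter (scaleIndex m · < K),
        pairSum α (rows γ (inside γ')) :=
      pairSum_biUnion_le α _ fun p ⟨hp, γ', h1, h2, h3⟩ =>
        ⟨γ', Finset.mem_filter.2 ⟨h1, h2⟩, hp, h3⟩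
    have h2 : ∑ γ' ∈ P.filter (scaleIndex m · < K), pairSum α (rows γ (inside γ')) =
        ∑ j ∈ Finset.range K, ∑ γ' ∈ P.filter (scaleIndex m · = j),
          pairSum α (rows γ (inside γ')) := by
      rw [← Finset.sum_fiberwise_of_maps_to (t := Finset.range K) (g := scaleIndex m)]
      · refine Finset.sum_congr rfl fun j hj => ?_
        rw [Finset.filter_filter]
        refine Finset.sum_congr (Finset.filter_congr fun γ' _ => ?_) fun _ _ => rfl
        have := Finset.mem_range.1 hj
        omega
      · intro γ' hγ'
        exact Finset.mem_range.2 (Finset.mem_filter.1 hγ').2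
    have h3 : ∀ j ∈ Finset.range K, ∑ γ' ∈ P.filter (scaleIndex m · = j),
        pairSum α (rows γ (inside γ')) ≤ 256 * 2⁻¹ ^ (m / 4) * Q * 2⁻¹ ^ j := by
      intro j hj
      refine (sum_pairSum_rows_inside_le hα hα₂ hm hP hγ (Finset.mem_range.1 hj)).trans ?_
      have hl := add_le_scaleExp (by omega : 16 ≤ m) j
      have h4 : (2⁻¹ : ℝ≥0∞) ^ (scaleExp m j / 4) ≤ 2⁻¹ ^ (m / 4) * 2⁻¹ ^ j := by
        rw [← pow_add]
        exact pow_le_pow_right_of_le_one' (by simp) (by omega)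
      calc 256 * 2⁻¹ ^ (scaleExp m j / 4) * Q ≤ 256 * (2⁻¹ ^ (m / 4) * 2⁻¹ ^ j) * Q := by gcongr
        _ = _ := by ring
    have h5 : ∑ j ∈ Finset.range K, (2⁻¹ : ℝ≥0∞) ^ j ≤ 2 := by
      refine (ENNReal.sum_le_tsum _).trans (le_of_eq ?_)
      rw [ENNReal.tsum_geometric, ENNReal.one_sub_inv_two, inv_inv]
    calc pairSum α near ≤ ∑ j ∈ Finset.range K, 256 * 2⁻¹ ^ (m / 4) * Q * 2⁻¹ ^ j :=
          h1.trans (h2.trans_le (Finset.sum_le_sum h3))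
      _ = 256 * 2⁻¹ ^ (m / 4) * Q * ∑ j ∈ Finset.range K, 2⁻¹ ^ j := by rw [Finset.mul_sum]
      _ ≤ 256 * 2⁻¹ ^ (m / 4) * Q * 2 := by gcongr
      _ = _ := by ring
  calc _ ≤ pairSum α far + (pairSum α near + pairSum α (Prod.swap ⁻¹' near)) :=
        (pairSum_mono α hsub).trans ((pairSum_union_le α _ _).trans
          (add_le_add le_rfl (pairSum_union_le α _ _)))
    _ = pairSum α far + (pairSum α near + pairSum α near) := by rw [pairSum_preimage_swap]
    _ ≤ 4 * ENNReal.ofReal ((N : ℝ) ^ (1 - α)) * Q +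
        (512 * 2⁻¹ ^ (m / 4) * Q + 512 * 2⁻¹ ^ (m / 4) * Q) := by gcongr
    _ = _ := by ring

lemma exists_scale_parameter {α : ℝ} (hα : 1 < α) {ε : ℝ} (hε : 0 < ε) :
    ∃ m, 64 ≤ m ∧ 4 * ENNReal.ofReal (((2 ^ (m / 4 - 5) : ℕ) : ℝ) ^ (1 - α)) +
      1024 * 2⁻¹ ^ (m / 4) ≤ ENNReal.ofReal ε := by
  have h1 : Tendsto (fun n : ℕ => 4 * (((2 ^ n : ℕ) : ℝ) ^ (1 - α)) +
      1024 * (2⁻¹ : ℝ) ^ (n + 5)) atTop (𝓝 (4 * 0 + 1024 * 0)) := by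
    refine Tendsto.add (Tendsto.const_mul 4 ?_) (Tendsto.const_mul 1024 ?_)
    · have h2 := (tendsto_rpow_neg_atTop (by linarith : 0 < α - 1)).comp
        (tendsto_pow_atTop_atTop_of_one_lt (one_lt_two (α := ℝ)))
      simpa [Function.comp_def] using h2
    · exact (tendsto_pow_atTop_nhds_zero_of_lt_one (by norm_num) (by norm_num)).comp
        (tendsto_add_atTop_nat 5)
  simp only [mul_zero, add_zero] at h1
  obtain ⟨n, hn, hn16⟩ := ((h1.eventually_lt_const hε).and (eventually_ge_atTop 16)).exists
  refine ⟨4 * (n + 5), by omega, ?_⟩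
  rw [show 4 * (n + 5) / 4 - 5 = n by omega, show 4 * (n + 5) / 4 = n + 5 by omega]
  have h3 : (2⁻¹ : ℝ≥0∞) ^ (n + 5) = ENNReal.ofReal ((2⁻¹ : ℝ) ^ (n + 5)) := by
    rw [ENNReal.ofReal_pow (by norm_num), ENNReal.ofReal_inv_of_pos two_pos, ENNReal.ofReal_ofNat]
  rw [h3, show (4 : ℝ≥0∞) = ENNReal.ofReal 4 by simp,
    show (1024 : ℝ≥0∞) = ENNReal.ofReal 1024 by simp, ← ENNReal.ofReal_mul (by norm_num),
    ← ENNReal.ofReal_mul (by norm_num), ← ENNReal.ofReal_add (by positivity) (by positivity)]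
  exact ENNReal.ofReal_le_ofReal hn.le

/-! ### Counting contours around the origin. -/

lemma blockCount_succ (γ : Finset ℤ) (K : ℕ) :
    blockCount γ (K + 1) = γ.card + blockCount (γ.image fun p => p / 2) K := by
  unfold blockCount
  rw [Finset.sum_range_succ', add_comm]
  congr 1
  · simp
  · refine Finset.sum_congr rfl fun k _ => ?_
    rw [Finset.image_image]
    congr 1
    refine Finset.image_congr fun p _ => ?_
    simp only [Function.comp_apply]
    rw [Int.ediv_ediv_of_nonneg (by norm_num), pow_succ, mul_comm]

lemma le_blockCount {γ : Finset ℤ} (hγ : γ.Nonempty) (K : ℕ) : K ≤ blockCount γ K := by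
  unfold blockCount
  calc K = ∑ k ∈ Finset.range K, 1 := by simp
    _ ≤ _ := Finset.sum_le_sum fun k _ => Finset.card_pos.2 (hγ.image _)

/-- A set that halves to `δ` has at least |δ| points, chosen among 2|δ| candidates; so there are at
most 4^|δ| such sets. -/
lemma sum_quarter_pow_card_le (U δ : Finset ℤ) :
    ∑ γ ∈ U.powerset.filter (fun γ => γ.image (fun p => p / 2) = δ), (1 / 4 : ℝ) ^ γ.card ≤ 1 := by
  set C := δ.image (fun d => 2 * d) ∪ δ.image (fun d => 2 * d + 1) with hC
  have hCcard : C.card ≤ 2 * δ.card := by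
    refine (Finset.card_union_le _ _).trans ?_
    have h1 := Finset.card_image_le (s := δ) (f := fun d : ℤ => 2 * d)
    have h2 := Finset.card_image_le (s := δ) (f := fun d : ℤ => 2 * d + 1)
    omega
  have hsub : U.powerset.filter (fun γ => γ.image (fun p => p / 2) = δ) ⊆ C.powerset := by
    intro γ hγ
    have h := (Finset.mem_filter.1 hγ).2
    rw [Finset.mem_powerset]
    intro p hp
    have hp2 : p / 2 ∈ δ := h ▸ Finset.mem_image_of_mem _ hp
    rw [hC, Finset.mem_union, Finset.mem_image, Finset.mem_image]
    rcases Int.emod_two_eq_zero_or_one p with h0 | h0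
    · exact Or.inl ⟨_, hp2, by omega⟩
    · exact Or.inr ⟨_, hp2, by omega⟩
  calc ∑ γ ∈ U.powerset.filter (fun γ => γ.image (fun p => p / 2) = δ), (1 / 4 : ℝ) ^ γ.card
      ≤ ∑ γ ∈ U.powerset.filter (fun γ => γ.image (fun p => p / 2) = δ), (1 / 4 : ℝ) ^ δ.card := by
        refine Finset.sum_le_sum fun γ hγ => ?_
        refine pow_le_pow_of_le_one (by norm_num) (by norm_num) ?_
        rw [← (Finset.mem_filter.1 hγ).2]
        exact Finset.card_image_le
    _ ≤ ∑ γ ∈ C.powerset, (1 / 4 : ℝ) ^ δ.card :=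
        Finset.sum_le_sum_of_subset_of_nonneg hsub fun _ _ _ => by positivity
    _ = 2 ^ C.card * (1 / 4 : ℝ) ^ δ.card := by
        rw [Finset.sum_const, Finset.card_powerset, nsmul_eq_mul]; push_cast; rfl
    _ ≤ 2 ^ (2 * δ.card) * (1 / 4 : ℝ) ^ δ.card := by
        gcongr
        norm_num
    _ = 1 := by rw [pow_mul, ← mul_pow]; norm_num

/-- Coarse-graining by halving peels off one block length at a time. It ends with the four subsets
of a two-point set. -/
lemma sum_quarter_pow_blockCount_le (K : ℕ) :
    ∑ γ ∈ (Finset.Ico (-2 ^ K : ℤ) (2 ^ K)).powerset, (1 / 4 : ℝ) ^ blockCount γ K ≤ 4 := by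
  induction K with
  | zero =>
    simp only [blockCount, Finset.range_zero, Finset.sum_empty, pow_zero, Finset.sum_const,
      Finset.card_powerset, Int.card_Ico]
    norm_num [show Int.toNat 2 = 2 from rfl]
  | succ K ih =>
    rw [← Finset.sum_fiberwise_of_maps_to (t := (Finset.Ico (-2 ^ K : ℤ) (2 ^ K)).powerset)
      (g := fun γ : Finset ℤ => γ.image fun p => p / 2)]
    · refine le_trans (Finset.sum_le_sum fun δ _ => ?_) ih
      calc ∑ γ ∈ (Finset.Ico (-2 ^ (K + 1) : ℤ) (2 ^ (K + 1))).powerset.filter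
            (fun γ => γ.image (fun p => p / 2) = δ), (1 / 4 : ℝ) ^ blockCount γ (K + 1)
          = ∑ γ ∈ (Finset.Ico (-2 ^ (K + 1) : ℤ) (2 ^ (K + 1))).powerset.filter
            (fun γ => γ.image (fun p => p / 2) = δ),
              (1 / 4 : ℝ) ^ γ.card * (1 / 4 : ℝ) ^ blockCount δ K := by
            refine Finset.sum_congr rfl fun γ hγ => ?_
            rw [blockCount_succ, (Finset.mem_filter.1 hγ).2, pow_add]
        _ ≤ 1 * (1 / 4 : ℝ) ^ blockCount δ K := by
            rw [← Finset.sum_mul]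
            gcongr
            exact sum_quarter_pow_card_le _ δ
        _ = _ := one_mul _
    · intro γ hγ
      rw [Finset.mem_powerset] at hγ ⊢
      intro b hb
      obtain ⟨p, hp, rfl⟩ := Finset.mem_image.1 hb
      have := Finset.mem_Ico.1 (hγ hp)
      rw [pow_succ] at this
      rw [Finset.mem_Ico]
      omega

/-- The counting estimate for contours. -/
lemma sum_pow_blockCount_le {G : Finset (Finset ℤ)} {κ : Finset ℤ → ℕ}
    (hne : ∀ γ ∈ G, γ.Nonempty) (hκ : ∀ γ ∈ G, 1 ≤ κ γ)
    (hsub : ∀ γ ∈ G, γ ⊆ Finset.Ico (-2 ^ κ γ : ℤ) (2 ^ κ γ)) :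
    ∑ γ ∈ G, (1 / 68 : ℝ) ^ blockCount γ (κ γ) ≤ 1 / 4 := by
  obtain ⟨M, hM⟩ : ∃ M, ∀ γ ∈ G, κ γ < M + 1 :=
    ⟨G.sup κ, fun γ hγ => Nat.lt_succ_of_le (Finset.le_sup hγ)⟩
  rw [← Finset.sum_fiberwise_of_maps_to (t := Finset.Ico 1 (M + 1)) (g := κ) fun γ hγ =>
    Finset.mem_Ico.2 ⟨hκ γ hγ, hM γ hγ⟩]
  -- Split 1/68 = 1/17 · 1/4: the quarters pay for the sets with a given `k`, and the 17ths, at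
  -- least `k` of them, make the sum over `k` at most 4 · 1/16.
  have h1 : ∀ k ∈ Finset.Ico 1 (M + 1),
      ∑ γ ∈ G.filter (κ · = k), (1 / 68 : ℝ) ^ blockCount γ (κ γ) ≤ 4 * (1 / 17) ^ k := by
    intro k _
    calc ∑ γ ∈ G.filter (κ · = k), (1 / 68 : ℝ) ^ blockCount γ (κ γ)
        ≤ ∑ γ ∈ G.filter (κ · = k), (1 / 17) ^ k * (1 / 4 : ℝ) ^ blockCount γ k := by
          refine Finset.sum_le_sum fun γ hγ => ?_
          obtain ⟨h1, h2⟩ := Finset.mem_filter.1 hγ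
          rw [h2, show (1 / 68 : ℝ) = 1 / 17 * (1 / 4) by norm_num, mul_pow]
          gcongr ?_ * _
          exact pow_le_pow_of_le_one (by norm_num) (by norm_num) (le_blockCount (hne γ h1) k)
      _ ≤ ∑ γ ∈ (Finset.Ico (-2 ^ k : ℤ) (2 ^ k)).powerset,
            (1 / 17) ^ k * (1 / 4 : ℝ) ^ blockCount γ k := by
          refine Finset.sum_le_sum_of_subset_of_nonneg (fun γ hγ => ?_) fun _ _ _ => by positivity
          obtain ⟨h1, h2⟩ := Finset.mem_filter.1 hγ
          rw [Finset.mem_powerset]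
          exact h2 ▸ hsub γ h1
      _ = (1 / 17) ^ k * ∑ γ ∈ (Finset.Ico (-2 ^ k : ℤ) (2 ^ k)).powerset,
            (1 / 4 : ℝ) ^ blockCount γ k := by rw [Finset.mul_sum]
      _ ≤ (1 / 17) ^ k * 4 := by
          gcongr
          exact sum_quarter_pow_blockCount_le k
      _ = _ := mul_comm _ _
  refine (Finset.sum_le_sum h1).trans ?_
  rw [← Finset.mul_sum, Finset.sum_Ico_eq_sum_range]
  have h2 : ∑ k ∈ Finset.range (M + 1 - 1), (1 / 17 : ℝ) ^ (1 + k) ≤ 1 / 16 := by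
    simp only [pow_add, pow_one, ← Finset.mul_sum]
    have h3 : ∑ k ∈ Finset.range (M + 1 - 1), (1 / 17 : ℝ) ^ k ≤ 17 / 16 := by
      refine (Summable.sum_le_tsum _ (fun _ _ => by positivity)
        (summable_geometric_of_lt_one (by norm_num) (by norm_num))).trans ?_
      rw [tsum_geometric_of_lt_one (by norm_num) (by norm_num)]
      norm_num
    linarith
  linarith

/-- A contour around the origin stays within its diameter, at most four scales, of it. The 3 in the
exponent gives strict room. -/
lemma subset_Ico_of_zero_mem_inside {m : ℕ} (hm : 16 ≤ m) {γ : Finset ℤ} (hγ : Even γ.card)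
    (h0 : (0 : ℤ) ∈ inside γ) :
    γ ⊆ Finset.Ico (-2 ^ (scaleExp m (scaleIndex m γ) + 3) : ℤ)
      (2 ^ (scaleExp m (scaleIndex m γ) + 3)) := by
  intro p hp
  have hd := (scaleIndex_le_iff hm).1 (le_refl (scaleIndex m γ))
  have hpos := scale_pos m (scaleIndex m γ)
  obtain ⟨q, hq, q', hq', h1, h2, -⟩ := exists_mem_le_lt_of_mem_inside hγ h0
  have h3 := natAbs_sub_le_diam hp hq
  have h4 := natAbs_sub_le_diam hp hq'
  have h5 : (2 : ℤ) ^ (scaleExp m (scaleIndex m γ) + 3) = 8 * (scale m (scaleIndex m γ) : ℕ) := by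
    rw [scale]; push_cast; ring
  rw [Finset.mem_Ico, h5]
  omega

/-! ### Isoperimetry and the field. -/

lemma rpow_sub_rpow_le_coupling {α : ℝ} (hα₂ : α ≤ 2) {r : ℕ} (hr : 0 < r) :
    (r : ℝ) ^ (1 - α) - ((r + 1 : ℕ) : ℝ) ^ (1 - α) ≤ coupling α r := by
  have hrR : (1 : ℝ) ≤ r := by exact_mod_cast hr
  have hr0 : (0 : ℝ) < r := by linarith
  rw [coupling, if_neg hr.ne']
  have h1 : (r : ℝ) ^ (1 - α) = (r : ℝ) ^ (-α) * r := by
    rw [sub_eq_neg_add, Real.rpow_add hr0, Real.rpow_one]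
  have h2 : (r : ℝ) ^ (1 - α) * (r / (r + 1)) ≤ ((r + 1 : ℕ) : ℝ) ^ (1 - α) := by
    have h3 : ((r + 1 : ℕ) : ℝ) ^ (1 - α) = (r : ℝ) ^ (1 - α) * (((r : ℝ) + 1) / r) ^ (1 - α) := by
      rw [← Real.mul_rpow hr0.le (by positivity), mul_div_cancel₀ _ hr0.ne']
      push_cast; rfl
    rw [h3]
    gcongr
    calc (r : ℝ) / (r + 1) = (((r : ℝ) + 1) / r) ^ (-1 : ℝ) := by
          rw [Real.rpow_neg_one, inv_div]
      _ ≤ _ := Real.rpow_le_rpow_of_exponent_le (by rw [le_div_iff₀ hr0]; linarith) (by linarith)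
  have h4 : (r : ℝ) ^ (1 - α) - (r : ℝ) ^ (1 - α) * (r / (r + 1)) =
      (r : ℝ) ^ (-α) * (r / (r + 1)) := by
    rw [h1]; field_simp; ring
  have h5 : (r : ℝ) ^ (-α) * (r / (r + 1)) ≤ (r : ℝ) ^ (-α) * 1 := by
    gcongr
    rw [div_le_one (by linarith)]
    linarith
  linarith

/-- Telescoping; the remainder vanishes because α > 1, while α ≤ 2 gives the constant 1 that leads
to the threshold κ < 1. -/
lemma rpow_le_tsum_coupling {α : ℝ} (hα : 1 < α) (hα₂ : α ≤ 2) (n : ℕ) :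
    ENNReal.ofReal (((n + 1 : ℕ) : ℝ) ^ (1 - α)) ≤
      ∑' k : ℕ, ENNReal.ofReal (coupling α (k + n + 1)) := by
  have h1 : ∀ M : ℕ, ((n + 1 : ℕ) : ℝ) ^ (1 - α) - ((M + n + 1 : ℕ) : ℝ) ^ (1 - α) ≤
      ∑ k ∈ Finset.range M, coupling α (k + n + 1) := by
    intro M
    induction M with
    | zero => simp
    | succ M ih =>
      rw [Finset.sum_range_succ]
      have := rpow_sub_rpow_le_coupling hα₂ (r := M + n + 1) (by omega)
      rw [show M + n + 1 + 1 = M + 1 + n + 1 by ring] at this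
      linarith
  have h2 : Tendsto (fun M : ℕ => ENNReal.ofReal
      (((n + 1 : ℕ) : ℝ) ^ (1 - α) - ((M + n + 1 : ℕ) : ℝ) ^ (1 - α))) atTop
      (𝓝 (ENNReal.ofReal (((n + 1 : ℕ) : ℝ) ^ (1 - α) - 0))) := by
    refine ENNReal.tendsto_ofReal (tendsto_const_nhds.sub ?_)
    have h3 := (tendsto_rpow_neg_atTop (by linarith : 0 < α - 1)).comp
      ((tendsto_natCast_atTop_atTop (R := ℝ)).comp (tendsto_add_atTop_nat (n + 1)))
    simpa [Function.comp_def, add_assoc] using h3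
  rw [sub_zero] at h2
  refine le_of_tendsto' h2 fun M => ?_
  refine (ENNReal.ofReal_le_ofReal (h1 M)).trans ?_
  rw [ENNReal.ofReal_sum_of_nonneg fun _ _ => coupling_nonneg _ _]
  exact ENNReal.sum_le_tsum _

lemma coupling_anti {α : ℝ} (hα : 0 ≤ α) {r s : ℕ} (hr : 0 < r) (hrs : r ≤ s) :
    coupling α s ≤ coupling α r := by
  rw [coupling, coupling, if_neg (by omega), if_neg (by omega)]
  exact Real.rpow_le_rpow_of_nonpos (by exact_mod_cast hr) (by exact_mod_cast hrs) (by linarith)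

/-- A site is coupled to the part of a half-line outside a finite set at least as strongly as to the
part beyond the first `B.card` sites. -/
lemma tsum_coupling_le_pairSum_row {α : ℝ} (hα : 0 ≤ α) (B : Finset ℤ) (a : ℤ) :
    ∑' k : ℕ, ENNReal.ofReal (coupling α (k + B.card + 1)) ≤
      pairSum α {p | p.1 = a ∧ p.2 ∉ B ∧ p.1 < p.2} := by
  classical
  -- The free distances to the right of `a`. Among the first k + |B| + 1 positive distances at most
  -- |B| are blocked, so the free distance with index `k`, counted from 0, is at most k + |B| + 1.
  set P : ℕ → Prop := fun r => 1 ≤ r ∧ a + r ∉ B with hP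
  have hcount : ∀ k, k < Nat.count P (k + B.card + 2) := by
    intro k
    rw [Nat.count_eq_card_filter_range]
    have h1 : Finset.range (k + B.card + 2) ⊆ (Finset.range (k + B.card + 2)).filter P ∪
        (insert 0 (B.image fun b => (b - a).natAbs)) := by
      intro r hr
      rw [Finset.mem_union, Finset.mem_filter, Finset.mem_insert, Finset.mem_image]
      by_cases h : P r
      · exact Or.inl ⟨hr, h⟩
      · by_cases h0 : r = 0
        · exact Or.inr (Or.inl h0)
        · refine Or.inr (Or.inr ⟨a + r, ?_, by omega⟩)
          by_contra hB
          exact h ⟨by omega, hB⟩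
    have h2 := (Finset.card_le_card h1).trans (Finset.card_union_le _ _)
    have h3 := Finset.card_insert_le 0 (B.image fun b => (b - a).natAbs)
    have h4 := Finset.card_image_le (s := B) (f := fun b => (b - a).natAbs)
    rw [Finset.card_range] at h2
    have h5 : k < ((Finset.range (k + B.card + 2)).filter P).card := by omega
    convert h5
  have hinf : (Set.ofPred P).Infinite := by
    intro hfin
    have h1 := hcount hfin.toFinset.card
    have h2 : ∀ n, Nat.count P n ≤ hfin.toFinset.card := by
      intro n
      rw [Nat.count_eq_card_filter_range]
      refine Finset.card_le_card fun r hr => ?_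
      rw [Set.Finite.mem_toFinset]
      exact (Finset.mem_filter.1 hr).2
    exact absurd h1 (not_lt.2 (h2 _))
  set f : ℕ → ℤ × ℤ := fun k => (a, a + (Nat.nth P k : ℕ)) with hf
  have hinj : Function.Injective f := fun i j hij => by
    simp only [hf, Prod.mk.injEq, true_and, add_right_inj, Nat.cast_inj] at hij
    exact Nat.nth_injective hinf hij
  unfold pairSum
  refine le_trans (ENNReal.tsum_le_tsum fun k => ?_) (ENNReal.tsum_comp_le_tsum_of_injective hinj _)
  have hmem : P (Nat.nth P k) := Nat.nth_mem_of_infinite hinf k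
  have hlt : Nat.nth P k < k + B.card + 2 := Nat.nth_lt_of_lt_count (hcount k)
  rw [Set.indicator_of_mem]
  · unfold pairCoupling
    refine ENNReal.ofReal_le_ofReal ?_
    simp only [hf]
    refine coupling_anti hα ?_ ?_
    · have := hmem.1; omega
    · omega
  · refine ⟨rfl, hmem.2, ?_⟩
    have := hmem.1
    simp only [hf]; omega

lemma pairSum_add_le (α : ℝ) {S T U : Set (ℤ × ℤ)} (hd : Disjoint S T) (hS : S ⊆ U) (hT : T ⊆ U) :
    pairSum α S + pairSum α T ≤ pairSum α U := by
  have := sum_pairSum_le α (Finset.univ : Finset Bool) (S := fun b => cond b S T) (T := U) ?_ ?_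
  · simpa using this
  · rintro (_ | _) - (_ | _) - hij
    · exact absurd rfl hij
    · exact hd.symm
    · exact hd
    · exact absurd rfl hij
  · rintro (_ | _) -
    · exact hT
    · exact hS

/-- Add the sites from right to left: a new leftmost site sees to its right a complement with |B|
sites removed and leaves the earlier pairs intact. -/
lemma sum_rpow_le_pairSum_right {α : ℝ} (hα : 1 < α) (hα₂ : α ≤ 2) (B : Finset ℤ) :
    ∑ n ∈ Finset.range B.card, ENNReal.ofReal (((n + 1 : ℕ) : ℝ) ^ (1 - α)) ≤
      pairSum α {p | p.1 ∈ B ∧ p.2 ∉ B ∧ p.1 < p.2} := by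
  induction B using Finset.induction_on_min with
  | empty => simp
  | insert a B ha ih =>
    have haB : a ∉ B := fun h => lt_irrefl _ (ha a h)
    rw [Finset.card_insert_of_notMem haB, Finset.sum_range_succ]
    refine (add_le_add ih ((rpow_le_tsum_coupling hα hα₂ B.card).trans
      (tsum_coupling_le_pairSum_row (by linarith) B a))).trans ?_
    refine pairSum_add_le α ?_ ?_ ?_
    · rw [Set.disjoint_left]
      rintro p ⟨h1, -⟩ ⟨h2, -⟩
      exact haB (h2 ▸ h1)
    · rintro p ⟨h1, h2, h3⟩
      refine ⟨Finset.mem_insert_of_mem h1, ?_, h3⟩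
      have := ha _ h1
      rw [Finset.mem_insert, not_or]
      exact ⟨by omega, h2⟩
    · rintro p ⟨h1, h2, h3⟩
      refine ⟨h1 ▸ Finset.mem_insert_self _ _, ?_, h3⟩
      rw [Finset.mem_insert, not_or]
      exact ⟨by omega, h2⟩

/-- Isoperimetric inequality: the cut of a finite set is at least that of an interval. -/
lemma four_mul_sum_rpow_le_pairSum_cut {α : ℝ} (hα : 1 < α) (hα₂ : α ≤ 2) (B : Finset ℤ) :
    4 * ∑ n ∈ Finset.range B.card, ENNReal.ofReal (((n + 1 : ℕ) : ℝ) ^ (1 - α)) ≤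
      pairSum α (cut B) := by
  set R : Set (ℤ × ℤ) := {p | p.1 ∈ B ∧ p.2 ∉ B ∧ p.1 < p.2} with hR
  set L : Set (ℤ × ℤ) := {p | p.1 ∈ B ∧ p.2 ∉ B ∧ p.2 < p.1} with hL
  set D : Set (ℤ × ℤ) := {p | p.1 ∈ B ∧ p.2 ∉ B} with hD
  set s := ∑ n ∈ Finset.range B.card, ENNReal.ofReal (((n + 1 : ℕ) : ℝ) ^ (1 - α)) with hs
  have h1 : s ≤ pairSum α R := sum_rpow_le_pairSum_right hα hα₂ B
  have h2 : s ≤ pairSum α L := by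
    have h3 := sum_rpow_le_pairSum_right hα hα₂ (B.map (Equiv.neg ℤ).toEmbedding)
    rw [Finset.card_map] at h3
    have hmem : ∀ x : ℤ, x ∈ B.map (Equiv.neg ℤ).toEmbedding ↔ -x ∈ B := by
      intro x
      rw [Finset.mem_map_equiv]
      rfl
    refine h3.trans ((pairSum_le_mul_of_injective α (f := fun p => (-p.1, -p.2)) (T := L) (c := 1)
      (fun p q hpq => ?_) ?_).trans_eq (one_mul _))
    · simp only [Prod.mk.injEq, neg_inj] at hpq
      exact Prod.ext hpq.1 hpq.2
    · rintro p ⟨h4, h5, h6⟩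
      rw [hmem] at h4 h5
      refine ⟨⟨h4, h5, by simpa using h6⟩, ?_⟩
      rw [one_mul, ← pairCoupling_swap]
      refine le_of_eq ?_
      simp only [pairCoupling, Prod.fst_swap, Prod.snd_swap]
      congr 3
      ring
  have h3 : s + s ≤ pairSum α D := by
    refine (add_le_add h1 h2).trans (pairSum_add_le α ?_ (fun p hp => ⟨hp.1, hp.2.1⟩)
      fun p hp => ⟨hp.1, hp.2.1⟩)
    rw [Set.disjoint_left]
    rintro p ⟨-, -, h4⟩ ⟨-, -, h5⟩
    omega
  have h4 : pairSum α D + pairSum α (Prod.swap ⁻¹' D) ≤ pairSum α (cut B) := by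
    refine pairSum_add_le α ?_ ?_ ?_
    · rw [Set.disjoint_left]
      rintro p ⟨h4, -⟩ ⟨-, h5⟩
      exact h5 h4
    · rintro p ⟨h4, h5⟩
      rw [mem_cut]
      simp [h4, h5]
    · rintro p ⟨h4, h5⟩
      rw [mem_cut]
      simp only [Prod.fst_swap, Prod.snd_swap] at h4 h5
      simp [h4, h5]
  rw [pairSum_preimage_swap] at h4
  calc 4 * s = (s + s) + (s + s) := by ring
    _ ≤ _ := (add_le_add h3 h3).trans h4

lemma sum_le_sum_range_of_antitone {f : ℕ → ℝ} (hf : ∀ r s, 1 ≤ r → r ≤ s → f s ≤ f r)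
    (S : Finset ℕ) (hS : ∀ r ∈ S, 1 ≤ r) :
    ∑ r ∈ S, f r ≤ ∑ n ∈ Finset.range S.card, f (n + 1) := by
  induction S using Finset.induction_on_max with
  | empty => simp
  | insert a S ha ih =>
    have haS : a ∉ S := fun h => lt_irrefl _ (ha a h)
    rw [Finset.sum_insert haS, Finset.card_insert_of_notMem haS, Finset.sum_range_succ, add_comm]
    refine add_le_add (ih fun r hr => hS r (Finset.mem_insert_of_mem hr)) (hf _ _ (by omega) ?_)
    have h1 : S ⊆ Finset.Ico 1 a := fun r hr =>
      Finset.mem_Ico.2 ⟨hS r (Finset.mem_insert_of_mem hr), ha r hr⟩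
    have h2 := Finset.card_le_card h1
    have h3 := hS a (Finset.mem_insert_self _ _)
    rw [Nat.card_Ico] at h2
    omega

/-- On each half-line the decreasing function is summed over distinct positive integers, so the
first ones give the maximum. Bounding each half by all of |B| is crude but suffices. -/
lemma sum_abs_rpow_le {α : ℝ} (hα : 1 < α) (B : Finset ℤ) (hB : ∀ x ∈ B, x ≠ 0) :
    ∑ x ∈ B, |(x : ℝ)| ^ (1 - α) ≤
      2 * ∑ n ∈ Finset.range B.card, ((n + 1 : ℕ) : ℝ) ^ (1 - α) := by
  have hhalf : ∀ C ⊆ B, Set.InjOn Int.natAbs (C : Set ℤ) →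
      ∑ x ∈ C, |(x : ℝ)| ^ (1 - α) ≤ ∑ n ∈ Finset.range B.card, ((n + 1 : ℕ) : ℝ) ^ (1 - α) := by
    intro C hC hinj
    calc ∑ x ∈ C, |(x : ℝ)| ^ (1 - α) = ∑ r ∈ C.image Int.natAbs, (r : ℝ) ^ (1 - α) := by
          rw [Finset.sum_image hinj]
          refine Finset.sum_congr rfl fun x _ => ?_
          rw [Nat.cast_natAbs, Int.cast_abs]
      _ ≤ ∑ n ∈ Finset.range (C.image Int.natAbs).card, ((n + 1 : ℕ) : ℝ) ^ (1 - α) := by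
          refine sum_le_sum_range_of_antitone (f := fun r : ℕ => (r : ℝ) ^ (1 - α)) ?_ _ ?_
          · intro r s hr hrs
            exact Real.rpow_le_rpow_of_nonpos (by exact_mod_cast hr) (by exact_mod_cast hrs)
              (by linarith)
          · intro r hr
            obtain ⟨x, hx, rfl⟩ := Finset.mem_image.1 hr
            have := hB x (hC hx)
            omega
      _ ≤ _ := by
          refine Finset.sum_le_sum_of_subset_of_nonneg (Finset.range_mono ?_)
            fun _ _ _ => by positivity
          exact Finset.card_image_le.trans (Finset.card_le_card hC)
  rw [← Finset.sum_filter_add_sum_filter_not B (0 < ·), two_mul]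
  refine add_le_add (hhalf _ (Finset.filter_subset _ _) ?_) (hhalf _ (Finset.filter_subset _ _) ?_)
  · intro x hx y hy hxy
    have h1 := (Finset.mem_filter.1 hx).2
    have h2 := (Finset.mem_filter.1 hy).2
    omega
  · intro x hx y hy hxy
    have h1 := (Finset.mem_filter.1 hx).2
    have h2 := (Finset.mem_filter.1 hy).2
    omega

/-- The field inside a finite set is dominated by the cut of that set. -/
lemma sum_field_le {α : ℝ} (hα : 1 < α) (hα₂ : α ≤ 2) {h : ℤ → ℝ} {κ : ℝ} (hκ : 0 ≤ κ)
    (h0 : h 0 = 0) (hh : ∀ x ≠ 0, h x ≤ κ * |(x : ℝ)| ^ (1 - α)) (B : Finset ℤ)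
    (hfin : pairSum α (cut B) ≠ ⊤) :
    2 * ∑ x ∈ B, h x ≤ κ * (pairSum α (cut B)).toReal := by
  have h1 : 4 * ∑ n ∈ Finset.range B.card, ((n + 1 : ℕ) : ℝ) ^ (1 - α) ≤
      (pairSum α (cut B)).toReal := by
    rw [← ENNReal.ofReal_le_iff_le_toReal hfin, ENNReal.ofReal_mul (by norm_num),
      ENNReal.ofReal_sum_of_nonneg fun _ _ => by positivity, ENNReal.ofReal_ofNat]
    exact four_mul_sum_rpow_le_pairSum_cut hα hα₂ B
  have h2 : ∑ x ∈ B, h x ≤ ∑ x ∈ B.erase 0, κ * |(x : ℝ)| ^ (1 - α) := by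
    have e : ∑ x ∈ B, h x = ∑ x ∈ B.erase 0, h x := by
      refine (Finset.sum_subset (Finset.erase_subset _ _) fun x hx hx' => ?_).symm
      have : x = 0 := by
        by_contra hne
        exact hx' (Finset.mem_erase.2 ⟨hne, hx⟩)
      rw [this, h0]
    rw [e]
    exact Finset.sum_le_sum fun x hx => hh x (Finset.ne_of_mem_erase hx)
  have h3 := sum_abs_rpow_le hα (B.erase 0) fun x hx => Finset.ne_of_mem_erase hx
  have h4 : ∑ n ∈ Finset.range (B.erase 0).card, ((n + 1 : ℕ) : ℝ) ^ (1 - α) ≤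
      ∑ n ∈ Finset.range B.card, ((n + 1 : ℕ) : ℝ) ^ (1 - α) :=
    Finset.sum_le_sum_of_subset_of_nonneg (Finset.range_mono (Finset.card_erase_le))
      fun _ _ _ => by positivity
  rw [← Finset.mul_sum] at h2
  -- Twice the field sum is at most 2κ · 2 ∑ n^(1-α), which the isoperimetric factor 4 matches
  -- exactly.
  nlinarith

/-! ### Energy gain of a flip. -/

lemma pairSum_eq_two_mul {α : ℝ} {S : Set (ℤ × ℤ)} (hS : ∀ p, p.swap ∈ S ↔ p ∈ S) :
    pairSum α S = 2 * pairSum α {p | p ∈ S ∧ p.1 < p.2} := by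
  classical
  have h1 : pairSum α S =
      pairSum α {p | p ∈ S ∧ p.1 < p.2} + pairSum α (Prod.swap ⁻¹' {p | p ∈ S ∧ p.1 < p.2}) := by
    unfold pairSum
    rw [← ENNReal.tsum_add]
    refine tsum_congr fun p => ?_
    simp only [Set.indicator_apply, Set.mem_preimage, Set.mem_ofPred_eq, hS, Prod.fst_swap,
      Prod.snd_swap]
    rcases lt_trichotomy p.1 p.2 with h | h | h
    · simp [h, h.not_gt]
    · simp [h, pairCoupling, coupling]
    · simp [h, h.not_gt]
  rw [h1, pairSum_preimage_swap, two_mul]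

lemma summable_indicator_coupling {α : ℝ} (hα : 1 < α) {Λ : Finset ℤ} {S : Set (ℤ × ℤ)}
    (hS : ∀ p ∈ S, p.1 ∈ Λ ∨ p.2 ∈ Λ) :
    Summable (S.indicator fun p : ℤ × ℤ => coupling α (p.1 - p.2).natAbs) := by
  refine Summable.of_nonneg_of_le
    (fun p => Set.indicator_nonneg (fun _ _ => coupling_nonneg _ _) p) (fun p => ?_)
    (summable_touchingCoupling hα Λ)
  by_cases hp : p ∈ S
  · rw [Set.indicator_of_mem hp, touchingCoupling, if_pos (hS p hp)]
  · rw [Set.indicator_of_notMem hp]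
    exact touchingCoupling_nonneg _ _ _

lemma toReal_pairSum (α : ℝ) (S : Set (ℤ × ℤ)) :
    (pairSum α S).toReal = ∑' p, S.indicator (fun p => coupling α (p.1 - p.2).natAbs) p := by
  unfold pairSum
  rw [ENNReal.tsum_toReal_eq]
  · refine tsum_congr fun p => ?_
    by_cases hp : p ∈ S
    · simp [hp, pairCoupling, coupling_nonneg]
    · simp [hp]
  · intro p
    by_cases hp : p ∈ S
    · simp [hp, pairCoupling]
    · simp [hp]

lemma pairSum_ne_top {α : ℝ} (hα : 1 < α) {Λ : Finset ℤ} {S : Set (ℤ × ℤ)}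
    (hS : ∀ p ∈ S, p.1 ∈ Λ ∨ p.2 ∈ Λ) : pairSum α S ≠ ⊤ := by
  have h1 : pairSum α S = ∑' p,
      ENNReal.ofReal (S.indicator (fun p => coupling α (p.1 - p.2).natAbs) p) := by
    refine tsum_congr fun p => ?_
    by_cases hp : p ∈ S
    · simp [hp, pairCoupling]
    · simp [hp]
  rw [h1, ← ENNReal.ofReal_tsum_of_nonneg
    (fun p => Set.indicator_nonneg (fun _ _ => coupling_nonneg _ _) p)
    (summable_indicator_coupling hα hS)]
  exact ENNReal.ofReal_ne_top

lemma mem_or_mem_of_mem_cut {B : Finset ℤ} {p : ℤ × ℤ} (hp : p ∈ cut (B : Set ℤ)) :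
    p.1 ∈ B ∨ p.2 ∈ B := by
  rw [mem_cut, Finset.mem_coe, Finset.mem_coe] at hp
  tauto

lemma swap_mem_cut {B : Set ℤ} {p : ℤ × ℤ} : p.swap ∈ cut B ↔ p ∈ cut B := by
  rw [mem_cut, mem_cut, Prod.fst_swap, Prod.snd_swap, iff_comm (a := p.2 ∈ B)]

/-- The configuration with the spins in `B` reversed. -/
def flip (B : Finset ℤ) (σ : Config) : Config := fun x => if x ∈ B then !σ x else σ x

lemma spin_not (b : Bool) : spin (!b) = -spin b := by cases b <;> simp [spin]

lemma pairEnergy_sub_pairEnergy_flip (α : ℝ) {B Λ : Finset ℤ} (hB : B ⊆ Λ) (σ : Config)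
    (p : ℤ × ℤ) :
    pairEnergy α Λ σ p - pairEnergy α Λ (flip B σ) p =
      2 * {p : ℤ × ℤ | p ∈ cut (B : Set ℤ) ∧ p.1 < p.2}.indicator
        (fun p => coupling α (p.1 - p.2).natAbs) p -
      4 * {p : ℤ × ℤ | (p ∈ cut (B : Set ℤ) ∧ σ p.1 = σ p.2) ∧ p.1 < p.2}.indicator
        (fun p => coupling α (p.1 - p.2).natAbs) p := by
  have hs : spin (σ p.1) * spin (σ p.2) = if σ p.1 = σ p.2 then 1 else -1 := by
    cases σ p.1 <;> cases σ p.2 <;> simp [spin]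
  simp only [Set.indicator_apply, Set.mem_ofPred_eq, mem_cut, Finset.mem_coe, pairEnergy, flip]
  by_cases hlt : p.1 < p.2
  · by_cases h1 : p.1 ∈ B <;> by_cases h2 : p.2 ∈ B
    · simp [h1, h2, spin_not]
    · simp only [h1, h2, hlt, hB h1, if_true, if_false, spin_not, neg_mul, hs, true_and, and_true,
        true_or, iff_false, not_true_eq_false, not_false_eq_true]
      split_ifs <;> ring
    · simp only [h1, h2, hlt, hB h2, if_true, if_false, spin_not, mul_neg, hs, true_and, and_true,
        or_true, iff_true, not_false_eq_true]
      split_ifs <;> ring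
    · simp [h1, h2]
  · simp [hlt]

/-- Only cut pairs change: a broken one gains twice its coupling and an aligned one loses as much.
Counting ordered pairs turns the 2 into 1. -/
lemma hamiltonian_sub_hamiltonian_flip {α : ℝ} (hα : 1 < α) (h : ℤ → ℝ) {B Λ : Finset ℤ}
    (hB : B ⊆ Λ) (σ : Config) :
    hamiltonian α h Λ σ - hamiltonian α h Λ (flip B σ) =
      (pairSum α (cut (B : Set ℤ))).toReal -
        2 * (pairSum α {p | p ∈ cut (B : Set ℤ) ∧ σ p.1 = σ p.2}).toReal -
        2 * ∑ x ∈ B, h x * spin (σ x) := by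
  have h1 : (∑' p, pairEnergy α Λ σ p) - ∑' p, pairEnergy α Λ (flip B σ) p =
      (pairSum α (cut (B : Set ℤ))).toReal -
        2 * (pairSum α {p | p ∈ cut (B : Set ℤ) ∧ σ p.1 = σ p.2}).toReal := by
    rw [pairSum_eq_two_mul (S := cut (B : Set ℤ)) fun p => swap_mem_cut,
      pairSum_eq_two_mul (S := {p | p ∈ cut (B : Set ℤ) ∧ σ p.1 = σ p.2}) fun p =>
        and_congr swap_mem_cut eq_comm,
      ENNReal.toReal_mul, ENNReal.toReal_mul, toReal_pairSum, toReal_pairSum, ← mul_assoc,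
      ENNReal.toReal_ofNat, ← (summable_pairEnergy hα Λ σ).tsum_sub (summable_pairEnergy hα Λ _),
      show (2 : ℝ) * 2 = 4 by norm_num, ← tsum_mul_left, ← tsum_mul_left,
      ← Summable.tsum_sub]
    · exact tsum_congr fun p => pairEnergy_sub_pairEnergy_flip α hB σ p
    · exact (summable_indicator_coupling hα (Λ := B) fun p hp =>
        mem_or_mem_of_mem_cut hp.1).mul_left _
    · exact (summable_indicator_coupling hα (Λ := B) fun p hp =>
        mem_or_mem_of_mem_cut hp.1.1).mul_left _
  have h2 : ∑ x ∈ Λ, h x * (1 - spin (σ x)) - ∑ x ∈ Λ, h x * (1 - spin (flip B σ x)) =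
      -(2 * ∑ x ∈ B, h x * spin (σ x)) := by
    rw [← Finset.sum_sub_distrib, ← Finset.sum_sdiff hB, Finset.sum_eq_zero, zero_add,
      Finset.mul_sum, ← Finset.sum_neg_distrib]
    · refine Finset.sum_congr rfl fun x hx => ?_
      simp only [flip, hx, if_true, spin_not]
      ring
    · intro x hx
      simp only [flip, (Finset.mem_sdiff.1 hx).2, if_false, sub_self]
  rw [hamiltonian_eq, hamiltonian_eq]
  linarith

/-- Reversing the spins inside a contour gains energy proportional to the coupling across it. -/
lemma hamiltonian_flip_add_le {α : ℝ} (hα : 1 < α) (hα₂ : α ≤ 2) {h : ℤ → ℝ} {κ : ℝ} (hκ : 0 ≤ κ)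
    (hnn : ∀ x, 0 ≤ h x) (h0 : h 0 = 0) (hh : ∀ x ≠ 0, h x ≤ κ * |(x : ℝ)| ^ (1 - α))
    (hκ1 : κ < 1) {m : ℕ} (hm : 64 ≤ m)
    (hcoef : 4 * ENNReal.ofReal (((2 ^ (m / 4 - 5) : ℕ) : ℝ) ^ (1 - α)) + 1024 * 2⁻¹ ^ (m / 4) ≤
      ENNReal.ofReal ((1 - κ) / 4))
    {σ : Config} {b : Bool} {A : Finset ℤ} (hA : ∀ x, x ∈ A ↔ σ x ≠ b) {P : Finset (Finset ℤ)}
    (hP : IsContourFamily m (boundary A) P) {γ : Finset ℤ} (hγ : γ ∈ P) {B Λ : Finset ℤ}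
    (hBγ : (B : Set ℤ) = inside γ) (hB : B ⊆ Λ) :
    hamiltonian α h Λ (flip B σ) + (1 - κ) / 2 * (pairSum α (cut (inside γ))).toReal ≤
      hamiltonian α h Λ σ := by
  have hfin : pairSum α (cut (B : Set ℤ)) ≠ ⊤ :=
    pairSum_ne_top hα fun p hp => mem_or_mem_of_mem_cut hp
  have h1 := hamiltonian_sub_hamiltonian_flip hα h hB σ
  have h2 := sum_field_le hα hα₂ hκ h0 hh B hfin
  -- The worst case, all spins up, covers both boundary conditions, including the minus one, against
  -- which the field acts.
  have h3 : ∑ x ∈ B, h x * spin (σ x) ≤ ∑ x ∈ B, h x := Finset.sum_le_sum fun x _ =>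
    mul_le_of_le_one_right (hnn x) ((le_abs_self _).trans (abs_spin _).le)
  -- The budget in units of the cut: 1 − 2(1 − κ)/4 − κ = (1 − κ)/2.
  have h4 : (pairSum α {p | p ∈ cut (B : Set ℤ) ∧ σ p.1 = σ p.2}).toReal ≤
      (1 - κ) / 4 * (pairSum α (cut (B : Set ℤ))).toReal := by
    rw [← ENNReal.toReal_ofReal (by linarith : 0 ≤ (1 - κ) / 4), ← ENNReal.toReal_mul]
    refine ENNReal.toReal_mono (ENNReal.mul_ne_top ENNReal.ofReal_ne_top hfin) ?_
    rw [hBγ]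
    refine le_trans (pairSum_mono α ?_)
      ((pairSum_same_le (by linarith) hα₂ hm hP hγ).trans (mul_le_mul' hcoef le_rfl))
    intro p hp
    refine ⟨hp.1, ?_⟩
    rw [mem_inside_boundary, mem_inside_boundary, hA, hA, hp.2]
  rw [← hBγ]
  linarith

/-- Energy beats entropy: the block count is at most 9m + 643 times the cut, so for such β the gain
pays log 68 per block. -/
lemma weight_le_pow_mul_weight_flip {α : ℝ} (hα : 1 < α) (hα₂ : α ≤ 2) {h : ℤ → ℝ} {κ : ℝ}
    (hκ : 0 ≤ κ) (hnn : ∀ x, 0 ≤ h x) (h0 : h 0 = 0)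
    (hh : ∀ x ≠ 0, h x ≤ κ * |(x : ℝ)| ^ (1 - α)) (hκ1 : κ < 1) {m : ℕ} (hm : 64 ≤ m)
    (hcoef : 4 * ENNReal.ofReal (((2 ^ (m / 4 - 5) : ℕ) : ℝ) ^ (1 - α)) + 1024 * 2⁻¹ ^ (m / 4) ≤
      ENNReal.ofReal ((1 - κ) / 4))
    {β : ℝ} (hβ : (9 * m + 643 : ℕ) * Real.log 68 ≤ β * ((1 - κ) / 2)) {σ : Config} {b : Bool}
    {A : Finset ℤ} (hA : ∀ x, x ∈ A ↔ σ x ≠ b) {P : Finset (Finset ℤ)}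
    (hP : IsContourFamily m (boundary A) P) {γ : Finset ℤ} (hγ : γ ∈ P)
    (hu : Unsplittable m γ) {B Λ : Finset ℤ} (hBγ : (B : Set ℤ) = inside γ) (hB : B ⊆ Λ) :
    weight α h β Λ σ ≤ (1 / 68 : ℝ) ^ blockCount γ (scaleExp m (scaleIndex m γ) + 3) *
      weight α h β Λ (flip B σ) := by
  set n := blockCount γ (scaleExp m (scaleIndex m γ) + 3) with hn
  set Q := (pairSum α (cut (inside γ))).toReal with hQ
  have hlog : 0 < Real.log 68 := Real.log_pos (by norm_num)
  have hfin : pairSum α (cut (inside γ)) ≠ ⊤ := hBγ ▸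
    pairSum_ne_top hα fun p hp => mem_or_mem_of_mem_cut hp
  have h1 := hamiltonian_flip_add_le hα hα₂ hκ hnn h0 hh hκ1 hm hcoef hA hP hγ hBγ hB
  have h2 : (n : ℝ) ≤ (9 * m + 643 : ℕ) * Q := by
    have := ENNReal.toReal_mono (ENNReal.mul_ne_top (ENNReal.natCast_ne_top _) hfin)
      (blockCount_le_pairSum_cut hα₂ hm hu)
    rwa [ENNReal.toReal_mul, ENNReal.toReal_natCast, ENNReal.toReal_natCast] at this
  have h3 : (1 / 68 : ℝ) ^ n = Real.exp (-(n * Real.log 68)) := by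
    rw [Real.exp_neg, mul_comm, Real.exp_mul, Real.exp_log (by norm_num), Real.rpow_natCast]
    simp
  have hQ0 : 0 ≤ Q := ENNReal.toReal_nonneg
  have hβ0 : 0 ≤ β := by
    by_contra! hneg
    have : (0 : ℝ) ≤ (9 * m + 643 : ℕ) * Real.log 68 := by positivity
    nlinarith
  rw [h3, weight, weight, ← Real.exp_add, Real.exp_le_exp]
  have h4 := mul_le_mul_of_nonneg_left h1 hβ0
  have h5 := mul_le_mul_of_nonneg_right hβ hQ0
  have h6 := mul_le_mul_of_nonneg_right h2 hlog.le
  linarith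

/-! ### The Peierls bound. -/

lemma sum_weight_flip (α : ℝ) (h : ℤ → ℝ) (β : ℝ) {B Λ : Finset ℤ} (hB : B ⊆ Λ) (ω : Config) :
    ∑ τ : Λ → Bool, weight α h β Λ (flip B (glue Λ τ ω)) = partitionFunction α h β Λ ω := by
  set T : (Λ → Bool) → (Λ → Bool) := fun τ x => if (x : ℤ) ∈ B then !τ x else τ x with hT
  have hinv : Function.Involutive T := by
    intro τ
    funext x
    by_cases hx : (x : ℤ) ∈ B <;> simp [hT, hx]
  refine Fintype.sum_equiv hinv.toPerm _ _ fun τ => ?_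
  congr 1
  funext x
  by_cases hx : x ∈ Λ
  · simp only [flip, glue_apply_mem hx, Function.Involutive.coe_toPerm, hT]
  · simp only [flip, glue_apply_not_mem hx, if_neg fun h => hx (hB h)]

/-- The Peierls bound. -/
lemma half_le_spin_mul_magnetization {α : ℝ} (hα : 1 < α) (hα₂ : α ≤ 2) {h : ℤ → ℝ} {κ : ℝ}
    (hκ : 0 ≤ κ) (hnn : ∀ x, 0 ≤ h x) (h0 : h 0 = 0)
    (hh : ∀ x ≠ 0, h x ≤ κ * |(x : ℝ)| ^ (1 - α)) (hκ1 : κ < 1) {m : ℕ} (hm : 64 ≤ m)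
    (hcoef : 4 * ENNReal.ofReal (((2 ^ (m / 4 - 5) : ℕ) : ℝ) ^ (1 - α)) + 1024 * 2⁻¹ ^ (m / 4) ≤
      ENNReal.ofReal ((1 - κ) / 4))
    {β : ℝ} (hβ : (9 * m + 643 : ℕ) * Real.log 68 ≤ β * ((1 - κ) / 2)) (b : Bool) (L : ℕ) :
    1 / 2 ≤ spin b * magnetization α h β b L := by
  classical
  set Λ := box L with hΛ
  set ω : Config := fun _ => b with hω
  set Z := partitionFunction α h β Λ ω with hZ
  have hZpos : 0 < Z := partitionFunction_pos α h β Λ ω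
  -- A boundary point sits to the right of the bond that it marks, hence the extra point L + 1.
  set G := (Finset.Icc (-L : ℤ) (L + 1)).powerset.filter
    (fun γ => γ.Nonempty ∧ Even γ.card ∧ (0 : ℤ) ∈ inside γ) with hG
  set B : Finset ℤ → Finset ℤ := fun γ => Λ.filter (· ∈ inside γ) with hB
  set e : Finset ℤ → ℕ := fun γ => scaleExp m (scaleIndex m γ) + 3 with he
  have hBsub : ∀ γ, B γ ⊆ Λ := fun γ => Finset.filter_subset _ _
  have hpeierls : ∑ γ ∈ G, (1 / 68 : ℝ) ^ blockCount γ (e γ) ≤ 1 / 4 := by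
    refine sum_pow_blockCount_le (κ := e) (fun γ hγ => (Finset.mem_filter.1 hγ).2.1)
      (fun γ _ => by simp only [he]; omega) fun γ hγ => ?_
    exact subset_Ico_of_zero_mem_inside (by omega) (Finset.mem_filter.1 hγ).2.2.1
      (Finset.mem_filter.1 hγ).2.2.2
  -- A wrong spin at the origin puts it inside some contour of the configuration; the bound then
  -- forgets which one and sums over all candidates.
  have hbad : ∀ τ : Λ → Bool, glue Λ τ ω 0 ≠ b → weight α h β Λ (glue Λ τ ω) ≤
      ∑ γ ∈ G, (1 / 68 : ℝ) ^ blockCount γ (e γ) * weight α h β Λ (flip (B γ) (glue Λ τ ω)) := by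
    intro τ hτ
    set σ := glue Λ τ ω with hσ
    set A := Λ.filter (fun x => σ x ≠ b) with hAdef
    have hA : ∀ x, x ∈ A ↔ σ x ≠ b := by
      intro x
      rw [hAdef, Finset.mem_filter, and_iff_right_iff_imp]
      intro hx
      by_contra hxΛ
      exact hx (glue_apply_not_mem hxΛ)
    have h0A : (0 : ℤ) ∈ inside (boundary A) := mem_inside_boundary.2 ((hA 0).2 hτ)
    have hne : (boundary A).Nonempty := by
      obtain ⟨p, hp, -⟩ := exists_le_of_mem_inside h0A
      exact ⟨p, hp⟩
    obtain ⟨P, hP, hu⟩ := exists_contourFamily (by omega : 16 ≤ m) hne (even_card_boundary A)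
    obtain ⟨γ, hγ, h0γ⟩ := hP.exists_mem_inside h0A
    have hsub : γ ⊆ Finset.Icc (-L : ℤ) (L + 1) := by
      intro p hp
      have hpA : p ∈ boundary A := by
        rw [← hP.union]
        exact Finset.mem_biUnion.2 ⟨γ, hγ, hp⟩
      rw [mem_boundary] at hpA
      have hbox : ∀ x ∈ A, -(L : ℤ) ≤ x ∧ x ≤ L := fun x hx =>
        mem_box.1 (Finset.mem_filter.1 hx).1
      rw [Finset.mem_Icc]
      by_cases h1 : p ∈ A
      · have := hbox p h1; omega
      · have := hbox (p - 1) (by tauto); omega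
    have hγe : Even γ.card := hP.even γ hγ
    have hBγ : (B γ : Set ℤ) = inside γ := by
      ext x
      rw [Finset.mem_coe, hB, Finset.mem_filter, and_iff_right_iff_imp]
      intro hx
      obtain ⟨p, hp, hpx⟩ := exists_le_of_mem_inside hx
      obtain ⟨q, hq, hqx⟩ := exists_lt_of_mem_inside hγe hx
      have h1 := Finset.mem_Icc.1 (hsub hp)
      have h2 := Finset.mem_Icc.1 (hsub hq)
      rw [hΛ, mem_box]
      omega
    refine (weight_le_pow_mul_weight_flip hα hα₂ hκ hnn h0 hh hκ1 hm hcoef hβ hA hP hγ (hu γ hγ)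
      hBγ (hBsub γ)).trans ?_
    refine Finset.single_le_sum (f := fun γ => (1 / 68 : ℝ) ^ blockCount γ (e γ) *
      weight α h β Λ (flip (B γ) σ)) (fun γ _ => mul_nonneg (by positivity)
        (weight_pos _ _ _ _ _).le) ?_
    exact Finset.mem_filter.2 ⟨Finset.mem_powerset.2 hsub, hP.nonempty γ hγ, hγe, h0γ⟩
  -- After exchanging the sums, each flip permutes the configurations and contributes a full
  -- partition function.
  have hmass : ∑ τ : Λ → Bool, (if glue Λ τ ω 0 ≠ b then weight α h β Λ (glue Λ τ ω) else 0) ≤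
      1 / 4 * Z := by
    calc ∑ τ : Λ → Bool, (if glue Λ τ ω 0 ≠ b then weight α h β Λ (glue Λ τ ω) else 0)
        ≤ ∑ τ : Λ → Bool, ∑ γ ∈ G, (1 / 68 : ℝ) ^ blockCount γ (e γ) *
            weight α h β Λ (flip (B γ) (glue Λ τ ω)) := by
          refine Finset.sum_le_sum fun τ _ => ?_
          split_ifs with hτ
          · exact hbad τ hτ
          · exact Finset.sum_nonneg fun γ _ => mul_nonneg (by positivity)
              (weight_pos _ _ _ _ _).le
      _ = (∑ γ ∈ G, (1 / 68 : ℝ) ^ blockCount γ (e γ)) * Z := by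
          rw [Finset.sum_comm, Finset.sum_mul]
          refine Finset.sum_congr rfl fun γ _ => ?_
          rw [← Finset.mul_sum, sum_weight_flip α h β (hBsub γ)]
      _ ≤ 1 / 4 * Z := by gcongr
  rw [magnetization, ← gibbsExp_const_mul, gibbsExp_eq, le_div_iff₀ hZpos]
  have hsum : ∑ τ : Λ → Bool, spin b * spin (glue Λ τ ω 0) * weight α h β Λ (glue Λ τ ω) =
      Z - 2 * ∑ τ : Λ → Bool,
        (if glue Λ τ ω 0 ≠ b then weight α h β Λ (glue Λ τ ω) else 0) := by
    rw [hZ, partitionFunction_eq, Finset.mul_sum, ← Finset.sum_sub_distrib]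
    refine Finset.sum_congr rfl fun τ _ => ?_
    have hs : ∀ a : Bool, spin b * spin a = if a ≠ b then -1 else 1 := fun a => by
      cases a <;> cases b <;> simp [spin]
    rw [hs]
    split_ifs <;> ring
  rw [hsum]
  linarith

/-! ### Conclusion for decaying fields. -/

/-- A field that is, off a finite set, a small multiple of the critical one does not destroy the
phase transition. -/
theorem hasPhaseTransition_of_field_le {α : ℝ} (hα : 1 < α) (hα₂ : α ≤ 2) {h : ℤ → ℝ} {κ : ℝ}
    (hκ : 0 ≤ κ) (hκ1 : κ < 1) {D : Finset ℤ} (h0D : (0 : ℤ) ∈ D)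
    (hh : ∀ x ∉ D, 0 ≤ h x ∧ h x ≤ κ * |(x : ℝ)| ^ (1 - α)) : HasPhaseTransition α h := by
  obtain ⟨m, hm, hcoef⟩ := exists_scale_parameter hα (by linarith : 0 < (1 - κ) / 4)
  have hlog : 0 < Real.log 68 := Real.log_pos (by norm_num)
  have hη : 0 < (1 - κ) / 2 := by linarith
  -- The Peierls bound is applied to the field erased on `D`; the true field is a finite
  -- perturbation of it.
  set h' : ℤ → ℝ := fun x => if x ∈ D then 0 else h x with hh'
  have h1 : ∀ x, 0 ≤ h' x := fun x => by
    by_cases hx : x ∈ D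
    · simp [hh', hx]
    · simp [hh', hx, (hh x hx).1]
  have h2 : ∀ x ≠ 0, h' x ≤ κ * |(x : ℝ)| ^ (1 - α) := fun x _ => by
    by_cases hx : x ∈ D
    · simp only [hh', hx, if_true]
      positivity
    · simp [hh', hx, (hh x hx).2]
  refine hasPhaseTransition_of_separated hα h
    (β₀ := (9 * m + 643 : ℕ) * Real.log 68 / ((1 - κ) / 2)) (by positivity) fun β hβ => ?_
  have hβpos : 0 < β := lt_of_lt_of_le (by positivity) hβ
  have hmag := fun b L => half_le_spin_mul_magnetization hα hα₂ hκ h1 (if_pos h0D) h2 hκ1 hm hcoef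
    ((div_le_iff₀ hη).1 hβ) b L
  refine exists_separated_of_field_eq_off hα (h' := h') hβpos (D := D)
    (fun x hx => (if_neg hx).symm) (fun L => ?_) fun L => ?_
  · have := hmag false L
    rw [spin_false] at this
    linarith
  · have := hmag true L
    rwa [spin_true, one_mul] at this

/-- The field decays faster than the critical one, so outside a large interval it is below half of
|x|^(1-α), however large `hs` is. -/
lemma hasPhaseTransition_decayingField_of_lt {α δ hs : ℝ} (hα : 1 < α) (hα₂ : α ≤ 2)
    (hhs : 0 ≤ hs) (hδ : α - 1 < δ) : HasPhaseTransition α (decayingField hs δ) := by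
  have hlim : Tendsto (fun x : ℝ => hs * x ^ (-(δ - (α - 1)))) atTop (𝓝 (hs * 0)) :=
    (tendsto_rpow_neg_atTop (by linarith)).const_mul hs
  rw [mul_zero] at hlim
  obtain ⟨R, hR⟩ := eventually_atTop.1 (hlim.eventually_le_const (by norm_num : (0 : ℝ) < 1 / 2))
  obtain ⟨N, hN⟩ := exists_nat_ge R
  refine hasPhaseTransition_of_field_le hα hα₂ (κ := 1 / 2) (by norm_num) (by norm_num)
    (D := Finset.Icc (-N : ℤ) N) (Finset.mem_Icc.2 ⟨by omega, by omega⟩) fun x hx => ?_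
  have hx0 : x ≠ 0 := by
    rintro rfl
    exact hx (Finset.mem_Icc.2 ⟨by omega, by omega⟩)
  have hxpos : 0 < |(x : ℝ)| := abs_pos.2 (Int.cast_ne_zero.2 hx0)
  have hxN : (N : ℝ) ≤ |(x : ℝ)| := by
    have : (N : ℤ) ≤ |x| := by
      rw [Finset.mem_Icc, ← abs_le] at hx
      omega
    exact_mod_cast this
  rw [decayingField, if_neg hx0]
  refine ⟨by positivity, ?_⟩
  have h1 := hR _ (hN.trans hxN)
  calc hs * |(x : ℝ)| ^ (-δ) = hs * |(x : ℝ)| ^ (-(δ - (α - 1))) * |(x : ℝ)| ^ (1 - α) := by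
        rw [mul_assoc, ← Real.rpow_add hxpos]
        congr 2
        ring
    _ ≤ 1 / 2 * |(x : ℝ)| ^ (1 - α) := by gcongr

lemma hasPhaseTransition_decayingField_critical {α hs : ℝ} (hα : 1 < α) (hα₂ : α ≤ 2)
    (hhs : 0 ≤ hs) (hhs₁ : hs < 1) : HasPhaseTransition α (decayingField hs (α - 1)) := by
  refine hasPhaseTransition_of_field_le hα hα₂ hhs hhs₁ (D := {0}) (Finset.mem_singleton_self 0)
    fun x hx => ?_
  rw [decayingField, if_neg (by simpa using hx), neg_sub]
  exact ⟨by positivity, le_rfl⟩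

end LongRangeIsing

theorem mainTheorem3 (α δ hs : ℝ) (hα₁ : 1 < α) (hα₂ : α ≤ 2) (hhs : 0 ≤ hs) :
    (α - 1 < δ →
      LongRangeIsing.HasPhaseTransition α (LongRangeIsing.decayingField hs δ)) ∧
    (δ = α - 1 → α < 2 → hs < (8 - 4 * α) / ((2 : ℝ) ^ (3 - α) + 6 - 3 * α) →
      LongRangeIsing.HasPhaseTransition α (LongRangeIsing.decayingField hs δ)) ∧
    (δ = α - 1 → α = 2 → hs < 4 / (3 + 2 * Real.log 2) →
      LongRangeIsing.HasPhaseTransition α (LongRangeIsing.decayingField hs δ)) := by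
  refine ⟨fun hδ => LongRangeIsing.hasPhaseTransition_decayingField_of_lt hα₁ hα₂ hhs hδ, ?_, ?_⟩
  · rintro rfl hα h
    refine LongRangeIsing.hasPhaseTransition_decayingField_critical hα₁ hα₂ hhs (h.trans_le ?_)
    -- This puts the stated threshold below 1, the bound that the argument reaches for every α: 8 −
    -- 4α ≤ 2 + 6 − 3α.
    have h1 : (2 : ℝ) ^ (1 : ℝ) ≤ 2 ^ (3 - α) :=
      Real.rpow_le_rpow_of_exponent_le one_le_two (by linarith)
    rw [Real.rpow_one] at h1
    exact div_le_one_of_le₀ (by linarith) (by linarith)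
  · rintro rfl - h
    refine LongRangeIsing.hasPhaseTransition_decayingField_critical hα₁ hα₂ hhs (h.trans_le ?_)
    -- Only 2 log 2 ≥ 1 is needed, so that the threshold is again at most 1.
    have h1 := Real.log_two_gt_d9
    exact div_le_one_of_le₀ (by linarith) (by linarith)
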